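/- Let $\Omega\subset\mathbb{C}$ be a simply connected domain and $z_0\in\Omega$. Equip $\mathbb{C}P^2$ with the Fubini--Study metric for which the Hopf map $S^5\to\mathbb{C}P^2$ is a Riemannian submersion, and with its Kähler form $\omega$. Let $\mathcal{U}$ be the set of smooth conformal Lagrangian immersions $u:\Omega\to\mathbb{C}P^2$ with $u(z_0)=[0:0:1]$ that are Hamiltonian stationary, i.e. such that $\frac{d}{dt}\big|_{t=0}\mathrm{Area}(u_t|_K)=0$ for every smooth variation $(u_t)$ of $u_0=u$ that is fixed outside a compact set $K\subset\Omega$ and whose variation field $\xi$ satisfies $\omega(\xi,du(\cdot))=-df$ for some $f\in C^\infty_c(\Omega,\mathbb{R})$. A *Legendrian framing* of $u$ is a smooth map $F:\Omega\to U(3)$ whose last column $\widehat u$ is a horizontal lift of $u$ (i.e. $u=[\widehat u]$ and $\langle d\widehat u,\widehat u\rangle=0$) and such that $\det F=e^{-2\rho}\det(\partial_x\widehat u,\partial_y\widehat u,\widehat u)$, where $e^{2\rho}(dx^2+dy^2)$ is the metric induced by $u$. Let $J=\begin{pmatrix}0&-1\\1&0\end{pmatrix}$, $\tau(M)=\begin{pmatrix}-J&0\\0&1\end{pmatrix}({}^tM)^{-1}\begin{pmatrix}J&0\\0&1\end{pmatrix}$,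 and let $\Lambda U(3)_\tau$ be the group of continuous loops $S^1\ni\lambda\mapsto g_\lambda\in U(3)$ with $\tau(g_\lambda)=g_{i\lambda}$ for all $\lambda$. Let $\mathcal{F}$ be the set of smooth maps $F_\lambda:\Omega\to\Lambda U(3)_\tau$ (smooth as maps into the Banach space of continuous matrix-valued loops) such that $F_\lambda(z_0)=\mathrm{Id}$ and the Fourier decomposition $A_\lambda=\sum_{k\in\mathbb{Z}}\widehat A_k\lambda^k$ of $A_\lambda:=F_\lambda^{-1}dF_\lambda$ satisfies $$\widehat A_k=0\ \text{ for all } k\le -3,\qquad \widehat A_{-2}=a(z)\,dz\,\mathrm{diag}(i,i,0)\ \text{ with } a\in C^\infty(\Omega,\mathbb{C}),\qquad \widehat A_{-1}(\partial/\partial\bar z)=0,$$ and $\widehat A_{-1}(\partial/\partial z)\neq 0$ at every point of $\Omega$. Call $F_\lambda,F'_\lambda\in\mathcal{F}$ *gauge equivalent* if $F'_\lambda=F_\lambda\begin{pmatrix}g&0\\0&1\end{pmatrix}$ for a smooth map $g:\Omega\to SU(2)$ independent of $\lambda$. Then: 1. $F_\lambda\mapsto F_1:=F_{\lambda=1}$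 is a bijection from $\mathcal{F}$ onto the set of all Legendrian framings $F$ with $F(z_0)=\mathrm{Id}$ of elements $u$ of $\mathcal{U}$. 2. The map $(c,[F_\lambda])\mapsto u$, $u(z)=\big[\mathrm{diag}(c,1,1)\,F_1(z)\,e_3\big]$, with $e_3={}^t(0,0,1)$, is well defined and is a bijection from $S^1\times(\mathcal{F}/\text{gauge equivalence})$ onto $\mathcal{U}$. -/

import Mathlib

open scoped ContDiff

noncomputable section

namespace HSLagrangian

/-- Complex `3 × 3` matrices. -/
abbrev Mat3 := Matrix (Fin 3) (Fin 3) ℂ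

/-- The unitary group `U(3)`. -/
abbrev U3 := Matrix.unitaryGroup (Fin 3) ℂ

/-- The complex projective plane: lines in `ℂ³`. -/
abbrev CP2 := Projectivization ℂ (Fin 3 → ℂ)

/-! ### Calculus on a domain `Ω ⊆ ℂ`

Maps are defined on the subtype `Ω`; to differentiate them at a point of the open set `Ω` they
are extended by zero to `ℂ` (the values outside `Ω` are irrelevant). -/

/-- Extension by zero to the whole plane of a map defined on `Ω`. -/
def zeroExt {Ω : Set ℂ} {E : Type*} [Zero E] (f : Ω → E) : ℂ → E :=
  Function.extend Subtype.val f 0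

/-- The real differential of a matrix valued map at `z`, applied to the tangent vector `X`. -/
def dMat (M : ℂ → Mat3) (z X : ℂ) : Mat3 :=
  Matrix.of fun i j => fderiv ℝ (fun w => M w i j) z X

/-- Smoothness on `Ω` (over `ℝ`) of a matrix valued map. -/
def SmoothMatOn (M : ℂ → Mat3) (Ω : Set ℂ) : Prop :=
  ∀ i j, ContDiffOn ℝ ∞ (fun z => M z i j) Ω

/-! ### The complex projective plane with its Fubini–Study structure

A line `p = [w]` is identified with the orthogonal projector `w w† / |w|²`. This is the usual
embedding of `ℂP²` as a submanifold of the space of Hermitian matrices. If `|w| = 1` and `v`, `v'`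
are Hermitian orthogonal to `w`, then the tangent vectors at `[w]` with horizontal lifts `v`, `v'`
are `S = v w† + w v†`, `T = v' w† + w v'†`, and `tr (P S T) = v† v'`. So the real part of
`tr (P S T)` is the Fubini–Study metric for which the Hopf map `S⁵ → ℂP²` is a Riemannian
submersion, and the imaginary part is its Kähler form. -/

/-- The orthogonal projector of `ℂ³` onto a line. -/
def proj (p : CP2) : Mat3 :=
  (p.rep ⬝ᵥ star p.rep)⁻¹ • Matrix.vecMulVec p.rep (star p.rep)

/-- The projector does not depend on the vector that represents the line. -/
theorem proj_mk (w : Fin 3 → ℂ) (hw : w ≠ 0) :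
    proj (Projectivization.mk ℂ w hw) = (w ⬝ᵥ star w)⁻¹ • Matrix.vecMulVec w (star w) := by
  obtain ⟨a, ha⟩ := Projectivization.exists_smul_eq_mk_rep ℂ w hw
  have ha0 : (a : ℂ) ≠ 0 := a.ne_zero
  have hs : star (a : ℂ) ≠ 0 := star_ne_zero.mpr ha0
  have ha' : (Projectivization.mk ℂ w hw).rep = (a : ℂ) • w := ha.symm
  unfold proj
  rw [ha']
  ext i j
  simp only [star_smul, dotProduct_smul, smul_dotProduct, Matrix.smul_apply,
    Matrix.vecMulVec_apply, Pi.smul_apply, smul_eq_mul, mul_inv]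
  field_simp

/-- The map `u : Ω → ℂP²`, seen as a field of projectors. -/
def projField {Ω : Set ℂ} (u : Ω → CP2) : ℂ → Mat3 :=
  zeroExt fun z => proj (u z)

/-- Pull-back by `u` of the Fubini–Study metric, at `z`. -/
def metric {Ω : Set ℂ} (u : Ω → CP2) (z X Y : ℂ) : ℝ :=
  (Matrix.trace (projField u z * dMat (projField u) z X * dMat (projField u) z Y)).re

/-- Pull-back by `u` of the Kähler form, at `z`. -/
def kahler {Ω : Set ℂ} (u : Ω → CP2) (z X Y : ℂ) : ℝ :=
  (Matrix.trace (projField u z * dMat (projField u) z X * dMat (projField u) z Y)).im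

/-- `u` is smooth. -/
def IsSmooth {Ω : Set ℂ} (u : Ω → CP2) : Prop :=
  SmoothMatOn (projField u) Ω

/-- The differential of `u` is injective at every point. -/
def IsImmersion {Ω : Set ℂ} (u : Ω → CP2) : Prop :=
  ∀ z ∈ Ω, ∀ X : ℂ, dMat (projField u) z X = 0 → X = 0

/-- The induced metric is `e^{2ρ} (dx² + dy²)`. -/
def IsConformal {Ω : Set ℂ} (u : Ω → CP2) : Prop :=
  ∀ z ∈ Ω, ∃ ρ : ℝ, ∀ X Y : ℂ,
    metric u z X Y = Real.exp (2 * ρ) * (X * (starRingEnd ℂ) Y).re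

/-- `u^* ω = 0`. -/
def IsLagrangian {Ω : Set ℂ} (u : Ω → CP2) : Prop :=
  ∀ z ∈ Ω, ∀ X Y : ℂ, kahler u z X Y = 0

/-- Area of `u` restricted to `K`. -/
def area {Ω : Set ℂ} (K : Set ℂ) (u : Ω → CP2) : ℝ :=
  ∫ z in K, Real.sqrt
    (metric u z 1 1 * metric u z Complex.I Complex.I - metric u z 1 Complex.I ^ 2)

/-- `U` is a smooth variation `(U t)` of `u`, `U 0 = u`, that is fixed outside the compact subset
`K` of `Ω`. -/
structure IsVariation {Ω : Set ℂ} (u : Ω → CP2) (U : ℝ → Ω → CP2) (K : Set ℂ) : Prop where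
  smooth : ∀ i j, ContDiffOn ℝ ∞ (fun p : ℝ × ℂ => projField (U p.1) p.2 i j) (Set.univ ×ˢ Ω)
  initial : U 0 = u
  compact : IsCompact K
  subset : K ⊆ Ω
  fixed : ∀ (t : ℝ) (z : Ω), (z : ℂ) ∉ K → U t z = u z

/-- The variation vector field `∂U/∂t` at `t = 0`. -/
def variationField {Ω : Set ℂ} (U : ℝ → Ω → CP2) (z : ℂ) : Mat3 :=
  Matrix.of fun i j => deriv (fun t => projField (U t) z i j) 0

/-- The variation vector field `ξ` is Hamiltonian with compact support along `u`: one has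
`ω(ξ, du(X)) + df(X) = 0` for a smooth real function `f` with compact support in `Ω`. -/
def IsHamiltonianVariation {Ω : Set ℂ} (u : Ω → CP2) (U : ℝ → Ω → CP2) : Prop :=
  ∃ f : ℂ → ℝ, ContDiff ℝ ∞ f ∧ HasCompactSupport f ∧ tsupport f ⊆ Ω ∧
    ∀ z ∈ Ω, ∀ X : ℂ,
      (Matrix.trace (projField u z * variationField U z * dMat (projField u) z X)).im
        + fderiv ℝ f z X = 0

/-- `u` is a critical point of the area under Hamiltonian variations with compact support. -/
def IsHamiltonianStationary {Ω : Set ℂ} (u : Ω → CP2) : Prop :=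
  ∀ (U : ℝ → Ω → CP2) (K : Set ℂ), IsVariation u U K → IsHamiltonianVariation u U →
    HasDerivAt (fun t => area K (U t)) 0 0

/-- The point `[0 : 0 : 1]`. -/
def basePoint : CP2 :=
  Projectivization.mk ℂ ![0, 0, 1] (by
    intro h
    have := congrFun h 2
    simp at this)

/-- The Hamiltonian stationary conformal Lagrangian immersions `u : Ω → ℂP²` with
`u(z₀) = [0 : 0 : 1]`. -/
def stationaryImmersions (Ω : Set ℂ) (z₀ : Ω) : Set (Ω → CP2) :=
  {u | IsSmooth u ∧ IsImmersion u ∧ IsConformal u ∧ IsLagrangian u ∧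
    IsHamiltonianStationary u ∧ u z₀ = basePoint}

/-! ### Legendrian framings -/

theorem lastCol_ne_zero (g : U3) : (fun i => (g : Mat3) i 2) ≠ 0 := by
  intro h
  have h1 : star (g : Mat3) * (g : Mat3) = 1 := Matrix.UnitaryGroup.star_mul_self g
  have h2 := congrFun (congrFun h1 2) 2
  have h3 : ∀ i, (g : Mat3) i 2 = 0 := fun i => congrFun h i
  simp [Matrix.mul_apply, h3] at h2

/-- The complex line spanned by the last column of a unitary matrix. -/
def lastColLine (g : U3) : CP2 :=
  Projectivization.mk ℂ (fun i => (g : Mat3) i 2) (lastCol_ne_zero g)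

/-- A map `Ω → U(3)`, seen as a matrix valued map. -/
def matField {Ω : Set ℂ} (F : Ω → U3) : ℂ → Mat3 :=
  zeroExt fun z => (F z : Mat3)

/-- `F : Ω → U(3)` is a Legendrian framing of the conformal immersion `u`: its last column `û` is
a horizontal lift of `u` to `S⁵`, and `det F` is equal to
`exp (iβ) = e^{-2ρ} det (∂û/∂x, ∂û/∂y, û)`, where `e^{2ρ} (dx² + dy²)` is the induced metric and
`β` is the Lagrangian angle along `û`. -/
structure IsLegendrianFraming {Ω : Set ℂ} (u : Ω → CP2) (F : Ω → U3) : Prop where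
  smooth : SmoothMatOn (matField F) Ω
  lift : ∀ z, u z = lastColLine (F z)
  horizontal : ∀ (z : Ω) (X : ℂ),
    ∑ i, (starRingEnd ℂ) ((F z : Mat3) i 2) * dMat (matField F) z X i 2 = 0
  angle : ∀ z : Ω, ((metric u z 1 1 : ℝ) : ℂ) * (F z : Mat3).det =
    (Matrix.of fun i j => ![dMat (matField F) z 1 i 2, dMat (matField F) z Complex.I i 2,
      (F z : Mat3) i 2] j : Mat3).det

/-! ### The twisted loop group -/

/-- The automorphism `τ(M) = diag(-J, 1) (ᵗM)⁻¹ diag(J, 1)` with `J = (0, -1; 1, 0)`. -/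
def tau (M : Mat3) : Mat3 :=
  !![0, 1, 0; -1, 0, 0; 0, 0, 1] * (M.transpose)⁻¹ * !![0, -1, 0; 1, 0, 0; 0, 0, 1]

theorem tau_one : tau 1 = 1 := by
  ext i j
  fin_cases i <;> fin_cases j <;> simp [tau, Matrix.mul_apply, Fin.sum_univ_three]

theorem tau_mul (M N : Mat3) : tau (M * N) = tau M * tau N := by
  have h : (!![0, -1, 0; 1, 0, 0; 0, 0, 1] : Mat3) * !![0, 1, 0; -1, 0, 0; 0, 0, 1] = 1 := by
    ext i j
    fin_cases i <;> fin_cases j <;> simp [Matrix.mul_apply, Fin.sum_univ_three]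
  unfold tau
  rw [Matrix.transpose_mul, Matrix.mul_inv_rev]
  calc _ = (!![0, 1, 0; -1, 0, 0; 0, 0, 1] : Mat3) * M.transpose⁻¹ * 1 * N.transpose⁻¹
        * !![0, -1, 0; 1, 0, 0; 0, 0, 1] := by simp only [Matrix.mul_one, Matrix.mul_assoc]
    _ = _ := by rw [← h]; simp only [Matrix.mul_assoc]

/-- The number `i` as a point of the unit circle. -/
def circleI : Circle := ⟨Complex.I, by simp [Submonoid.unitSphere]⟩

/-- The twisted loop group: continuous loops `λ ↦ g_λ` in `U(3)` with `τ(g_λ) = g_{iλ}`. -/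
def twistedLoopGroup : Subgroup C(Circle, U3) where
  carrier := {g | ∀ l : Circle, tau (g l : Mat3) = (g (circleI * l) : Mat3)}
  one_mem' := by
    intro l
    simpa using tau_one
  mul_mem' := by
    intro a b ha hb l
    have h1 : (((a * b) l : U3) : Mat3) = (a l : Mat3) * (b l : Mat3) := rfl
    have h2 : (((a * b) (circleI * l) : U3) : Mat3)
        = (a (circleI * l) : Mat3) * (b (circleI * l) : Mat3) := rfl
    rw [h1, h2, tau_mul, ha l, hb l]
  inv_mem' := by
    intro a ha l
    have key : ∀ g : U3, tau (((g⁻¹ : U3)) : Mat3) * tau (g : Mat3) = 1 := by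
      intro g
      rw [← tau_mul, ← tau_one]
      congr 1
      simp
    have h1 : tau (((a l)⁻¹ : U3) : Mat3) * (a (circleI * l) : Mat3) = 1 := by
      rw [← ha l]
      exact key (a l)
    have h2 : (a (circleI * l) : Mat3) * (((a (circleI * l))⁻¹ : U3) : Mat3) = 1 := by
      simp
    change tau (((a l)⁻¹ : U3) : Mat3) = (((a (circleI * l))⁻¹ : U3) : Mat3)
    calc tau (((a l)⁻¹ : U3) : Mat3)
        = tau (((a l)⁻¹ : U3) : Mat3)
            * ((a (circleI * l) : Mat3) * (((a (circleI * l))⁻¹ : U3) : Mat3)) := by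
          rw [h2, mul_one]
      _ = _ := by rw [← mul_assoc, h1, one_mul]

/-- The `(i, j)` entry of a loop of unitary matrices, a continuous complex function on the
circle. -/
def entryLoop (g : C(Circle, U3)) (i j : Fin 3) : C(Circle, ℂ) where
  toFun l := (g l : Mat3) i j
  continuous_toFun :=
    ((continuous_subtype_val.comp g.continuous).matrix_elem i j)

variable {Ω : Set ℂ}

/-- The map `F_λ : Ω → U(3)` for a fixed `λ`. -/
def atParam (F : Ω → twistedLoopGroup) (l : Circle) (z : Ω) : U3 :=
  (F z : C(Circle, U3)) l

/-- The Maurer–Cartan form `A_λ = F_λ⁻¹ dF_λ` at `z`, applied to the real tangent vector `X`. -/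
def maurerCartan (F : Ω → twistedLoopGroup) (l : Circle) (z : Ω) (X : ℂ) : Mat3 :=
  (((atParam F l z)⁻¹ : U3) : Mat3) * dMat (matField (atParam F l)) z X

/-- The Fourier coefficient of order `k` of `λ ↦ A_λ`, a matrix valued real 1-form. -/
def fourierMode (F : Ω → twistedLoopGroup) (k : ℤ) (z : Ω) (X : ℂ) : Mat3 :=
  Matrix.of fun i j => (2 * Real.pi : ℂ)⁻¹ * ∫ θ in (0 : ℝ)..(2 * Real.pi),
    Complex.exp (-(k * θ * Complex.I)) * maurerCartan F (Circle.exp θ) z X i j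

/-- The coefficient on `∂/∂z` of the Fourier mode of order `k`. -/
def fourierModeDz (F : Ω → twistedLoopGroup) (k : ℤ) (z : Ω) : Mat3 :=
  (1 / 2 : ℂ) • (fourierMode F k z 1 - Complex.I • fourierMode F k z Complex.I)

/-- The coefficient on `∂/∂z̄` of the Fourier mode of order `k`. -/
def fourierModeDzbar (F : Ω → twistedLoopGroup) (k : ℤ) (z : Ω) : Mat3 :=
  (1 / 2 : ℂ) • (fourierMode F k z 1 + Complex.I • fourierMode F k z Complex.I)

/-- The smooth maps `F_λ` from `Ω` to the twisted loop group with `F_λ(z₀) = Id` and the required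
Fourier modes. Smoothness is that of a map into the Banach space of continuous loops. -/
structure IsExtendedFraming (z₀ : Ω) (F : Ω → twistedLoopGroup) : Prop where
  smooth : ∀ i j, ContDiffOn ℝ ∞ (zeroExt fun z => entryLoop (F z : C(Circle, U3)) i j) Ω
  base : F z₀ = 1
  mode_le_neg_three : ∀ k : ℤ, k ≤ -3 → ∀ z X, fourierMode F k z X = 0
  mode_neg_two : ∃ a : ℂ → ℂ, ContDiffOn ℝ ∞ a Ω ∧ ∀ (z : Ω) (X : ℂ),
    fourierMode F (-2) z X = (a z * X) • Matrix.diagonal ![Complex.I, Complex.I, 0]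
  mode_neg_one : ∀ z, fourierModeDzbar F (-1) z = 0
  /-- This expresses that the surface is immersed. -/
  nondegenerate : ∀ z, fourierModeDz F (-1) z ≠ 0

/-- The set of the maps `F_λ`. -/
def ExtendedFraming (z₀ : Ω) : Type :=
  {F : Ω → twistedLoopGroup // IsExtendedFraming z₀ F}

/-! ### Gauge equivalence -/

/-- The embedding `g ↦ diag(g, 1)` of `2 × 2` matrices. -/
def embed (g : Matrix (Fin 2) (Fin 2) ℂ) : Mat3 :=
  !![g 0 0, g 0 1, 0; g 1 0, g 1 1, 0; 0, 0, 1]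

theorem embed_one : embed 1 = 1 := by
  ext i j
  fin_cases i <;> fin_cases j <;> simp [embed]

theorem embed_mul (g h : Matrix (Fin 2) (Fin 2) ℂ) : embed (g * h) = embed g * embed h := by
  ext i j
  fin_cases i <;> fin_cases j <;>
    simp [embed, Matrix.mul_apply, Fin.sum_univ_three, Fin.sum_univ_two]

/-- Gauge equivalence: `F'_λ = F_λ · diag(g, 1)` for a smooth map `g : Ω → SU(2)` that does not
depend on `λ`. -/
def GaugeEquivalent (z₀ : Ω) (F F' : ExtendedFraming z₀) : Prop :=
  ∃ g : Ω → Matrix.specialUnitaryGroup (Fin 2) ℂ,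
    (∀ i j, ContDiffOn ℝ ∞ (zeroExt fun z => (g z : Matrix (Fin 2) (Fin 2) ℂ) i j) Ω) ∧
    ∀ (l : Circle) (z : Ω),
      (atParam F'.1 l z : Mat3) = (atParam F.1 l z : Mat3) * embed (g z)

theorem zeroExt_apply {E : Type*} [Zero E] (f : Ω → E) {z : ℂ} (hz : z ∈ Ω) :
    zeroExt f z = f ⟨z, hz⟩ :=
  Subtype.val_injective.extend_apply f 0 ⟨z, hz⟩

instance gaugeSetoid (z₀ : Ω) : Setoid (ExtendedFraming z₀) where
  r := GaugeEquivalent z₀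
  iseqv := by
    refine ⟨?_, ?_, ?_⟩
    · intro F
      refine ⟨fun _ => 1, ?_, ?_⟩
      · intro i j
        refine (contDiffOn_const (c := (1 : Matrix (Fin 2) (Fin 2) ℂ) i j)).congr ?_
        intro z hz
        rw [zeroExt_apply _ hz]
        rfl
      · intro l z
        have : ((1 : Matrix.specialUnitaryGroup (Fin 2) ℂ) : Matrix (Fin 2) (Fin 2) ℂ) = 1 := rfl
        rw [this, embed_one, mul_one]
    · rintro F F' ⟨g, hg, h⟩
      refine ⟨fun z => (g z)⁻¹, ?_, ?_⟩
      · intro i j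
        refine (Complex.conjCLE.contDiff.comp_contDiffOn (hg j i)).congr ?_
        intro z hz
        rw [Function.comp_apply, zeroExt_apply _ hz, zeroExt_apply _ hz]
        rfl
      · intro l z
        have hgz : (g z : Matrix (Fin 2) (Fin 2) ℂ)
            * (((g z)⁻¹ : Matrix.specialUnitaryGroup (Fin 2) ℂ) : Matrix (Fin 2) (Fin 2) ℂ)
              = 1 := by
          rw [← Submonoid.coe_mul, mul_inv_cancel]
          rfl
        rw [h l z, mul_assoc, ← embed_mul, hgz, embed_one, mul_one]
    · rintro F F' F'' ⟨g, hg, h⟩ ⟨g', hg', h'⟩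
      refine ⟨fun z => g z * g' z, ?_, ?_⟩
      · intro i j
        refine (ContDiffOn.sum (s := Finset.univ)
          fun k _ => (hg i k).mul (hg' k j)).congr ?_
        intro z hz
        simp only [zeroExt_apply _ hz]
        exact Matrix.mul_apply
      · intro l z
        rw [h' l z, h l z, mul_assoc, ← embed_mul]
        rfl

/-- The unitary matrix `diag(c, 1, 1)`, for `|c| = 1`. -/
def rotation (c : Circle) : U3 :=
  ⟨Matrix.diagonal ![(c : ℂ), 1, 1], by
    rw [Matrix.mem_unitaryGroup_iff]
    have hc : (c : ℂ) * (starRingEnd ℂ) (c : ℂ) = 1 := by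
      rw [Complex.mul_conj]
      simp
    ext i j
    fin_cases i <;> fin_cases j <;>
      simp [Matrix.mul_apply, Fin.sum_univ_three, Matrix.star_apply, hc]⟩

/-- The map `z ↦ [R e]`, where `R = diag(c, 1, 1)` and `e` is the last column of
`F_{λ = 1}(z)`; it only depends on the gauge equivalence class of `F_λ`. -/
def toImmersion (z₀ : Ω) (p : Circle × Quotient (gaugeSetoid z₀)) : Ω → CP2 :=
  Quotient.lift (fun (F : ExtendedFraming z₀) (z : Ω) =>
      lastColLine (rotation p.1 * atParam F.1 1 z))
    (by
      rintro F F' ⟨g, -, h⟩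
      funext z
      unfold lastColLine
      congr 1
      funext i
      have hz : ((rotation p.1 * atParam F'.1 1 z : U3) : Mat3)
          = ((rotation p.1 * atParam F.1 1 z : U3) : Mat3) * embed (g z) := by
        simp only [Submonoid.coe_mul]
        rw [h 1 z, mul_assoc]
      rw [hz]
      simp [embed, Matrix.mul_apply, Fin.sum_univ_three]) p.2

end HSLagrangian

end

/-! Everything is read from the Maurer–Cartan form A = F†dF of a unitary frame F whose last column
is a lift û of u. Put α = (A₁₃, A₂₃). A Legendrian framing of a conformal immersion satisfies A₃₃ =
0, α(∂y) = J conj α(∂x) and α(∂x) ≠ 0, and conversely these relations (`IsAdapted`) make [û] a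
conformal Lagrangian immersion with Legendrian framing F. The trace of A is then i dβ, with β the
Lagrangian angle.

Variational side. In an adapted frame, flatness of A gives the tension equation `IsAdapted.tension`:
the tension field is determined by dβ. Along a Hamiltonian variation of potential f, the derivative
of the area is therefore -∫⟨dβ, df⟩. Since every compactly supported f is the potential of an
explicit variation, u is Hamiltonian stationary if and only if β is harmonic
(`HarmonicAngle.isHamiltonianStationary`, `IsHamiltonianStationary.harmonicAngle`).

Loop side. The twisting condition places the coefficient of λ^k in the i^k-eigenspace of the
differential of τ, and unitarity relates the degrees k and -k. Hence the last row and column of A_λ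
have degrees ±1, the scalar part of the 2 × 2 block has degrees ±2, and its traceless part has
degree 0. The coefficients of λ⁻¹ and λ⁻² are multiples of dz, so that multiplying them by a power
of λ⁻¹ amounts to rotating the tangent vector. Thus A_λ is an explicit function `twistForm` of A₁
(`IsExtendedFraming.mc_eq_twistForm`), and F_λ is determined by F₁ and its value at the base point.
The trace of the flatness equation at λ = e^{iπ/4} says that dβ is co-closed. Conversely, the twist
of the form of an adapted frame is flat for all λ: this follows from flatness at λ = 1, the tension
equation and the harmonicity of β (`twistForm_flat`). On a simply connected domain it integrates to
F_λ in the Banach algebra of matrices of continuous loops (`exists_solution`). This is the first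
bijection.

For the second one, a Lagrangian map has a global horizontal lift, unique up to a constant phase,
and (e^{-ρ}∂û/∂x, e^{-ρ}∂û/∂y, û) is an adapted frame (`exists_adapted_frame`). Its value at z₀
factors into a scalar, some diag(c, 1, 1) and an element of SU(2), which yields the parameter c and
a frame equal to Id at z₀. Two frames with the same last column have the same determinant, namely
the angle, so they differ by an SU(2)-valued gauge. This gauge commutes with the insertion of λ
(`twistForm_gauge`), and the determinant at z₀ recovers c. -/

open scoped ContDiff

noncomputable section

namespace HSLagrangian

/-! ### Integration of flat linear systems on simply connected domains. -/

open Set Filter Topology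

/-! ### Gluing local sections over a simply connected space -/

/-- Local maps into a group that differ by locally constant left translations can be glued, up to
such translations, to a global map, if the source is simply connected. -/
theorem exists_glued_of_locallyConst_cocycle {X : Type*} [TopologicalSpace X]
    [SimplyConnectedSpace X] [LocallyPathConnectedSpace X] {G : Type*} [Group G]
    (D : X → Set X) (hD : ∀ i, IsOpen (D i)) (hmem : ∀ i, i ∈ D i) (s : X → X → G)
    (hs : ∀ i j x, x ∈ D i → x ∈ D j →
      ∀ᶠ y in 𝓝 x, s j y * (s i y)⁻¹ = s j x * (s i x)⁻¹) :
    ∃ S : X → G, ∀ x, ∃ k, ∀ᶠ y in 𝓝 x, S y = k * s x y := by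
  -- With G discrete, the locally constant transition functions s_j s_i⁻¹ define a bundle with fibre
  -- G, that is, a covering of X. Since X is simply connected, the identity of X lifts to a section.
  let _ : TopologicalSpace G := ⊥
  have _ : DiscreteTopology G := ⟨rfl⟩
  let Z : FiberBundleCore X X G :=
    { baseSet := D
      isOpen_baseSet := hD
      indexAt := id
      mem_baseSet_at := hmem
      coordChange := fun i j x v => s j x * (s i x)⁻¹ * v
      coordChange_self := by simp
      continuousOn_coordChange := by
        rintro i j ⟨x, v⟩ ⟨⟨hi, hj⟩, -⟩
        refine ContinuousAt.continuousWithinAt ?_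
        rw [ContinuousAt, nhds_discrete G, tendsto_pure, nhds_prod_eq, nhds_discrete G, prod_pure,
          eventually_map]
        filter_upwards [hs i j x hi hj] with y hy
        simp only [hy]
      coordChange_comp := by
        intro i j k x _ v
        group }
  have hcov : IsCoveringMap Z.proj :=
    IsFiberBundle.isCoveringMap (F := G) fun x => ⟨Z.localTriv x, hmem x⟩
  obtain ⟨x₀⟩ : Nonempty X := inferInstance
  obtain ⟨σ, ⟨-, hσ⟩, -⟩ := hcov.existsUnique_continuousMap_lifts (ContinuousMap.id X) x₀
    (⟨x₀, (1 : G)⟩ : Z.TotalSpace) rfl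
  let v : X → G := fun x => (σ x).snd
  have hp : ∀ x, (σ x).proj = x := fun x => congrFun hσ x
  have hcoord : ∀ i y, (Z.localTriv i (σ y)).2 = s i y * (s y y)⁻¹ * v y := by
    intro i y
    rw [Z.localTriv_apply]
    change s i (σ y).proj * (s (σ y).proj (σ y).proj)⁻¹ * v y = _
    rw [hp]
  -- The coordinate of σ in the chart i is s_i(y) g(y), where g(y) = s_y(y)⁻¹ v(y) does not depend
  -- on i. It is locally constant by continuity of σ, so g⁻¹ is locally a constant times s_i.
  refine ⟨fun x => ((s x x)⁻¹ * v x)⁻¹, fun x => ⟨((Z.localTriv x (σ x)).2)⁻¹, ?_⟩⟩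
  have hc : ContinuousAt (fun y => (Z.localTriv x (σ y)).2) x := by
    refine continuous_snd.continuousAt.comp (ContinuousAt.comp (f := σ) ?_ σ.continuous.continuousAt)
    refine (Z.localTriv x).continuousOn.continuousAt ((Z.localTriv x).open_source.mem_nhds ?_)
    rw [Z.mem_localTriv_source, hp]
    exact hmem x
  rw [ContinuousAt, nhds_discrete G, tendsto_pure] at hc
  filter_upwards [hc] with y hy
  rw [← hy, hcoord]
  group

/-- A continuous function on a rectangle can be integrated in either order. -/
theorem intervalIntegral_swap_of_continuous {E : Type*} [NormedAddCommGroup E] [NormedSpace ℝ E]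
    {f : ℝ → ℝ → E} (hf : Continuous (Function.uncurry f)) (a b c d : ℝ) :
    ∫ x in a..b, ∫ y in c..d, f x y = ∫ y in c..d, ∫ x in a..b, f x y := by
  refine MeasureTheory.intervalIntegral_intervalIntegral_swap ?_
  exact (hf.continuousOn.integrableOn_compact
    ((isCompact_uIcc (a := a) (b := b)).prod (isCompact_uIcc (a := c) (b := d)))).mono_set
    (Set.prod_mono uIoc_subset_uIcc uIoc_subset_uIcc)

section FlatSquare

variable {B : Type*} [NormedRing B] [NormedAlgebra ℝ B] [CompleteSpace B]

/-- Clamping of a real number to `[-r, r]`. -/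
def clamp (r x : ℝ) : ℝ := max (-r) (min x r)

theorem continuous_clamp (r : ℝ) : Continuous (clamp r) := by
  unfold clamp
  fun_prop

theorem abs_clamp_le {r : ℝ} (hr : 0 ≤ r) (x : ℝ) : |clamp r x| ≤ r := by
  unfold clamp
  rw [abs_le]
  exact ⟨le_max_left _ _, max_le (by linarith) (min_le_right _ _)⟩

theorem clamp_of_abs_le {r x : ℝ} (hx : |x| ≤ r) : clamp r x = x := by
  rw [abs_le] at hx
  unfold clamp
  rw [min_eq_left hx.2, max_eq_right hx.1]

/-- On a small square, the linear equation is solved first along the horizontal axis, then along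
vertical lines. -/
theorem exists_solution_along_axes {a b : ℝ → ℝ → B} (ha : Continuous (Function.uncurry a))
    (hb : Continuous (Function.uncurry b)) {r C : ℝ} (hr : 0 < r) (hC : 0 ≤ C)
    (haC : ∀ x y, ‖a x y‖ ≤ C) (hbC : ∀ x y, ‖b x y‖ ≤ C) (hrC : 2 * r * C < 1) :
    ∃ Φ : ℝ → ℝ → B, Continuous (Function.uncurry Φ) ∧ (∃ M, ∀ x y, ‖Φ x y‖ ≤ M) ∧
      ∀ x y, |x| ≤ r → |y| ≤ r →
        Φ x y = 1 + (∫ s in (0 : ℝ)..x, Φ s 0 * a s 0) + ∫ s in (0 : ℝ)..y, Φ x s * b x s := by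
  have hc := continuous_clamp r
  -- Clamping makes the integral operator act on bounded continuous functions on the whole plane.
  -- Each of its two integrals runs over a length at most r, whence the contraction constant 2rC.
  let T₀ : (ℝ × ℝ → B) → ℝ × ℝ → B := fun Φ p =>
    1 + (∫ s in (0 : ℝ)..clamp r p.1, Φ (s, 0) * a s 0)
      + ∫ s in (0 : ℝ)..clamp r p.2, Φ (clamp r p.1, s) * b (clamp r p.1) s
  have ha' : ∀ {Z : Type _} [TopologicalSpace Z] {f g : Z → ℝ}, Continuous f → Continuous g →
      Continuous fun z => a (f z) (g z) := fun hf hg => ha.comp (hf.prodMk hg)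
  have hb' : ∀ {Z : Type _} [TopologicalSpace Z] {f g : Z → ℝ}, Continuous f → Continuous g →
      Continuous fun z => b (f z) (g z) := fun hf hg => hb.comp (hf.prodMk hg)
  have hT₀ : ∀ Φ : ℝ × ℝ → B, Continuous Φ → Continuous (T₀ Φ) := by
    intro Φ hΦ
    refine (continuous_const.add ?_).add ?_
    · refine intervalIntegral.continuous_parametric_intervalIntegral_of_continuous
        (f := fun (_ : ℝ × ℝ) s => Φ (s, 0) * a s 0) ?_ (hc.comp continuous_fst)
      exact (hΦ.comp (by fun_prop)).mul (ha' continuous_snd continuous_const)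
    · refine intervalIntegral.continuous_parametric_intervalIntegral_of_continuous
        (f := fun (p : ℝ × ℝ) s => Φ (clamp r p.1, s) * b (clamp r p.1) s) ?_
        (hc.comp continuous_snd)
      refine (hΦ.comp ((hc.comp (by fun_prop)).prodMk continuous_snd)).mul
        (hb' (hc.comp (by fun_prop)) continuous_snd)
  have hsub : ∀ Φ Ψ : ℝ × ℝ → B, Continuous Φ → Continuous Ψ → ∀ M, (∀ p, ‖Φ p - Ψ p‖ ≤ M) →
      ∀ p, ‖T₀ Φ p - T₀ Ψ p‖ ≤ 2 * r * C * M := by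
    intro Φ Ψ hΦ hΨ M hM p
    have hM0 : 0 ≤ M := (norm_nonneg _).trans (hM p)
    have e : T₀ Φ p - T₀ Ψ p = (∫ s in (0 : ℝ)..clamp r p.1, (Φ (s, 0) - Ψ (s, 0)) * a s 0)
        + ∫ s in (0 : ℝ)..clamp r p.2,
          (Φ (clamp r p.1, s) - Ψ (clamp r p.1, s)) * b (clamp r p.1) s := by
      simp only [sub_mul, T₀]
      rw [intervalIntegral.integral_sub, intervalIntegral.integral_sub]
      · abel
      all_goals
        refine Continuous.intervalIntegrable ?_ _ _
        refine Continuous.mul (Continuous.comp (by assumption) (by fun_prop)) ?_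
        first
          | exact ha' continuous_id continuous_const
          | exact hb' continuous_const continuous_id
    have h1 : ∀ x y, ‖(Φ (x, y) - Ψ (x, y)) * a x y‖ ≤ M * C := fun x y =>
      (norm_mul_le _ _).trans (mul_le_mul (hM _) (haC _ _) (norm_nonneg _) hM0)
    have h2 : ∀ x y, ‖(Φ (x, y) - Ψ (x, y)) * b x y‖ ≤ M * C := fun x y =>
      (norm_mul_le _ _).trans (mul_le_mul (hM _) (hbC _ _) (norm_nonneg _) hM0)
    have i1 : ‖∫ s in (0 : ℝ)..clamp r p.1, (Φ (s, 0) - Ψ (s, 0)) * a s 0‖ ≤ M * C * r := by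
      refine (intervalIntegral.norm_integral_le_of_norm_le_const fun s _ => h1 s 0).trans ?_
      rw [sub_zero]
      exact mul_le_mul_of_nonneg_left (abs_clamp_le hr.le _) (by positivity)
    have i2 : ‖∫ s in (0 : ℝ)..clamp r p.2,
        (Φ (clamp r p.1, s) - Ψ (clamp r p.1, s)) * b (clamp r p.1) s‖ ≤ M * C * r := by
      refine (intervalIntegral.norm_integral_le_of_norm_le_const
        fun s _ => h2 (clamp r p.1) s).trans ?_
      rw [sub_zero]
      exact mul_le_mul_of_nonneg_left (abs_clamp_le hr.le _) (by positivity)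
    rw [e]
    refine (norm_add_le _ _).trans ?_
    linarith
  have hbd : ∀ Φ : BoundedContinuousFunction (ℝ × ℝ) B, ∀ p,
      ‖T₀ Φ p‖ ≤ ‖(1 : B)‖ + 2 * r * C * ‖Φ‖ := by
    intro Φ p
    have h0 : T₀ (fun _ => 0) p = 1 := by simp [T₀]
    have := hsub Φ (fun _ => 0) Φ.continuous continuous_const ‖Φ‖
      (fun p => by simpa using Φ.norm_coe_le_norm p) p
    rw [h0] at this
    have h3 := norm_add_le (1 : B) (T₀ Φ p - 1)
    rw [add_sub_cancel] at h3
    linarith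
  let T : BoundedContinuousFunction (ℝ × ℝ) B → BoundedContinuousFunction (ℝ × ℝ) B := fun Φ =>
    BoundedContinuousFunction.ofNormedAddCommGroup (T₀ Φ) (hT₀ Φ Φ.continuous) _ (hbd Φ)
  have hrC0 : 0 ≤ 2 * r * C := by positivity
  have hT : ContractingWith ⟨2 * r * C, hrC0⟩ T := by
    refine ⟨by exact_mod_cast hrC, LipschitzWith.of_dist_le_mul fun Φ Ψ => ?_⟩
    rw [BoundedContinuousFunction.dist_le (mul_nonneg (by positivity) dist_nonneg)]
    intro p
    rw [dist_eq_norm]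
    refine hsub Φ Ψ Φ.continuous Ψ.continuous _ (fun q => ?_) p
    rw [← dist_eq_norm]
    exact BoundedContinuousFunction.dist_coe_le_dist q
  have hfix : T (hT.fixedPoint T) = hT.fixedPoint T := hT.fixedPoint_isFixedPt
  set Φ := hT.fixedPoint T
  refine ⟨fun x y => Φ (x, y), Φ.continuous, ⟨‖Φ‖, fun x y => Φ.norm_coe_le_norm _⟩,
    fun x y hx hy => ?_⟩
  have := DFunLike.congr_fun hfix (x, y)
  refine this.symm.trans ?_
  change T₀ Φ (x, y) = _
  simp only [T₀, clamp_of_abs_le hx, clamp_of_abs_le hy]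

/-- A flat linear equation on a small square has a solution. -/
theorem exists_solution_on_square {a b a' b' : ℝ → ℝ → B} (ha : Continuous (Function.uncurry a))
    (hb : Continuous (Function.uncurry b)) (hb' : Continuous (Function.uncurry b'))
    {r C : ℝ} (hr : 0 < r) (hr1 : r ≤ 1) (hC : 0 ≤ C)
    (haC : ∀ x y, ‖a x y‖ ≤ C) (hbC : ∀ x y, ‖b x y‖ ≤ C) (hb'C : ∀ x y, ‖b' x y‖ ≤ C)
    (hrC : 2 * r * C < 1)
    (hda : ∀ x y, |x| < r → |y| < r → HasDerivAt (fun t => a x t) (a' x y) y)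
    (hdb : ∀ x y, |x| < r → |y| < r → HasDerivAt (fun t => b t y) (b' x y) x)
    (hflat : ∀ x y, |x| < r → |y| < r → a' x y + b x y * a x y = b' x y + a x y * b x y) :
    ∃ Φ : ℝ → ℝ → B, Continuous (Function.uncurry Φ) ∧ Φ 0 0 = 1 ∧
      (∀ x y, |x| < r → |y| < r → HasDerivAt (fun t => Φ t y) (Φ x y * a x y) x) ∧
      ∀ x y, |x| < r → |y| < r → HasDerivAt (fun t => Φ x t) (Φ x y * b x y) y := by
  obtain ⟨Φ, hΦ, ⟨M₀, hM₀⟩, hsol⟩ := exists_solution_along_axes ha hb hr hC haC hbC hrC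
  have r0 : |(0 : ℝ)| ≤ r := by simpa using hr.le
  have hΦ00 : Φ 0 0 = 1 := by simpa using hsol 0 0 r0 r0
  have hx0 : ∀ x, |x| ≤ r → Φ x 0 = 1 + ∫ s in (0 : ℝ)..x, Φ s 0 * a s 0 := by
    intro x hx
    simpa using hsol x 0 hx r0
  have hy : ∀ x y, |x| ≤ r → |y| ≤ r → Φ x y = Φ x 0 + ∫ s in (0 : ℝ)..y, Φ x s * b x s := by
    intro x y hx hy
    rw [hsol x y hx hy, hx0 x hx]
  have sl : ∀ {f : ℝ → ℝ → B}, Continuous (Function.uncurry f) → ∀ y, Continuous fun x => f x y :=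
    fun hf y => hf.comp (continuous_id.prodMk continuous_const)
  have sr : ∀ {f : ℝ → ℝ → B}, Continuous (Function.uncurry f) → ∀ x, Continuous fun y => f x y :=
    fun hf x => hf.comp (continuous_const.prodMk continuous_id)
  have cΦa : Continuous (Function.uncurry fun x y => Φ x y * a x y) := hΦ.mul ha
  have cΦb : Continuous (Function.uncurry fun x y => Φ x y * b x y) := hΦ.mul hb
  have hopen : ∀ y : ℝ, |y| < r → ∀ᶠ t in 𝓝 y, |t| < r := fun y hy =>
    (isOpen_lt continuous_abs continuous_const).mem_nhds hy
  have dy : ∀ x y, |x| < r → |y| < r → HasDerivAt (fun t => Φ x t) (Φ x y * b x y) y := by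
    intro x y hx hy'
    have h1 : HasDerivAt (fun t => Φ x 0 + ∫ s in (0 : ℝ)..t, Φ x s * b x s)
        (Φ x y * b x y) y :=
      (intervalIntegral.integral_hasDerivAt_right ((sr cΦb x).intervalIntegrable _ _)
        ((sr cΦb x).stronglyMeasurableAtFilter _ _) (sr cΦb x).continuousAt).const_add _
    refine h1.congr_of_eventuallyEq ?_
    filter_upwards [hopen y hy'] with t ht
    exact hy x t hx.le ht.le
  -- Φ satisfies the equation in y by construction, whereas G satisfies ∂G/∂x = Φa everywhere. The
  -- equation in x for Φ amounts to the vanishing of E = Φ - G.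
  let G : ℝ → ℝ → B := fun x y => Φ 0 y + ∫ s in (0 : ℝ)..x, Φ s y * a s y
  have hG : Continuous (Function.uncurry G) := by
    refine ((sr hΦ 0).comp continuous_snd).add ?_
    refine intervalIntegral.continuous_parametric_intervalIntegral_of_continuous
      (f := fun (p : ℝ × ℝ) s => Φ s p.2 * a s p.2) ?_ continuous_fst
    exact cΦa.comp (continuous_snd.prodMk (continuous_snd.comp continuous_fst))
  have dG : ∀ x y, HasDerivAt (fun t => G t y) (Φ x y * a x y) x := fun x y =>
    (intervalIntegral.integral_hasDerivAt_right ((sl cΦa y).intervalIntegrable _ _)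
        ((sl cΦa y).stronglyMeasurableAtFilter _ _) (sl cΦa y).continuousAt).const_add _
  let E : ℝ → ℝ → B := fun x y => Φ x y - G x y
  have hE : Continuous (Function.uncurry E) := hΦ.sub hG
  have cEb : Continuous (Function.uncurry fun x y => E x y * b x y) := hE.mul hb
  have cEb' : Continuous (Function.uncurry fun x y => E x y * b' x y) := hE.mul hb'
  have cGb' : Continuous (Function.uncurry fun x y => G x y * b' x y) := hG.mul hb'
  have cΦab : Continuous (Function.uncurry fun x y => Φ x y * a x y * b x y) := cΦa.mul hb
  have cΦc : Continuous (Function.uncurry fun x y => Φ x y * (b' x y + a x y * b x y)) :=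
    hΦ.mul (hb'.add (ha.mul hb))
  have hmem : ∀ {x s : ℝ}, |x| < r → s ∈ uIcc 0 x → |s| < r := by
    intro x s hx hs
    have := abs_sub_left_of_mem_uIcc hs
    rw [sub_zero, sub_zero] at this
    exact this.trans_lt hx
  -- The derivative of G b in x is Φab + Gb', since only G has a known derivative in x. Replacing G
  -- by Φ - E produces the error term in E.
  have hcΦ : ∀ x y, |x| < r → |y| < r → ∫ s in (0 : ℝ)..x, Φ s y * (b' s y + a s y * b s y)
      = G x y * b x y - Φ 0 y * b 0 y + ∫ s in (0 : ℝ)..x, E s y * b' s y := by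
    intro x y hx hy'
    have cs : Continuous fun s => Φ s y * a s y * b s y + G s y * b' s y :=
      (sl cΦab y).add (sl cGb' y)
    have h1 : ∫ s in (0 : ℝ)..x, (Φ s y * a s y * b s y + G s y * b' s y)
        = G x y * b x y - G 0 y * b 0 y := by
      refine intervalIntegral.integral_eq_sub_of_hasDerivAt (f := fun s => G s y * b s y)
        (fun s hs => ?_) (cs.intervalIntegrable _ _)
      exact (dG s y).mul (hdb s y (hmem hx hs) hy')
    have h2 : G 0 y = Φ 0 y := by simp [G]
    rw [h2] at h1
    rw [← h1, ← intervalIntegral.integral_add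
      (cs.intervalIntegrable _ _) ((sl cEb' y).intervalIntegrable _ _)]
    refine intervalIntegral.integral_congr fun s _ => ?_
    simp only [E]
    noncomm_ring
  -- Flatness says that Φ(b' + ab) is the derivative of Φa in y. After exchanging the order of
  -- integration, all terms cancel except those in E, which therefore solves a homogeneous Volterra
  -- equation.
  have key : ∀ x y, |x| < r → |y| < r →
      E x y = ∫ t in (0 : ℝ)..y, (E x t * b x t - ∫ s in (0 : ℝ)..x, E s t * b' s t) := by
    intro x y hx hy'
    have h1 : ∫ s in (0 : ℝ)..x, Φ s y * a s y = (∫ s in (0 : ℝ)..x, Φ s 0 * a s 0)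
        + ∫ s in (0 : ℝ)..x, ∫ t in (0 : ℝ)..y, Φ s t * (b' s t + a s t * b s t) := by
      have : ∀ s ∈ uIcc 0 x, ∫ t in (0 : ℝ)..y, Φ s t * (b' s t + a s t * b s t)
          = Φ s y * a s y - Φ s 0 * a s 0 := by
        intro s hs
        refine intervalIntegral.integral_eq_sub_of_hasDerivAt (f := fun t => Φ s t * a s t)
          (fun t ht => ?_) ((sr cΦc s).intervalIntegrable _ _)
        have hs' := hmem hx hs
        have ht' := hmem hy' ht
        convert! (dy s t hs' ht').mul (hda s t hs' ht') using 1
        rw [← hflat s t hs' ht']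
        noncomm_ring
      rw [intervalIntegral.integral_congr this, intervalIntegral.integral_sub
        ((sl cΦa y).intervalIntegrable _ _) ((sl cΦa 0).intervalIntegrable _ _)]
      abel
    rw [intervalIntegral_swap_of_continuous cΦc] at h1
    have h3 : ∫ t in (0 : ℝ)..y, ∫ s in (0 : ℝ)..x, Φ s t * (b' s t + a s t * b s t)
        = ∫ t in (0 : ℝ)..y, (G x t * b x t - Φ 0 t * b 0 t
          + ∫ s in (0 : ℝ)..x, E s t * b' s t) :=
      intervalIntegral.integral_congr fun t ht => hcΦ x t hx (hmem hy' ht)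
    have cI : Continuous fun t => ∫ s in (0 : ℝ)..x, E s t * b' s t :=
      intervalIntegral.continuous_parametric_intervalIntegral_of_continuous'
        (f := fun t s => E s t * b' s t) (cEb'.comp continuous_swap) _ _
    have e0 : E x y = (∫ t in (0 : ℝ)..y, Φ x t * b x t) - (∫ t in (0 : ℝ)..y, Φ 0 t * b 0 t)
        - ∫ t in (0 : ℝ)..y, (G x t * b x t - Φ 0 t * b 0 t
          + ∫ s in (0 : ℝ)..x, E s t * b' s t) := by
      simp only [E, G]
      rw [h1, h3, hy x y hx.le hy'.le, hy 0 y r0 hy'.le, hx0 x hx.le, hΦ00]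
      abel
    rw [e0, ← intervalIntegral.integral_sub, ← intervalIntegral.integral_sub]
    · refine intervalIntegral.integral_congr fun t _ => ?_
      simp only [E]
      noncomm_ring
    · exact ((sr cΦb x).sub (sr cΦb 0)).intervalIntegrable _ _
    · exact ((((sr hG x).mul (sr hb x)).sub (sr cΦb 0)).add cI).intervalIntegrable _ _
    · exact (sr cΦb x).intervalIntegrable _ _
    · exact (sr cΦb 0).intervalIntegrable _ _
  have hEM : ∃ M, 0 ≤ M ∧ ∀ x y, |x| < r → |y| < r → ‖E x y‖ ≤ M := by
    obtain ⟨M, hM⟩ := ((isCompact_Icc (a := -r) (b := r)).prod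
      (isCompact_Icc (a := -r) (b := r))).exists_bound_of_continuousOn hE.continuousOn
    refine ⟨max M 0, le_max_right _ _, fun x y hx hy' => (hM (x, y) ⟨?_, ?_⟩).trans
      (le_max_left _ _)⟩
    · exact abs_le.mp hx.le
    · exact abs_le.mp hy'.le
  obtain ⟨M, hM0, hM⟩ := hEM
  -- The integral equation improves any bound on E by the factor 2rC < 1. The condition r ≤ 1
  -- absorbs the double integral: MC + MCr ≤ 2MC. Iteration gives E = 0.
  have hstep : ∀ M, 0 ≤ M → (∀ x y, |x| < r → |y| < r → ‖E x y‖ ≤ M) →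
      ∀ x y, |x| < r → |y| < r → ‖E x y‖ ≤ 2 * r * C * M := by
    intro M hM0 hM x y hx hy'
    have hsub : ∀ {z s : ℝ}, s ∈ uIoc 0 z → s ∈ uIcc 0 z := fun h => uIoc_subset_uIcc h
    rw [key x y hx hy']
    refine (intervalIntegral.norm_integral_le_of_norm_le_const
      (C := M * C + M * C * r) fun t ht => ?_).trans ?_
    · have ht' := hmem hy' (hsub ht)
      refine (norm_sub_le _ _).trans (add_le_add ?_ ?_)
      · exact (norm_mul_le _ _).trans (mul_le_mul (hM _ _ hx ht') (hbC _ _) (norm_nonneg _) hM0)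
      · refine (intervalIntegral.norm_integral_le_of_norm_le_const
          (C := M * C) fun s hs => ?_).trans ?_
        · exact (norm_mul_le _ _).trans
            (mul_le_mul (hM _ _ (hmem hx (hsub hs)) ht') (hb'C _ _) (norm_nonneg _) hM0)
        · rw [sub_zero]
          exact mul_le_mul_of_nonneg_left hx.le (by positivity)
    · rw [sub_zero]
      have h1 : M * C + M * C * r ≤ 2 * (M * C) := by
        have : M * C * r ≤ M * C * 1 := mul_le_mul_of_nonneg_left hr1 (by positivity)
        linarith
      calc (M * C + M * C * r) * |y| ≤ 2 * (M * C) * r :=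
            mul_le_mul h1 hy'.le (abs_nonneg _) (by positivity)
        _ = 2 * r * C * M := by ring
  have hpow : ∀ n : ℕ, ∀ x y, |x| < r → |y| < r → ‖E x y‖ ≤ (2 * r * C) ^ n * M := by
    intro n
    induction n with
    | zero => simpa using hM
    | succ n ih =>
      intro x y hx hy'
      have := hstep _ (by positivity) ih x y hx hy'
      rwa [pow_succ', mul_assoc]
  have hE0 : ∀ x y, |x| < r → |y| < r → Φ x y = G x y := by
    intro x y hx hy'
    have h1 : Tendsto (fun n : ℕ => (2 * r * C) ^ n * M) atTop (𝓝 (0 * M)) :=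
      (tendsto_pow_atTop_nhds_zero_of_lt_one (by positivity) hrC).mul_const M
    rw [zero_mul] at h1
    have h2 : ‖E x y‖ ≤ 0 := ge_of_tendsto' h1 fun n => hpow n x y hx hy'
    exact sub_eq_zero.mp (norm_le_zero_iff.mp h2)
  refine ⟨Φ, hΦ, hΦ00, fun x y hx hy' => ?_, dy⟩
  refine (dG x y).congr_of_eventuallyEq ?_
  filter_upwards [hopen x hx] with t ht
  exact hE0 t y ht hy'

end FlatSquare

/-! ### Flat linear equations on a simply connected domain -/

section Flat

variable {B : Type*} [NormedRing B] [NormedAlgebra ℝ B]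

/-- The real linear map `ℂ → B` with values `a` at `1` and `b` at `I`. -/
def realForm {E : Type*} [NormedAddCommGroup E] [NormedSpace ℝ E] (a b : E) : ℂ →L[ℝ] E :=
  Complex.reCLM.smulRight a + Complex.imCLM.smulRight b

theorem realForm_apply {E : Type*} [NormedAddCommGroup E] [NormedSpace ℝ E] (a b : E) (X : ℂ) :
    realForm a b X = X.re • a + X.im • b := rfl

/-- `dΦ = Φ (a₁ dx + a₂ dy)` at the point `z`. -/
def SolvesAt (a₁ a₂ : ℂ → B) (Φ : ℂ → B) (z : ℂ) : Prop :=
  HasFDerivAt Φ (realForm (Φ z * a₁ z) (Φ z * a₂ z)) z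

theorem SolvesAt.const_mul {a₁ a₂ Φ : ℂ → B} {z : ℂ} (h : SolvesAt a₁ a₂ Φ z) (k : B) :
    SolvesAt a₁ a₂ (fun w => k * Φ w) z := by
  have h1 := HasFDerivAt.const_mul (h : HasFDerivAt Φ _ z) k
  refine h1.congr_fderiv ?_
  ext X
  simp [realForm_apply, mul_add, mul_assoc]

/-- The coefficients act on the right, so the two contributions ΦAΨ⁻¹ to the derivative of ΦΨ⁻¹
cancel. Two solutions thus differ locally by a constant left factor, which is the cocycle condition
needed for gluing. -/
theorem SolvesAt.hasFDerivAt_mul_inverse [CompleteSpace B] {a₁ a₂ Φ Ψ : ℂ → B} {z : ℂ}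
    (hΦ : SolvesAt a₁ a₂ Φ z) (hΨ : SolvesAt a₁ a₂ Ψ z) (hu : IsUnit (Ψ z)) :
    HasFDerivAt (fun w => Φ w * Ring.inverse (Ψ w)) (0 : ℂ →L[ℝ] B) z := by
  obtain ⟨v, hv⟩ := hu
  have h1 : HasFDerivAt Ring.inverse (-ContinuousLinearMap.mulLeftRight ℝ B ↑v⁻¹ ↑v⁻¹) (Ψ z) := by
    rw [← hv]
    exact hasFDerivAt_ringInverse v
  have h2 := HasFDerivAt.mul' (hΦ : HasFDerivAt Φ _ z) (h1.comp z (hΨ : HasFDerivAt Ψ _ z))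
  refine h2.congr_fderiv ?_
  ext X
  simp only [realForm_apply, add_apply, smul_apply,
    ContinuousLinearMap.comp_apply, neg_apply, smul_eq_mul,
    ContinuousLinearMap.mulLeftRight_apply, Function.comp_apply, ← hv, Ring.inverse_unit,
    zero_apply, MulOpposite.smul_eq_mul_unop, MulOpposite.unop_op]
  have e : ∀ c : B, (↑v⁻¹ : B) * (↑v * c) = c := fun c => by simp
  simp only [mul_add, mul_smul_comm, e, add_mul, smul_mul_assoc, mul_neg, ← mul_assoc]
  abel

/-- Bootstrap: the differential is a product of Φ with smooth coefficients, so regularity of order n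
implies regularity of order n + 1. -/
theorem contDiffOn_of_solvesAt {Ω : Set ℂ} (hΩ : IsOpen Ω) {a₁ a₂ Φ : ℂ → B}
    (h₁ : ContDiffOn ℝ ∞ a₁ Ω) (h₂ : ContDiffOn ℝ ∞ a₂ Ω) (h : ∀ z ∈ Ω, SolvesAt a₁ a₂ Φ z) :
    ContDiffOn ℝ ∞ Φ Ω := by
  have hd : DifferentiableOn ℝ Φ Ω := fun z hz =>
    (h z hz : HasFDerivAt Φ _ z).differentiableAt.differentiableWithinAt
  rw [contDiffOn_infty]
  intro n
  induction n with
  | zero => exact contDiffOn_zero.mpr hd.continuousOn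
  | succ n ih =>
    have hn : ((n : ℕ∞) : WithTop ℕ∞) ≤ ∞ := by exact_mod_cast le_top
    push_cast
    rw [contDiffOn_succ_iff_fderiv_of_isOpen hΩ]
    refine ⟨hd, by simp, ?_⟩
    have : ContDiffOn ℝ n (fun z => realForm (Φ z * a₁ z) (Φ z * a₂ z)) Ω := by
      refine ContDiffOn.add ?_ ?_
      · exact contDiffOn_const.smulRight (ih.mul (h₁.of_le hn))
      · exact contDiffOn_const.smulRight (ih.mul (h₂.of_le hn))
    exact this.congr fun z hz => (h z hz : HasFDerivAt Φ _ z).fderiv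

variable [CompleteSpace B]

/-- The problem is transported to a small square centred at p. The coefficients are extended by
clamping to bounded continuous functions on the plane, which do not change inside the square. -/
theorem exists_local_solution {Ω : Set ℂ} (hΩ : IsOpen Ω) {a₁ a₂ : ℂ → B}
    (h₁ : ContDiffOn ℝ ∞ a₁ Ω) (h₂ : ContDiffOn ℝ ∞ a₂ Ω)
    (hflat : ∀ z ∈ Ω, fderiv ℝ a₁ z Complex.I + a₂ z * a₁ z = fderiv ℝ a₂ z 1 + a₁ z * a₂ z)
    {p : ℂ} (hp : p ∈ Ω) :
    ∃ (V : Set ℂ) (Φ : ℂ → B), IsOpen V ∧ p ∈ V ∧ V ⊆ Ω ∧ Φ p = 1 ∧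
      ∀ z ∈ V, SolvesAt a₁ a₂ Φ z := by
  obtain ⟨δ, hδ, hδΩ⟩ := Metric.nhds_basis_closedBall.mem_iff.mp (hΩ.mem_nhds hp)
  set R := δ / 2 with hRdef
  have hR : 0 < R := by positivity
  let q : ℝ × ℝ → ℂ := fun x => p + (clamp R x.1 + clamp R x.2 * Complex.I)
  have hq : Continuous q := by
    have := continuous_clamp R
    fun_prop
  have hqball : ∀ x, q x ∈ Metric.closedBall p δ := by
    intro x
    rw [Metric.mem_closedBall, dist_eq_norm]
    simp only [q, add_sub_cancel_left]
    refine (norm_add_le _ _).trans ?_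
    have e1 : ‖(clamp R x.1 : ℂ)‖ ≤ R := by simpa using abs_clamp_le hR.le x.1
    have e2 : ‖(clamp R x.2 : ℂ) * Complex.I‖ ≤ R := by simpa using abs_clamp_le hR.le x.2
    linarith
  have hd₁ : ContinuousOn (fun z => fderiv ℝ a₁ z Complex.I) Ω :=
    (h₁.continuousOn_fderiv_of_isOpen hΩ (by simp)).clm_apply continuousOn_const
  have hd₂ : ContinuousOn (fun z => fderiv ℝ a₂ z 1) Ω :=
    (h₂.continuousOn_fderiv_of_isOpen hΩ (by simp)).clm_apply continuousOn_const
  have hcomp : ∀ {f : ℂ → B}, ContinuousOn f Ω → Continuous fun x => f (q x) := fun hf =>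
    hf.comp_continuous hq fun x => hδΩ (hqball x)
  have hbdd : ∀ {f : ℂ → B}, ContinuousOn f Ω → ∃ C, ∀ x, ‖f (q x)‖ ≤ C := by
    intro f hf
    obtain ⟨C, hC⟩ := (isCompact_closedBall p δ).exists_bound_of_continuousOn (hf.mono hδΩ)
    exact ⟨C, fun x => hC _ (hqball x)⟩
  obtain ⟨C₁, hC₁⟩ := hbdd h₁.continuousOn
  obtain ⟨C₂, hC₂⟩ := hbdd h₂.continuousOn
  obtain ⟨C₃, hC₃⟩ := hbdd hd₂
  set C := max (max C₁ C₂) (max C₃ 0)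
  have hC : 0 ≤ C := le_max_of_le_right (le_max_right _ _)
  -- The bound R keeps the square where clamping is inactive, the bound 1 is required on the square,
  -- and the last one gives 2rC ≤ C/(2C + 1) < 1.
  obtain ⟨r, hr, hrle⟩ : ∃ r > 0, r ≤ min (min R 1) (1 / (2 * C + 1) / 2) :=
    ⟨_, by positivity, le_rfl⟩
  have hrR : r ≤ R := hrle.trans ((min_le_left _ _).trans (min_le_left _ _))
  have hr1 : r ≤ 1 := hrle.trans ((min_le_left _ _).trans (min_le_right _ _))
  have hrC : 2 * r * C < 1 := by
    have h1 : r ≤ 1 / (2 * C + 1) / 2 := hrle.trans (min_le_right _ _)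
    have h2 : r * (2 * C) ≤ 1 / (2 * C + 1) / 2 * (2 * C) :=
      mul_le_mul_of_nonneg_right h1 (by positivity)
    have h3 : 1 / (2 * C + 1) / 2 * (2 * C) < 1 := by
      rw [div_div, div_mul_eq_mul_div, div_lt_one (by positivity)]
      linarith
    linarith
  have hqeq : ∀ x y, |x| < r → |y| < r → q (x, y) = p + (x + y * Complex.I) := by
    intro x y hx hy
    simp only [q, clamp_of_abs_le (hx.le.trans hrR), clamp_of_abs_le (hy.le.trans hrR)]
  have hopen : ∀ y : ℝ, |y| < r → ∀ᶠ t in 𝓝 y, |t| < r := fun y hy =>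
    (isOpen_lt continuous_abs continuous_const).mem_nhds hy
  have hdiff : ∀ {f : ℂ → B}, ContDiffOn ℝ ∞ f Ω → ∀ x, HasFDerivAt f (fderiv ℝ f (q x)) (q x) :=
    fun hf x => ((hf.differentiableOn (by simp)).differentiableAt
      (hΩ.mem_nhds (hδΩ (hqball x)))).hasFDerivAt
  obtain ⟨Φ, hΦ, hΦ0, hΦx, hΦy⟩ := exists_solution_on_square
    (a := fun x y => a₁ (q (x, y))) (b := fun x y => a₂ (q (x, y)))
    (a' := fun x y => fderiv ℝ a₁ (q (x, y)) Complex.I)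
    (b' := fun x y => fderiv ℝ a₂ (q (x, y)) 1)
    (hcomp h₁.continuousOn) (hcomp h₂.continuousOn) (hcomp hd₂) hr hr1 hC
    (fun x y => (hC₁ _).trans ((le_max_left _ _).trans (le_max_left _ _)))
    (fun x y => (hC₂ _).trans ((le_max_right _ _).trans (le_max_left _ _)))
    (fun x y => (hC₃ _).trans ((le_max_left _ _).trans (le_max_right _ _))) hrC
    (by
      intro x y hx hy
      have e := hdiff h₁ (x, y)
      have l : HasDerivAt (fun t : ℝ => p + (x + t * Complex.I)) Complex.I y := by
        simpa using! (((hasDerivAt_id y).ofReal_comp.mul_const Complex.I).const_add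
          (x : ℂ)).const_add p
      rw [hqeq x y hx hy] at e ⊢
      refine (e.comp_hasDerivAt y l).congr_of_eventuallyEq ?_
      filter_upwards [hopen y hy] with t ht
      rw [hqeq x t hx ht]
      rfl)
    (by
      intro x y hx hy
      have e := hdiff h₂ (x, y)
      have l : HasDerivAt (fun t : ℝ => p + (t + y * Complex.I)) 1 x := by
        simpa using! ((hasDerivAt_id x).ofReal_comp.add_const
          (y * Complex.I : ℂ)).const_add p
      rw [hqeq x y hx hy] at e ⊢
      refine (e.comp_hasDerivAt x l).congr_of_eventuallyEq ?_
      filter_upwards [hopen x hx] with t ht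
      rw [hqeq t y ht hy]
      rfl)
    (fun x y _ _ => hflat _ (hδΩ (hqball _)))
  let V : Set ℂ := {z | |(z - p).re| < r ∧ |(z - p).im| < r}
  have hzq : ∀ z ∈ V, q ((z - p).re, (z - p).im) = z := by
    intro z hz
    rw [hqeq _ _ hz.1 hz.2, Complex.re_add_im, add_sub_cancel]
  have hVo : IsOpen V := by
    refine IsOpen.and (isOpen_lt ?_ continuous_const) (isOpen_lt ?_ continuous_const)
    · exact (Complex.continuous_re.comp (continuous_id.sub continuous_const)).abs
    · exact (Complex.continuous_im.comp (continuous_id.sub continuous_const)).abs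
  refine ⟨V, fun z => Φ (z - p).re (z - p).im, hVo, by simpa [V] using hr, ?_, by simpa using hΦ0,
    fun z hz => ?_⟩
  · intro z hz
    rw [← hzq z hz]
    exact hδΩ (hqball _)
  · let f₁ : ℝ → ℝ → ℝ →L[ℝ] B := fun x y =>
      ContinuousLinearMap.toSpanSingleton ℝ (Φ x y * a₁ (q (x, y)))
    let f₂ : ℝ → ℝ → ℝ →L[ℝ] B := fun x y =>
      ContinuousLinearMap.toSpanSingleton ℝ (Φ x y * a₂ (q (x, y)))
    have hnear : ∀ᶠ v : ℝ × ℝ in 𝓝 ((z - p).re, (z - p).im), |v.1| < r ∧ |v.2| < r :=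
      (hopen _ hz.1).prod_nhds (hopen _ hz.2)
    -- Both partial derivatives exist near the point and are continuous there, so Φ is
    -- differentiable jointly in the two variables.
    have hs : HasStrictFDerivAt (Function.HasUncurry.uncurry Φ) _ ((z - p).re, (z - p).im) :=
      hasStrictFDerivAt_uncurry_coprod (f := Φ) (f₁ := f₁) (f₂ := f₂)
        (hnear.mono fun v hv => (hΦx v.1 v.2 hv.1 hv.2).hasFDerivAt)
        (hnear.mono fun v hv => (hΦy v.1 v.2 hv.1 hv.2).hasFDerivAt)
        (by
          refine ContinuousAt.comp (g := ContinuousLinearMap.toSpanSingletonCLE (𝕜 := ℝ))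
            (ContinuousLinearEquiv.continuous _).continuousAt ?_
          exact (hΦ.mul (hcomp h₁.continuousOn)).continuousAt)
        (by
          refine ContinuousAt.comp (g := ContinuousLinearMap.toSpanSingletonCLE (𝕜 := ℝ))
            (ContinuousLinearEquiv.continuous _).continuousAt ?_
          exact (hΦ.mul (hcomp h₂.continuousOn)).continuousAt)
    have hl : HasFDerivAt (fun w : ℂ => ((w - p).re, (w - p).im))
        (Complex.reCLM.prod Complex.imCLM) z :=
      (Complex.reCLM.hasFDerivAt.comp z ((hasFDerivAt_id z).sub_const p)).prodMk
        (Complex.imCLM.hasFDerivAt.comp z ((hasFDerivAt_id z).sub_const p))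
    refine (hs.hasFDerivAt.comp z hl).congr_fderiv ?_
    ext X
    change X.re • (Φ _ _ * a₁ (q _)) + X.im • (Φ _ _ * a₂ (q _)) = _
    rw [realForm_apply, hzq z hz]

/-- A flat linear equation on a simply connected domain has a solution with any base point. -/
theorem exists_solution {Ω : Set ℂ} (hΩ : IsOpen Ω) [SimplyConnectedSpace Ω] {a₁ a₂ : ℂ → B}
    (h₁ : ContDiffOn ℝ ∞ a₁ Ω) (h₂ : ContDiffOn ℝ ∞ a₂ Ω)
    (hflat : ∀ z ∈ Ω, fderiv ℝ a₁ z Complex.I + a₂ z * a₁ z = fderiv ℝ a₂ z 1 + a₁ z * a₂ z)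
    (z₀ : Ω) : ∃ Φ : ℂ → B, Φ z₀ = 1 ∧ ∀ z ∈ Ω, SolvesAt a₁ a₂ Φ z := by
  have := hΩ.locallyPathConnectedSpace
  choose V Φ hVo hpV hVΩ hΦ1 hΦ using
    fun p : Ω => exists_local_solution hΩ h₁ h₂ hflat p.2
  classical
  -- The local solution at p equals 1 at p, hence is invertible nearby because units form an open
  -- set. The default value 1 is taken only outside `D' p` and plays no role.
  let s : Ω → Ω → Bˣ := fun p z => if h : IsUnit (Φ p z) then h.unit else 1
  have hs : ∀ p (z : Ω), IsUnit (Φ p z) → (s p z : B) = Φ p z := by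
    intro p z h
    simp only [s, dif_pos h, IsUnit.unit_spec]
  let D' : Ω → Set ℂ := fun p => V p ∩ Φ p ⁻¹' {x | IsUnit x}
  have hD'o : ∀ p, IsOpen (D' p) := fun p =>
    ContinuousOn.isOpen_inter_preimage
      (fun z hz => (hΦ p z hz : HasFDerivAt _ _ _).continuousAt.continuousWithinAt) (hVo p)
      Units.isOpen
  obtain ⟨S, hS⟩ := exists_glued_of_locallyConst_cocycle (G := Bˣ)
    (fun p => Subtype.val ⁻¹' D' p) (fun p => (hD'o p).preimage continuous_subtype_val)
    (fun p => ⟨hpV p, by simp [hΦ1]⟩) s (by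
      intro i j x hi hj
      obtain ⟨ε, hε, hball⟩ := Metric.isOpen_iff.mp ((hD'o i).inter (hD'o j)) x ⟨hi, hj⟩
      have hder : ∀ z ∈ Metric.ball (x : ℂ) ε,
          HasFDerivAt (fun w => Φ j w * Ring.inverse (Φ i w)) (0 : ℂ →L[ℝ] B) z := fun z hz =>
        (hΦ j z (hball hz).2.1).hasFDerivAt_mul_inverse (hΦ i z (hball hz).1.1) (hball hz).1.2
      filter_upwards [continuous_subtype_val.continuousAt (Metric.ball_mem_nhds (x : ℂ) hε)]
        with y hy
      have hc := Metric.isOpen_ball.is_const_of_fderiv_eq_zero (𝕜 := ℝ)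
        (convex_ball (x : ℂ) ε).isPreconnected
        (fun z hz => (hder z hz).differentiableAt.differentiableWithinAt)
        (fun z hz => (hder z hz).fderiv) hy (Metric.mem_ball_self hε)
      have e : ∀ z : Ω, (z : ℂ) ∈ Metric.ball (x : ℂ) ε →
          ((s j z * (s i z)⁻¹ : Bˣ) : B) = Φ j z * Ring.inverse (Φ i z) := by
        intro z hz
        rw [Units.val_mul, hs j z (hball hz).2.2, ← hs i z (hball hz).1.2, Ring.inverse_unit]
      apply Units.ext
      rw [e y hy, e x (Metric.mem_ball_self hε)]
      exact hc)
  refine ⟨zeroExt fun z => (((S z₀)⁻¹ * S z : Bˣ) : B), ?_, fun z hz => ?_⟩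
  · rw [zeroExt_apply _ z₀.2]
    simp
  · obtain ⟨k, hk⟩ := hS ⟨z, hz⟩
    have hk' : ∀ᶠ w in 𝓝 z, zeroExt (fun z => (((S z₀)⁻¹ * S z : Bˣ) : B)) w
        = (((S z₀)⁻¹ * k : Bˣ) : B) * Φ ⟨z, hz⟩ w := by
      have h1 : ∀ᶠ w in 𝓝 z, ∀ h : w ∈ Ω, S ⟨w, h⟩ = k * s ⟨z, hz⟩ ⟨w, h⟩ := by
        rw [nhds_subtype_eq_comap, eventually_comap] at hk
        filter_upwards [hk] with w hw h
        exact hw ⟨w, h⟩ rfl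
      filter_upwards [h1, hΩ.mem_nhds hz, (hD'o ⟨z, hz⟩).mem_nhds ⟨hpV _, by simp [hΦ1]⟩]
        with w hw hwΩ hwD
      rw [zeroExt_apply _ hwΩ, hw hwΩ, ← mul_assoc, Units.val_mul, hs ⟨z, hz⟩ ⟨w, hwΩ⟩ hwD.2]
    have h2 := (hΦ ⟨z, hz⟩ z (hpV _)).const_mul (((S z₀)⁻¹ * k : Bˣ) : B)
    unfold SolvesAt at h2 ⊢
    rw [hk'.self_of_nhds]
    exact h2.congr_of_eventuallyEq hk'

end Flat

end HSLagrangian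
end

/-! ### Matrix calculus, Maurer–Cartan forms and adapted frames. -/

open scoped ContDiff

noncomputable section

namespace HSLagrangian

open Set Filter Topology Complex

/-! ### Calculus of matrix valued maps -/

/-- Differentiability at `z` of a matrix valued map. -/
def DiffMatAt (M : ℂ → Mat3) (z : ℂ) : Prop :=
  ∀ i j, DifferentiableAt ℝ (fun w => M w i j) z

theorem SmoothMatOn.diffMatAt {M : ℂ → Mat3} {Ω : Set ℂ} (h : SmoothMatOn M Ω) (hΩ : IsOpen Ω)
    {z : ℂ} (hz : z ∈ Ω) : DiffMatAt M z := fun i j =>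
  ((h i j).differentiableOn (by simp)).differentiableAt (hΩ.mem_nhds hz)

theorem dMat_congr {M N : ℂ → Mat3} {z : ℂ} (h : M =ᶠ[𝓝 z] N) (X : ℂ) :
    dMat M z X = dMat N z X := by
  ext i j
  have : (fun w => M w i j) =ᶠ[𝓝 z] fun w => N w i j := h.mono fun w hw => by simp only [hw]
  simp only [dMat, Matrix.of_apply, this.fderiv_eq]

theorem dMat_congr_on {M N : ℂ → Mat3} {Ω : Set ℂ} (hΩ : IsOpen Ω) (h : ∀ z ∈ Ω, M z = N z)
    {z : ℂ} (hz : z ∈ Ω) (X : ℂ) : dMat M z X = dMat N z X :=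
  dMat_congr (eventually_of_mem (hΩ.mem_nhds hz) h) X

theorem SmoothMatOn.congr {M N : ℂ → Mat3} {Ω : Set ℂ} (hM : SmoothMatOn M Ω)
    (h : ∀ z ∈ Ω, N z = M z) : SmoothMatOn N Ω := fun i j =>
  (hM i j).congr fun z hz => by rw [h z hz]

theorem dMat_const (C : Mat3) (z X : ℂ) : dMat (fun _ => C) z X = 0 := by
  ext i j
  simp [dMat]

theorem dMat_mul {M N : ℂ → Mat3} {z : ℂ} (hM : DiffMatAt M z) (hN : DiffMatAt N z) (X : ℂ) :
    dMat (fun w => M w * N w) z X = dMat M z X * N z + M z * dMat N z X := by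
  ext i j
  simp only [dMat, Matrix.of_apply, Matrix.add_apply, Matrix.mul_apply]
  rw [fderiv_fun_sum fun k _ => (hM i k).fun_mul (hN k j)]
  simp only [sum_apply, ← Finset.sum_add_distrib]
  refine Finset.sum_congr rfl fun k _ => ?_
  rw [fderiv_fun_mul (hM i k) (hN k j)]
  simp only [add_apply, smul_apply, smul_eq_mul]
  ring

theorem DiffMatAt.mul {M N : ℂ → Mat3} {z : ℂ} (hM : DiffMatAt M z) (hN : DiffMatAt N z) :
    DiffMatAt (fun w => M w * N w) z := fun i j => by
  simp only [Matrix.mul_apply]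
  exact DifferentiableAt.fun_sum fun k _ => (hM i k).mul (hN k j)

theorem DiffMatAt.const (C : Mat3) (z : ℂ) : DiffMatAt (fun _ => C) z := fun _ _ =>
  differentiableAt_const _

theorem DiffMatAt.star {M : ℂ → Mat3} {z : ℂ} (hM : DiffMatAt M z) :
    DiffMatAt (fun w => star (M w)) z := fun i j =>
  conjCLE.differentiableAt.comp z (hM j i)

theorem dMat_star {M : ℂ → Mat3} {z : ℂ} (hM : DiffMatAt M z) (X : ℂ) :
    dMat (fun w => star (M w)) z X = star (dMat M z X) := by
  ext i j
  have := (conjCLE.hasFDerivAt.comp z (hM j i).hasFDerivAt).fderiv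
  exact DFunLike.congr_fun this X

theorem dMat_const_mul (C : Mat3) {M : ℂ → Mat3} {z : ℂ} (hM : DiffMatAt M z) (X : ℂ) :
    dMat (fun w => C * M w) z X = C * dMat M z X := by
  rw [dMat_mul (DiffMatAt.const C z) hM, dMat_const, zero_mul, zero_add]

theorem SmoothMatOn.mul {M N : ℂ → Mat3} {Ω : Set ℂ} (hM : SmoothMatOn M Ω)
    (hN : SmoothMatOn N Ω) : SmoothMatOn (fun w => M w * N w) Ω := fun i j => by
  simp only [Matrix.mul_apply]
  exact ContDiffOn.sum fun k _ => (hM i k).mul (hN k j)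

theorem SmoothMatOn.const (C : Mat3) (Ω : Set ℂ) : SmoothMatOn (fun _ => C) Ω := fun _ _ =>
  contDiffOn_const

theorem SmoothMatOn.star {M : ℂ → Mat3} {Ω : Set ℂ} (hM : SmoothMatOn M Ω) :
    SmoothMatOn (fun w => star (M w)) Ω := fun i j =>
  conjCLE.contDiff.comp_contDiffOn (hM j i)

theorem SmoothMatOn.dMat {M : ℂ → Mat3} {Ω : Set ℂ} (hM : SmoothMatOn M Ω) (hΩ : IsOpen Ω)
    (X : ℂ) : SmoothMatOn (fun w => dMat M w X) Ω := fun i j =>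
  ((hM i j).fderiv_of_isOpen hΩ (m := ∞) (by simp)).clm_apply contDiffOn_const

theorem fderiv_real_basis {E : Type*} [NormedAddCommGroup E] [NormedSpace ℝ E] (L : ℂ →L[ℝ] E)
    (X : ℂ) : L X = X.re • L 1 + X.im • L I := by
  have : X = X.re • (1 : ℂ) + X.im • I := by simp
  conv_lhs => rw [this, map_add, map_smul, map_smul]

theorem dMat_basis (M : ℂ → Mat3) (z X : ℂ) :
    dMat M z X = (X.re : ℂ) • dMat M z 1 + (X.im : ℂ) • dMat M z I := by
  ext i j
  exact fderiv_real_basis (fderiv ℝ (fun w => M w i j) z) X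

theorem fderiv_fderiv_symm {E F : Type*} [NormedAddCommGroup E] [NormedSpace ℝ E]
    [NormedAddCommGroup F] [NormedSpace ℝ F] {f : E → F} {s : Set E} (hs : IsOpen s)
    (hf : ContDiffOn ℝ ∞ f s) {z : E} (hz : z ∈ s) (X Y : E) :
    fderiv ℝ (fun w => fderiv ℝ f w X) z Y = fderiv ℝ (fun w => fderiv ℝ f w Y) z X := by
  have h1 : ContDiffAt ℝ ∞ f z := hf.contDiffAt (hs.mem_nhds hz)
  have h2 : DifferentiableAt ℝ (fderiv ℝ f) z :=
    (h1.fderiv_right (m := ∞) (by simp)).differentiableAt (by simp)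
  have h3 := (h1.isSymmSndFDerivAt (by simpa using ENat.LEInfty.out)).eq X Y
  have e : ∀ v, fderiv ℝ (fun w => fderiv ℝ f w v) z = (fderiv ℝ (fderiv ℝ f) z).flip v := by
    intro v
    rw [fderiv_clm_apply h2 (differentiableAt_const v)]
    simp
  rw [e, e]
  exact h3.symm

theorem dMat_dMat_symm {M : ℂ → Mat3} {Ω : Set ℂ} (hM : SmoothMatOn M Ω) (hΩ : IsOpen Ω) {z : ℂ}
    (hz : z ∈ Ω) (X Y : ℂ) : dMat (fun w => dMat M w X) z Y = dMat (fun w => dMat M w Y) z X := by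
  ext i j
  exact fderiv_fderiv_symm hΩ (hM i j) hz X Y

theorem fderiv_trace {M : ℂ → Mat3} {z : ℂ} (hM : DiffMatAt M z) (X : ℂ) :
    fderiv ℝ (fun w => (M w).trace) z X = (dMat M z X).trace := by
  simp only [Matrix.trace, Matrix.diag]
  rw [fderiv_fun_sum fun i _ => hM i i, sum_apply]
  rfl

/-! ### Maurer–Cartan forms -/

/-- Unitary valued on `Ω`. -/
def UnitaryOn (M : ℂ → Mat3) (Ω : Set ℂ) : Prop :=
  ∀ z ∈ Ω, star (M z) * M z = 1

theorem UnitaryOn.mul_star {M : ℂ → Mat3} {Ω : Set ℂ} (h : UnitaryOn M Ω) {z : ℂ} (hz : z ∈ Ω) :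
    M z * star (M z) = 1 := mul_eq_one_comm.mp (h z hz)

/-- The Maurer–Cartan form `M† dM` of a unitary valued map. -/
def mc (M : ℂ → Mat3) (z X : ℂ) : Mat3 := star (M z) * dMat M z X

theorem mc_basis (M : ℂ → Mat3) (z X : ℂ) :
    mc M z X = (X.re : ℂ) • mc M z 1 + (X.im : ℂ) • mc M z I := by
  simp only [mc]
  rw [dMat_basis, mul_add, Matrix.mul_smul, Matrix.mul_smul]

theorem SmoothMatOn.mc {M : ℂ → Mat3} {Ω : Set ℂ} (hM : SmoothMatOn M Ω) (hΩ : IsOpen Ω) (X : ℂ) :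
    SmoothMatOn (fun w => mc M w X) Ω := hM.star.mul (hM.dMat hΩ X)

theorem dMat_eq_mul_mc {M : ℂ → Mat3} {Ω : Set ℂ} (hU : UnitaryOn M Ω) {z : ℂ} (hz : z ∈ Ω)
    (X : ℂ) : dMat M z X = M z * mc M z X := by
  rw [mc, ← mul_assoc, hU.mul_star hz, one_mul]

theorem star_mc {M : ℂ → Mat3} {Ω : Set ℂ} (hΩ : IsOpen Ω) (hM : SmoothMatOn M Ω)
    (hU : UnitaryOn M Ω) {z : ℂ} (hz : z ∈ Ω) (X : ℂ) : star (mc M z X) = -mc M z X := by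
  have hd := hM.diffMatAt hΩ hz
  have h1 : dMat (fun w => star (M w) * M w) z X = 0 := by
    rw [dMat_congr_on hΩ (N := fun _ => 1) hU hz, dMat_const]
  rw [dMat_mul hd.star hd, dMat_star hd] at h1
  rw [mc, star_mul, star_star]
  exact eq_neg_of_add_eq_zero_left h1

theorem conj_mc_apply {M : ℂ → Mat3} {Ω : Set ℂ} (hΩ : IsOpen Ω) (hM : SmoothMatOn M Ω)
    (hU : UnitaryOn M Ω) {z : ℂ} (hz : z ∈ Ω) (X : ℂ) (i j : Fin 3) :
    (starRingEnd ℂ) (mc M z X i j) = -mc M z X j i := by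
  have := congrFun (congrFun (star_mc hΩ hM hU hz X) j) i
  simpa using! this

/-- Differentiating the factor M† of M†dM gives the quadratic terms, because A is skew-Hermitian.
The second derivatives of M are symmetric. The order of the factors is the one that
`exists_solution` requires for dΦ = ΦA. -/
theorem mc_flat {M : ℂ → Mat3} {Ω : Set ℂ} (hΩ : IsOpen Ω) (hM : SmoothMatOn M Ω)
    (hU : UnitaryOn M Ω) {z : ℂ} (hz : z ∈ Ω) :
    dMat (fun w => mc M w 1) z I + mc M z I * mc M z 1
      = dMat (fun w => mc M w I) z 1 + mc M z 1 * mc M z I := by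
  have hd := hM.diffMatAt hΩ hz
  have e : ∀ X Y, dMat (fun w => mc M w X) z Y
      = -(mc M z Y * mc M z X) + star (M z) * dMat (fun w => dMat M w X) z Y := by
    intro X Y
    simp only [mc]
    rw [dMat_mul hd.star ((hM.dMat hΩ X).diffMatAt hΩ hz), dMat_star hd]
    congr 1
    have h1 := star_mc hΩ hM hU hz Y
    have h2 : star (dMat M z Y) = star (mc M z Y) * star (M z) := by
      rw [dMat_eq_mul_mc hU hz, star_mul]
    rw [h2, h1]
    simp only [mc]
    noncomm_ring
  rw [e, e, dMat_dMat_symm hM hΩ hz 1 I]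
  abel

theorem mc_const_mul {M : ℂ → Mat3} {R : Mat3} (hR : star R * R = 1) {z : ℂ} (hM : DiffMatAt M z)
    (X : ℂ) : mc (fun w => R * M w) z X = mc M z X := by
  simp only [mc]
  rw [dMat_const_mul R hM, star_mul, mul_assoc, ← mul_assoc (star R), hR, one_mul]

theorem mc_mul {M N : ℂ → Mat3} {z : ℂ} (hM : DiffMatAt M z) (hN : DiffMatAt N z)
    (hU : star (M z) * M z = 1) (X : ℂ) :
    mc (fun w => M w * N w) z X = star (N z) * mc M z X * N z + mc N z X := by
  simp only [mc]
  rw [dMat_mul hM hN, star_mul, mul_add]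
  congr 1
  · simp only [mul_assoc]
  · rw [mul_assoc, ← mul_assoc (star (M z)), hU, one_mul]

/-- Two unitary valued maps with the same Maurer–Cartan form that agree at a point of a connected
open set agree everywhere. -/
theorem eq_of_mc_eq {M N : ℂ → Mat3} {Ω : Set ℂ} (hΩ : IsOpen Ω) (hc : IsPreconnected Ω)
    (hM : ∀ z ∈ Ω, DiffMatAt M z) (hN : ∀ z ∈ Ω, DiffMatAt N z) (hUM : UnitaryOn M Ω)
    (hUN : UnitaryOn N Ω)
    (h : ∀ z ∈ Ω, ∀ X, mc M z X = mc N z X) {z₀ : ℂ} (hz₀ : z₀ ∈ Ω) (h₀ : M z₀ = N z₀) {z : ℂ}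
    (hz : z ∈ Ω) : M z = N z := by
  -- With a common form A, the derivative of MN† is MAN† - MAN† = 0, where d(N†) = -AN† comes from
  -- N†N = 1.
  have hd : ∀ w ∈ Ω, ∀ X, dMat (fun w => M w * star (N w)) w X = 0 := by
    intro w hw X
    have h1 : dMat (fun w => star (N w) * N w) w X = 0 := by
      rw [dMat_congr_on hΩ (N := fun _ => 1) hUN hw, dMat_const]
    rw [dMat_mul (hN w hw).star (hN w hw), dMat_star (hN w hw)] at h1
    have h2 : star (dMat N w X) = -(mc N w X * star (N w)) := by
      calc star (dMat N w X) = star (dMat N w X) * N w * star (N w) := by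
            rw [mul_assoc, hUN.mul_star hw, mul_one]
        _ = _ := by rw [eq_neg_of_add_eq_zero_left h1, neg_mul, mc]
    rw [dMat_mul (hM w hw) (hN w hw).star, dMat_star (hN w hw), h2, dMat_eq_mul_mc hUM hw,
      h w hw]
    noncomm_ring
  have hconst : M z * star (N z) = M z₀ * star (N z₀) := by
    ext i j
    refine hΩ.is_const_of_fderiv_eq_zero (𝕜 := ℝ) hc
      (f := fun w => (M w * star (N w)) i j) (fun w hw => ?_) (fun w hw => ?_) hz hz₀
    · exact (((hM w hw).mul (hN w hw).star) i j).differentiableWithinAt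
    · ext X
      exact congrFun (congrFun (hd w hw X) i) j
  rw [h₀, hUN.mul_star hz₀] at hconst
  calc M z = M z * star (N z) * N z := by rw [mul_assoc, hUN z hz, mul_one]
    _ = N z := by rw [hconst, one_mul]

end HSLagrangian
end

open scoped ContDiff

noncomputable section

namespace HSLagrangian

open Set Filter Topology Complex

/-! ### Adapted frames -/

/-- The conformal factor `e^{2ρ}`. -/
def confFactor (M : ℂ → Mat3) (z : ℂ) : ℝ := normSq (mc M z 1 0 2) + normSq (mc M z 1 1 2)

/-- Smooth unitary frames on `Ω` whose last column is a horizontal conformal immersion `û` with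
Lagrangian angle `det`: the Maurer–Cartan form `A` has `A₃₃ = 0`, and the vector
`α = (A₁₃, A₂₃)` satisfies `α(∂/∂y) = J conj (α(∂/∂x))`, `α(∂/∂x) ≠ 0`. -/
structure IsAdapted (Ω : Set ℂ) (M : ℂ → Mat3) : Prop where
  smooth : SmoothMatOn M Ω
  unitary : UnitaryOn M Ω
  horizontal : ∀ z ∈ Ω, ∀ X, mc M z X 2 2 = 0
  rot_zero : ∀ z ∈ Ω, mc M z I 0 2 = -(starRingEnd ℂ) (mc M z 1 1 2)
  rot_one : ∀ z ∈ Ω, mc M z I 1 2 = (starRingEnd ℂ) (mc M z 1 0 2)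
  nondeg : ∀ z ∈ Ω, 0 < confFactor M z

variable {Ω : Set ℂ}

theorem matField_apply (F : Ω → U3) {z : ℂ} (hz : z ∈ Ω) : matField F z = (F ⟨z, hz⟩ : Mat3) :=
  zeroExt_apply _ hz

theorem unitaryOn_matField (F : Ω → U3) : UnitaryOn (matField F) Ω := fun z hz => by
  rw [matField_apply F hz]
  exact Matrix.UnitaryGroup.star_mul_self _

/-- The projector onto the last coordinate. -/
def lastProj : Mat3 := Matrix.single 2 2 1

theorem mul_lastProj_mul_star_apply (M : Mat3) (i j : Fin 3) :
    (M * lastProj * star M) i j = M i 2 * (starRingEnd ℂ) (M j 2) := by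
  simp [lastProj, Matrix.mul_apply, Fin.sum_univ_three, Matrix.single_apply]

theorem proj_lastColLine (g : U3) : proj (lastColLine g) = (g : Mat3) * lastProj * star (g : Mat3) := by
  have h1 : star (g : Mat3) * (g : Mat3) = 1 := Matrix.UnitaryGroup.star_mul_self g
  have h2 := congrFun (congrFun h1 2) 2
  have h3 : (fun i => (g : Mat3) i 2) ⬝ᵥ star (fun i => (g : Mat3) i 2) = 1 := by
    rw [dotProduct_comm]
    simpa [Matrix.mul_apply, dotProduct] using h2
  rw [lastColLine, proj_mk, h3]
  ext i j
  rw [mul_lastProj_mul_star_apply]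
  simp [Matrix.vecMulVec_apply]

theorem projField_eq {u : Ω → CP2} {F : Ω → U3} (hu : ∀ z, u z = lastColLine (F z)) :
    ∀ z ∈ Ω, projField u z = matField F z * lastProj * star (matField F z) := fun z hz => by
  rw [projField, zeroExt_apply _ hz, hu, proj_lastColLine, matField_apply F hz]

section Projector

variable {M P : ℂ → Mat3}

/-- As A is skew-Hermitian, dP is conjugate to the commutator of A with the last projector. That
commutator only sees the off-diagonal part of the last row and column of A, which represents the
differential of u. -/
theorem dMat_projector (hΩ : IsOpen Ω) (hM : SmoothMatOn M Ω) (hU : UnitaryOn M Ω)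
    (hP : ∀ z ∈ Ω, P z = M z * lastProj * star (M z)) {z : ℂ} (hz : z ∈ Ω) (X : ℂ) :
    dMat P z X = M z * (mc M z X * lastProj - lastProj * mc M z X) * star (M z) := by
  have hd := hM.diffMatAt hΩ hz
  rw [dMat_congr_on hΩ hP hz, dMat_mul (hd.mul (DiffMatAt.const _ z)) hd.star,
    dMat_mul hd (DiffMatAt.const _ z), dMat_const, dMat_star hd, dMat_eq_mul_mc hU hz, star_mul,
    star_mc hΩ hM hU hz]
  noncomm_ring

theorem commutator_lastProj (A : Mat3) : A * lastProj - lastProj * A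
    = !![0, 0, A 0 2; 0, 0, A 1 2; -A 2 0, -A 2 1, 0] := by
  ext i j
  fin_cases i <;> fin_cases j <;>
    simp [lastProj, Matrix.mul_apply, Matrix.single_apply]

theorem trace_projector (hΩ : IsOpen Ω) (hM : SmoothMatOn M Ω) (hU : UnitaryOn M Ω)
    (hP : ∀ z ∈ Ω, P z = M z * lastProj * star (M z)) {z : ℂ} (hz : z ∈ Ω) (X Y : ℂ) :
    (P z * dMat P z X * dMat P z Y).trace
      = (starRingEnd ℂ) (mc M z X 0 2) * mc M z Y 0 2
        + (starRingEnd ℂ) (mc M z X 1 2) * mc M z Y 1 2 := by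
  rw [dMat_projector hΩ hM hU hP hz, dMat_projector hΩ hM hU hP hz, hP z hz,
    commutator_lastProj, commutator_lastProj, conj_mc_apply hΩ hM hU hz, conj_mc_apply hΩ hM hU hz]
  have e : ∀ N N' : Mat3, M z * lastProj * star (M z) * (M z * N * star (M z))
      * (M z * N' * star (M z)) = M z * (lastProj * N * N' * star (M z)) := by
    intro N N'
    calc _ = M z * (lastProj * (star (M z) * M z) * N * (star (M z) * M z) * N' * star (M z)) := by
          noncomm_ring
      _ = _ := by rw [hU z hz]; noncomm_ring
  rw [e, Matrix.trace_mul_comm, mul_assoc, hU z hz, mul_one]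
  simp [lastProj, Matrix.trace, Matrix.mul_apply, Fin.sum_univ_three, Matrix.single_apply]

end Projector

theorem IsAdapted.mc_zero {M : ℂ → Mat3} (h : IsAdapted Ω M) {z : ℂ} (hz : z ∈ Ω) (X : ℂ) :
    mc M z X 0 2 = X.re * mc M z 1 0 2 - X.im * (starRingEnd ℂ) (mc M z 1 1 2) := by
  rw [mc_basis]
  simp only [Matrix.add_apply, Matrix.smul_apply, smul_eq_mul, h.rot_zero z hz]
  ring

theorem IsAdapted.mc_one {M : ℂ → Mat3} (h : IsAdapted Ω M) {z : ℂ} (hz : z ∈ Ω) (X : ℂ) :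
    mc M z X 1 2 = X.re * mc M z 1 1 2 + X.im * (starRingEnd ℂ) (mc M z 1 0 2) := by
  rw [mc_basis]
  simp only [Matrix.add_apply, Matrix.smul_apply, smul_eq_mul, h.rot_one z hz]

/-- The vectors α(∂x) and J conj α(∂x) are Hermitian orthogonal and have the same norm. The product
is therefore real: its real part gives conformality, its vanishing imaginary part gives the
Lagrangian condition. -/
theorem IsAdapted.herm {M : ℂ → Mat3} (h : IsAdapted Ω M) {z : ℂ} (hz : z ∈ Ω) (X Y : ℂ) :
    (starRingEnd ℂ) (mc M z X 0 2) * mc M z Y 0 2 + (starRingEnd ℂ) (mc M z X 1 2) * mc M z Y 1 2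
      = ((confFactor M z * (X * (starRingEnd ℂ) Y).re : ℝ) : ℂ) := by
  rw [h.mc_zero hz X, h.mc_zero hz Y, h.mc_one hz X, h.mc_one hz Y, confFactor]
  push_cast
  rw [normSq_eq_conj_mul_self, normSq_eq_conj_mul_self]
  simp only [map_sub, map_add, map_mul, conj_ofReal, conj_conj, mul_re, conj_re, conj_im]
  push_cast
  ring

section Frame

variable {u : Ω → CP2} {F : Ω → U3}

theorem IsAdapted.trace_eq (hΩ : IsOpen Ω) (hF : IsAdapted Ω (matField F))
    (hu : ∀ z, u z = lastColLine (F z)) {z : ℂ} (hz : z ∈ Ω) (X Y : ℂ) :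
    (projField u z * dMat (projField u) z X * dMat (projField u) z Y).trace
      = ((confFactor (matField F) z * (X * (starRingEnd ℂ) Y).re : ℝ) : ℂ) := by
  rw [trace_projector hΩ hF.smooth hF.unitary (projField_eq hu) hz, hF.herm hz]

theorem IsAdapted.metric_eq (hΩ : IsOpen Ω) (hF : IsAdapted Ω (matField F))
    (hu : ∀ z, u z = lastColLine (F z)) {z : ℂ} (hz : z ∈ Ω) (X Y : ℂ) :
    metric u z X Y = confFactor (matField F) z * (X * (starRingEnd ℂ) Y).re := by
  rw [metric, hF.trace_eq hΩ hu hz, ofReal_re]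

theorem IsAdapted.isSmooth (hF : IsAdapted Ω (matField F))
    (hu : ∀ z, u z = lastColLine (F z)) : IsSmooth u :=
  SmoothMatOn.congr ((hF.smooth.mul (SmoothMatOn.const lastProj Ω)).mul hF.smooth.star)
    (projField_eq hu)

theorem IsAdapted.isConformal (hΩ : IsOpen Ω) (hF : IsAdapted Ω (matField F))
    (hu : ∀ z, u z = lastColLine (F z)) : IsConformal u := fun z hz => by
  refine ⟨Real.log (confFactor (matField F) z) / 2, fun X Y => ?_⟩
  rw [mul_div_cancel₀ _ (two_ne_zero), Real.exp_log (hF.nondeg z hz), hF.metric_eq hΩ hu hz]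

theorem IsAdapted.isLagrangian (hΩ : IsOpen Ω) (hF : IsAdapted Ω (matField F))
    (hu : ∀ z, u z = lastColLine (F z)) : IsLagrangian u := fun z hz X Y => by
  rw [kahler, hF.trace_eq hΩ hu hz, ofReal_im]

theorem IsAdapted.isImmersion (hΩ : IsOpen Ω) (hF : IsAdapted Ω (matField F))
    (hu : ∀ z, u z = lastColLine (F z)) : IsImmersion u := fun z hz X hX => by
  have h1 := hF.metric_eq hΩ hu hz X X
  rw [metric, hX, mul_zero, Matrix.trace_zero, zero_re, mul_conj, ofReal_re] at h1
  have h2 : normSq X = 0 := by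
    rcases mul_eq_zero.mp h1.symm with h | h
    · exact absurd h (hF.nondeg z hz).ne'
    · exact h
  exact normSq_eq_zero.mp h2

/-- In the frame, (∂û/∂x, ∂û/∂y, û) is F times a matrix of determinant det(α(∂x), J conj α(∂x)) =
|α(∂x)|², the conformal factor. -/
theorem IsAdapted.isLegendrianFraming (hΩ : IsOpen Ω) (hF : IsAdapted Ω (matField F))
    (hu : ∀ z, u z = lastColLine (F z)) : IsLegendrianFraming u F where
  smooth := hF.smooth
  lift := hu
  horizontal := fun z X => by
    have := hF.horizontal z z.2 X
    rw [mc, matField_apply F z.2] at this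
    simpa [Matrix.mul_apply] using! this
  angle := fun z => by
    have hz := z.2
    have e : (Matrix.of fun i j => ![dMat (matField F) z 1 i 2, dMat (matField F) z I i 2,
        (F z : Mat3) i 2] j : Mat3) = (F z : Mat3)
          * !![mc (matField F) z 1 0 2, mc (matField F) z I 0 2, 0;
               mc (matField F) z 1 1 2, mc (matField F) z I 1 2, 0; 0, 0, 1] := by
      rw [dMat_eq_mul_mc hF.unitary hz, dMat_eq_mul_mc hF.unitary hz, matField_apply F hz]
      ext i j
      fin_cases j <;>
        simp [Matrix.mul_apply, Fin.sum_univ_three, hF.horizontal z hz]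
    rw [e, Matrix.det_mul, hF.metric_eq hΩ hu hz, hF.rot_zero z hz, hF.rot_one z hz, mul_comm]
    congr 1
    rw [Matrix.det_fin_three]
    simp only [confFactor, map_one, mul_one, one_re, ofReal_add, normSq_eq_conj_mul_self]
    simp
    ring

end Frame

/-- A Legendrian framing of a conformal Lagrangian immersion is adapted. -/
theorem IsLegendrianFraming.isAdapted {u : Ω → CP2} {F : Ω → U3} (hΩ : IsOpen Ω)
    (h : IsLegendrianFraming u F) (hc : IsConformal u) : IsAdapted Ω (matField F) := by
  have hU := unitaryOn_matField F
  have hh : ∀ z ∈ Ω, ∀ X, mc (matField F) z X 2 2 = 0 := by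
    intro z hz X
    have := h.horizontal ⟨z, hz⟩ X
    rw [mc, matField_apply F hz]
    simpa [Matrix.mul_apply] using! this
  have hm : ∀ z ∈ Ω, ∀ X, metric u z X X
      = normSq (mc (matField F) z X 0 2) + normSq (mc (matField F) z X 1 2) := by
    intro z hz X
    rw [metric, trace_projector hΩ h.smooth hU (projField_eq h.lift) hz,
      ← normSq_eq_conj_mul_self, ← normSq_eq_conj_mul_self, ← ofReal_add, ofReal_re]
  have hpos : ∀ z ∈ Ω, 0 < metric u z 1 1 ∧ metric u z I I = metric u z 1 1 := by
    intro z hz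
    obtain ⟨ρ, hρ⟩ := hc z hz
    rw [hρ, hρ]
    refine ⟨by simpa using Real.exp_pos _, by simp⟩
  have hdet : ∀ z ∈ Ω, ((metric u z 1 1 : ℝ) : ℂ)
      = mc (matField F) z 1 0 2 * mc (matField F) z I 1 2
        - mc (matField F) z I 0 2 * mc (matField F) z 1 1 2 := by
    intro z hz
    have ha := h.angle ⟨z, hz⟩
    have e : (Matrix.of fun i j => ![dMat (matField F) z 1 i 2, dMat (matField F) z I i 2,
        (F ⟨z, hz⟩ : Mat3) i 2] j : Mat3) = (F ⟨z, hz⟩ : Mat3)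
          * !![mc (matField F) z 1 0 2, mc (matField F) z I 0 2, 0;
               mc (matField F) z 1 1 2, mc (matField F) z I 1 2, 0; 0, 0, 1] := by
      rw [dMat_eq_mul_mc hU hz, dMat_eq_mul_mc hU hz, matField_apply F hz]
      ext i j
      fin_cases j <;> simp [Matrix.mul_apply, Fin.sum_univ_three, hh z hz]
    rw [e, Matrix.det_mul, mul_comm] at ha
    have hne : (F ⟨z, hz⟩ : Mat3).det ≠ 0 := by
      intro h0
      have := congrArg Matrix.det (Matrix.UnitaryGroup.star_mul_self (F ⟨z, hz⟩))
      rw [Matrix.det_mul, h0, mul_zero, Matrix.det_one] at this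
      exact zero_ne_one this
    rw [mul_left_cancel₀ hne ha, Matrix.det_fin_three]
    simp
  -- Equality case of an inequality: |α(∂y) - J conj α(∂x)|² = |α(∂x)|² + |α(∂y)|² - 2 Re det(α(∂x),
  -- α(∂y)). Conformality and the angle condition make each norm squared and the determinant equal
  -- to e^{2ρ}.
  have key : ∀ z ∈ Ω, normSq (mc (matField F) z I 0 2 + (starRingEnd ℂ) (mc (matField F) z 1 1 2))
      + normSq (mc (matField F) z I 1 2 - (starRingEnd ℂ) (mc (matField F) z 1 0 2)) = 0 := by
    intro z hz
    have h1 := hm z hz 1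
    have h2 := hm z hz I
    rw [(hpos z hz).2] at h2
    have h3 := congrArg re (hdet z hz)
    rw [ofReal_re] at h3
    simp only [sub_re, mul_re] at h3
    simp only [normSq_apply, add_re, add_im, sub_re, sub_im, conj_re, conj_im] at h1 h2 ⊢
    linarith
  have key' := fun z hz => (add_eq_zero_iff_of_nonneg (normSq_nonneg _) (normSq_nonneg _)).mp
    (key z hz)
  refine ⟨h.smooth, hU, hh, fun z hz => ?_, fun z hz => ?_, fun z hz => ?_⟩
  · exact eq_neg_of_add_eq_zero_left (normSq_eq_zero.mp (key' z hz).1)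
  · exact sub_eq_zero.mp (normSq_eq_zero.mp (key' z hz).2)
  · rw [confFactor, ← hm z hz]
    exact (hpos z hz).1

end HSLagrangian
end

/-! ### First variation of the area and the Lagrangian angle. -/

open scoped ContDiff

noncomputable section

namespace HSLagrangian

open Set Filter Topology Complex MeasureTheory

/-! ### Two facts on integrals -/

/-- Derivation under the integral sign over a compact set. -/
theorem hasDerivAt_setIntegral_of_contDiffOn {W : Set (ℝ × ℂ)} (hW : IsOpen W) {h : ℝ × ℂ → ℝ}
    (hh : ContDiffOn ℝ ∞ h W) {K : Set ℂ} (hK : IsCompact K) (hKW : ∀ z ∈ K, ((0 : ℝ), z) ∈ W) :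
    HasDerivAt (fun t : ℝ => ∫ z in K, h (t, z)) (∫ z in K, fderiv ℝ h (0, z) (1, 0)) 0 := by
  -- The tube lemma provides an interval of times common to all points of K, on which the derivative
  -- in t is bounded by compactness.
  obtain ⟨O, V, hO, -, h0O, hKV, hOV⟩ := generalized_tube_lemma (s := {(0 : ℝ)})
    isCompact_singleton hK hW (by rintro ⟨t, z⟩ ⟨rfl, hz⟩; exact hKW z hz)
  obtain ⟨ε, hε, hball⟩ := Metric.nhds_basis_closedBall.mem_iff.mp (hO.mem_nhds (h0O rfl))
  have hsub : Metric.closedBall (0 : ℝ) ε ×ˢ K ⊆ W := fun p hp =>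
    hOV ⟨hball hp.1, hKV hp.2⟩
  have hder : ContinuousOn (fun p => fderiv ℝ h p (1, 0)) W :=
    (hh.continuousOn_fderiv_of_isOpen hW (by simp)).clm_apply continuousOn_const
  obtain ⟨C, hC⟩ := ((isCompact_closedBall (0 : ℝ) ε).prod hK).exists_bound_of_continuousOn
    (hder.mono hsub)
  have hslice : ∀ {f : ℝ × ℂ → ℝ}, ContinuousOn f W → ∀ t ∈ Metric.closedBall (0 : ℝ) ε,
      ContinuousOn (fun z => f (t, z)) K := fun hf t ht =>
    hf.comp (continuousOn_const.prodMk continuousOn_id) fun z hz => hsub ⟨ht, hz⟩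
  have h0 : (0 : ℝ) ∈ Metric.closedBall (0 : ℝ) ε := Metric.mem_closedBall_self hε.le
  refine (hasDerivAt_integral_of_dominated_loc_of_deriv_le (μ := volume.restrict K)
    (F := fun t z => h (t, z)) (F' := fun t z => fderiv ℝ h (t, z) (1, 0))
    (bound := fun _ => C) (Metric.closedBall_mem_nhds (0 : ℝ) hε) ?_ ?_ ?_ ?_ ?_ ?_).2
  · filter_upwards [Metric.closedBall_mem_nhds (0 : ℝ) hε] with t ht
    exact (hslice hh.continuousOn t ht).aestronglyMeasurable hK.measurableSet
  · exact (hslice hh.continuousOn 0 h0).integrableOn_compact hK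
  · exact (hslice hder 0 h0).aestronglyMeasurable hK.measurableSet
  · filter_upwards [ae_restrict_mem hK.measurableSet] with z hz t ht
    exact hC (t, z) ⟨ht, hz⟩
  · exact integrableOn_const hK.measure_lt_top.ne
  · filter_upwards [ae_restrict_mem hK.measurableSet] with z hz t ht
    have h1 : HasFDerivAt h (fderiv ℝ h (t, z)) (t, z) :=
      ((hh.differentiableOn (by simp)).differentiableAt
        (hW.mem_nhds (hsub ⟨ht, hz⟩))).hasFDerivAt
    exact h1.comp_hasDerivAt t ((hasDerivAt_id t).prodMk (hasDerivAt_const t z))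

theorem contDiff_of_eq_zero_off {Ω K : Set ℂ} (hΩ : IsOpen Ω) {V : ℂ → ℝ}
    (hV : ContDiffOn ℝ ∞ V Ω) (hK : IsCompact K) (hKΩ : K ⊆ Ω) (h0 : ∀ z ∉ K, V z = 0) :
    ContDiff ℝ ∞ V := by
  rw [contDiff_iff_contDiffAt]
  intro z
  by_cases hz : z ∈ K
  · exact hV.contDiffAt (hΩ.mem_nhds (hKΩ hz))
  · refine (contDiffAt_const (c := (0 : ℝ))).congr_of_eventuallyEq ?_
    filter_upwards [hK.isClosed.isOpen_compl.mem_nhds hz] with w hw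
    exact h0 w hw

theorem fderiv_eq_zero_off {K : Set ℂ} {V : ℂ → ℝ} (hK : IsCompact K) (h0 : ∀ z ∉ K, V z = 0)
    {z : ℂ} (hz : z ∉ K) : fderiv ℝ V z = 0 := by
  have : V =ᶠ[𝓝 z] fun _ => 0 := by
    filter_upwards [hK.isClosed.isOpen_compl.mem_nhds hz] with w hw
    exact h0 w hw
  rw [this.fderiv_eq, fderiv_fun_const]
  rfl

/-- The integral of a derivative of a function with compact support vanishes. -/
theorem setIntegral_fderiv_eq_zero {Ω K : Set ℂ} (hΩ : IsOpen Ω) {V : ℂ → ℝ}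
    (hV : ContDiffOn ℝ ∞ V Ω) (hK : IsCompact K) (hKΩ : K ⊆ Ω) (h0 : ∀ z ∉ K, V z = 0) (X : ℂ) :
    ∫ z in K, fderiv ℝ V z X = 0 := by
  have hVs := contDiff_of_eq_zero_off hΩ hV hK hKΩ h0
  have hsupp : HasCompactSupport V := HasCompactSupport.intro hK h0
  rw [setIntegral_eq_integral_of_forall_compl_eq_zero fun z hz => by
    rw [fderiv_eq_zero_off hK h0 hz]; rfl]
  have hc : Continuous fun z => fderiv ℝ V z X :=
    (hVs.continuous_fderiv (by simp)).clm_apply continuous_const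
  have hi : Integrable fun z => fderiv ℝ V z X :=
    hc.integrable_of_hasCompactSupport (hsupp.fderiv_apply (𝕜 := ℝ) X)
  have := integral_mul_fderiv_eq_neg_fderiv_mul_of_integrable (μ := (volume : Measure ℂ))
    (f := fun _ => (1 : ℝ)) (g := V) (v := X) (by simp) (by simpa using hi)
    (by simpa using hVs.continuous.integrable_of_hasCompactSupport hsupp)
    (fun _ _ => differentiableAt_const _) (fun z _ => hVs.differentiable (by simp) z)
  simpa using this

/-! ### Projectors -/

open scoped ComplexOrder in
theorem rep_dotProduct_ne_zero (p : CP2) : p.rep ⬝ᵥ star p.rep ≠ 0 := by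
  rw [Ne, dotProduct_comm, dotProduct_star_self_eq_zero]
  exact p.rep_nonzero

theorem proj_mul_self (p : CP2) : proj p * proj p = proj p := by
  have h := rep_dotProduct_ne_zero p
  rw [proj, Matrix.smul_mul, Matrix.mul_smul, Matrix.vecMulVec_mul_vecMulVec, smul_smul,
    dotProduct_comm (star p.rep), Matrix.vecMulVec_smul, smul_smul, mul_assoc,
    inv_mul_cancel₀ h, mul_one]

theorem star_proj (p : CP2) : star (proj p) = proj p := by
  have h : star (p.rep ⬝ᵥ star p.rep) = p.rep ⬝ᵥ star p.rep := by
    simp [dotProduct, mul_comm]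
  rw [proj, star_smul, star_inv₀, h]
  congr 1
  ext i j
  simp [Matrix.vecMulVec_apply, Matrix.star_apply, mul_comm]

section Field

variable {Ω : Set ℂ}

theorem zeroExt_of_notMem {E : Type*} [Zero E] (f : Ω → E) {z : ℂ} (hz : z ∉ Ω) :
    zeroExt f z = 0 :=
  Function.extend_apply' _ _ _ (by rintro ⟨a, rfl⟩; exact hz a.2)

theorem projField_mul_self (u : Ω → CP2) {z : ℂ} (hz : z ∈ Ω) :
    projField u z * projField u z = projField u z := by
  rw [projField, zeroExt_apply _ hz, proj_mul_self]

theorem star_projField (u : Ω → CP2) {z : ℂ} (hz : z ∈ Ω) :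
    star (projField u z) = projField u z := by
  rw [projField, zeroExt_apply _ hz, star_proj]

/-- For a field of projectors, the metric is half the Hilbert–Schmidt norm of the differential. -/
theorem metric_self (hΩ : IsOpen Ω) {u : Ω → CP2} (hu : IsSmooth u) {z : ℂ} (hz : z ∈ Ω) (X : ℂ) :
    metric u z X X
      = (1 / 2) * ((dMat (projField u) z X * dMat (projField u) z X).trace).re := by
  set P := projField u
  have hd : DiffMatAt P z := SmoothMatOn.diffMatAt hu hΩ hz
  -- Differentiation of P² = P. By cyclicity of the trace, tr(dP dP) then splits into two halves
  -- equal to tr(P dP dP).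
  have h1 : dMat P z X = dMat P z X * P z + P z * dMat P z X := by
    rw [← dMat_mul hd hd]
    exact dMat_congr_on hΩ (fun w hw => (projField_mul_self u hw).symm) hz X
  have h2 : (dMat P z X * dMat P z X).trace = 2 * (P z * dMat P z X * dMat P z X).trace := by
    calc (dMat P z X * dMat P z X).trace
        = ((dMat P z X * P z + P z * dMat P z X) * dMat P z X).trace := by rw [← h1]
      _ = (dMat P z X * (P z * dMat P z X)).trace + (P z * dMat P z X * dMat P z X).trace := by
          rw [add_mul, Matrix.trace_add, mul_assoc]
      _ = _ := by rw [Matrix.trace_mul_comm, two_mul]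
  rw [h2, metric]
  simp [P]

end Field

/-! ### Variations -/

section Variation

variable {Ω : Set ℂ} {u : Ω → CP2} {U : ℝ → Ω → CP2} {K : Set ℂ}

theorem IsVariation.hasFDerivAt (hΩ : IsOpen Ω) (h : IsVariation u U K) (i j : Fin 3) (t : ℝ)
    {z : ℂ} (hz : z ∈ Ω) :
    HasFDerivAt (fun p : ℝ × ℂ => projField (U p.1) p.2 i j)
      (fderiv ℝ (fun p : ℝ × ℂ => projField (U p.1) p.2 i j) (t, z)) (t, z) :=
  (((h.smooth i j).differentiableOn (by simp)).differentiableAt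
    ((isOpen_univ.prod hΩ).mem_nhds ⟨mem_univ _, hz⟩)).hasFDerivAt

theorem IsVariation.dMat_eq (hΩ : IsOpen Ω) (h : IsVariation u U K) (i j : Fin 3) (t : ℝ)
    {z : ℂ} (hz : z ∈ Ω) (X : ℂ) : dMat (projField (U t)) z X i j
      = fderiv ℝ (fun p : ℝ × ℂ => projField (U p.1) p.2 i j) (t, z) (0, X) := by
  have h1 : HasFDerivAt (fun w : ℂ => ((t, w) : ℝ × ℂ)) ((0 : ℂ →L[ℝ] ℝ).prod (.id ℝ ℂ)) z :=
    (hasFDerivAt_const t z).prodMk (hasFDerivAt_id z)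
  have h2 := ((h.hasFDerivAt hΩ i j t hz).comp z h1).fderiv
  exact DFunLike.congr_fun h2 X

theorem IsVariation.hasDerivAt (hΩ : IsOpen Ω) (h : IsVariation u U K) (i j : Fin 3) {z : ℂ}
    (hz : z ∈ Ω) : HasDerivAt (fun t => projField (U t) z i j) (variationField U z i j) 0 := by
  have h1 := (h.hasFDerivAt hΩ i j 0 hz).comp_hasDerivAt (0 : ℝ)
    ((hasDerivAt_id (0 : ℝ)).prodMk (hasDerivAt_const (0 : ℝ) z))
  exact h1.differentiableAt.hasDerivAt

theorem IsVariation.variationField_eq (hΩ : IsOpen Ω) (h : IsVariation u U K) (i j : Fin 3) {z : ℂ}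
    (hz : z ∈ Ω) : variationField U z i j
      = fderiv ℝ (fun p : ℝ × ℂ => projField (U p.1) p.2 i j) (0, z) (1, 0) := by
  have h1 := (h.hasFDerivAt hΩ i j 0 hz).comp_hasDerivAt (0 : ℝ)
    ((hasDerivAt_id (0 : ℝ)).prodMk (hasDerivAt_const (0 : ℝ) z))
  exact h1.deriv

theorem IsVariation.contDiffOn_fderiv (hΩ : IsOpen Ω) (h : IsVariation u U K) (i j : Fin 3)
    (v : ℝ × ℂ) : ContDiffOn ℝ ∞
      (fun q => fderiv ℝ (fun p : ℝ × ℂ => projField (U p.1) p.2 i j) q v) (univ ×ˢ Ω) :=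
  ((h.smooth i j).fderiv_of_isOpen (isOpen_univ.prod hΩ) (m := ∞) (by simp)).clm_apply
    contDiffOn_const

theorem IsVariation.isSmooth (h : IsVariation u U K) (t : ℝ) : IsSmooth (U t) := fun i j => by
  have h1 : ContDiffOn ℝ ∞ (fun w : ℂ => (t, w)) Ω := contDiffOn_const.prodMk contDiffOn_id
  have h2 := (h.smooth i j).comp h1 fun _ hz => ⟨mem_univ _, hz⟩
  simpa only [Function.comp_def] using h2

theorem IsVariation.smooth_variationField (hΩ : IsOpen Ω) (h : IsVariation u U K) :
    SmoothMatOn (variationField U) Ω := fun i j => by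
  have h1 : ContDiffOn ℝ ∞ (fun w : ℂ => ((0 : ℝ), w)) Ω := contDiffOn_const.prodMk contDiffOn_id
  have h2 := (h.contDiffOn_fderiv hΩ i j (1, 0)).comp h1 fun _ hz => ⟨mem_univ _, hz⟩
  exact h2.congr fun _ hz => h.variationField_eq hΩ i j hz

theorem IsVariation.variationField_eq_zero (h : IsVariation u U K) {z : ℂ} (hz : z ∉ K) :
    variationField U z = 0 := by
  have : ∀ t, projField (U t) z = projField u z := by
    intro t
    by_cases hzΩ : z ∈ Ω
    · rw [projField, projField, zeroExt_apply _ hzΩ, zeroExt_apply _ hzΩ, h.fixed t ⟨z, hzΩ⟩ hz]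
    · rw [projField, projField, zeroExt_of_notMem _ hzΩ, zeroExt_of_notMem _ hzΩ]
  ext i j
  simp [variationField, this]

/-- Symmetry of the second derivatives in (t, z): the time derivative of dP is the differential of
the variation field. -/
theorem IsVariation.hasDerivAt_dMat (hΩ : IsOpen Ω) (h : IsVariation u U K) (i j : Fin 3) {z : ℂ}
    (hz : z ∈ Ω) (X : ℂ) : HasDerivAt (fun t => dMat (projField (U t)) z X i j)
      (dMat (variationField U) z X i j) 0 := by
  have hO := isOpen_univ.prod hΩ (X := ℝ)
  set Q : ℝ × ℂ → ℂ := fun p => projField (U p.1) p.2 i j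
  have h1 : HasFDerivAt (fun q => fderiv ℝ Q q (0, X)) _ ((0 : ℝ), z) :=
    (((h.contDiffOn_fderiv hΩ i j (0, X)).differentiableOn (by simp)).differentiableAt
      (hO.mem_nhds ⟨mem_univ _, hz⟩)).hasFDerivAt
  have h2 := h1.comp_hasDerivAt (0 : ℝ)
    ((hasDerivAt_id (0 : ℝ)).prodMk (hasDerivAt_const (0 : ℝ) z))
  have h3 : HasFDerivAt (fun q => fderiv ℝ Q q (1, 0)) _ ((0 : ℝ), z) :=
    (((h.contDiffOn_fderiv hΩ i j (1, 0)).differentiableOn (by simp)).differentiableAt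
      (hO.mem_nhds ⟨mem_univ _, hz⟩)).hasFDerivAt
  have h4 : HasFDerivAt (fun w : ℂ => ((0, w) : ℝ × ℂ)) ((0 : ℂ →L[ℝ] ℝ).prod (.id ℝ ℂ)) z :=
    (hasFDerivAt_const (0 : ℝ) z).prodMk (hasFDerivAt_id z)
  have h5 : dMat (variationField U) z X i j
      = fderiv ℝ (fun q => fderiv ℝ Q q (1, 0)) (0, z) (0, X) := by
    have e : (fun w => variationField U w i j) =ᶠ[𝓝 z] fun w => fderiv ℝ Q (0, w) (1, 0) := by
      filter_upwards [hΩ.mem_nhds hz] with w hw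
      exact h.variationField_eq hΩ i j hw
    have h6 := (h3.comp z h4).fderiv
    change fderiv ℝ (fun w => variationField U w i j) z X = _
    rw [e.fderiv_eq]
    exact DFunLike.congr_fun h6 X
  rw [h5, fderiv_fderiv_symm hO (h.smooth i j) ⟨mem_univ _, hz⟩]
  refine h2.congr_of_eventuallyEq (Eventually.of_forall fun t => ?_)
  exact h.dMat_eq hΩ i j t hz X

/-- The variation field is tangent to the space of projectors. -/
theorem IsVariation.tangent (hΩ : IsOpen Ω) (h : IsVariation u U K) {z : ℂ} (hz : z ∈ Ω) :
    variationField U z = variationField U z * projField u z + projField u z * variationField U z := by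
  ext i j
  have h1 : HasDerivAt (fun t => ∑ k, projField (U t) z i k * projField (U t) z k j)
      (∑ k, (variationField U z i k * projField u z k j
        + projField u z i k * variationField U z k j)) 0 := by
    refine HasDerivAt.fun_sum fun k _ => ?_
    have := (h.hasDerivAt hΩ i k hz).mul (h.hasDerivAt hΩ k j hz)
    rwa [h.initial] at this
  have h2 : (fun t => ∑ k, projField (U t) z i k * projField (U t) z k j)
      = fun t => projField (U t) z i j := by
    funext t
    rw [← Matrix.mul_apply, projField_mul_self _ hz]
  rw [h2] at h1
  rw [(h.hasDerivAt hΩ i j hz).unique h1, Finset.sum_add_distrib]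
  rfl

theorem IsVariation.star_variationField (hΩ : IsOpen Ω) (h : IsVariation u U K) {z : ℂ}
    (hz : z ∈ Ω) : star (variationField U z) = variationField U z := by
  ext i j
  have h1 : HasDerivAt (fun t => star (projField (U t) z j i)) (star (variationField U z j i)) 0 :=
    (h.hasDerivAt hΩ j i hz).star
  have h2 : (fun t => star (projField (U t) z j i)) = fun t => projField (U t) z i j := by
    funext t
    conv_rhs => rw [← star_projField _ hz]
    rfl
  rw [h2] at h1
  exact h1.unique (h.hasDerivAt hΩ i j hz)

end Variation

end HSLagrangian
end

open scoped ContDiff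

noncomputable section

namespace HSLagrangian

open Set Filter Topology Complex MeasureTheory

/-! ### The first variation of the area -/

section FirstVariation

variable {Ω : Set ℂ} {u : Ω → CP2} {U : ℝ → Ω → CP2} {K : Set ℂ}

theorem IsVariation.contDiffOn_metric (hΩ : IsOpen Ω) (h : IsVariation u U K) (X Y : ℂ) :
    ContDiffOn ℝ ∞ (fun p : ℝ × ℂ => metric (U p.1) p.2 X Y) (univ ×ˢ Ω) := by
  have h1 : ContDiffOn ℝ ∞ (fun p : ℝ × ℂ => ∑ i, ∑ k, (∑ j, projField (U p.1) p.2 i j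
      * fderiv ℝ (fun p : ℝ × ℂ => projField (U p.1) p.2 j k) p (0, X))
      * fderiv ℝ (fun p : ℝ × ℂ => projField (U p.1) p.2 k i) p (0, Y)) (univ ×ˢ Ω) :=
    ContDiffOn.sum fun i _ => ContDiffOn.sum fun k _ => (ContDiffOn.sum fun j _ =>
      (h.smooth i j).mul (h.contDiffOn_fderiv hΩ j k (0, X))).mul
        (h.contDiffOn_fderiv hΩ k i (0, Y))
  refine (reCLM.contDiff.comp_contDiffOn h1).congr fun p hp => ?_
  simp only [metric, Matrix.trace, Matrix.diag, Matrix.mul_apply, h.dMat_eq hΩ _ _ p.1 hp.2]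
  rfl

/-- The expression of the metric as half of tr(dP dP) contains no undifferentiated P, so only the
symmetric product rule is needed and its two terms coincide. -/
theorem IsVariation.hasDerivAt_metric (hΩ : IsOpen Ω) (h : IsVariation u U K) {z : ℂ} (hz : z ∈ Ω)
    (X : ℂ) : HasDerivAt (fun t => metric (U t) z X X)
      ((dMat (variationField U) z X * dMat (projField u) z X).trace).re 0 := by
  have e : (fun t => metric (U t) z X X) = fun t => (1 / 2) * reCLM (∑ i, ∑ j,
      dMat (projField (U t)) z X i j * dMat (projField (U t)) z X j i) := by
    funext t
    rw [metric_self hΩ (h.isSmooth t) hz]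
    simp only [Matrix.trace, Matrix.diag, Matrix.mul_apply]
    rfl
  rw [e]
  have h1 : HasDerivAt (fun t => ∑ i, ∑ j,
      dMat (projField (U t)) z X i j * dMat (projField (U t)) z X j i)
      (∑ i, ∑ j, (dMat (variationField U) z X i j * dMat (projField u) z X j i
        + dMat (projField u) z X i j * dMat (variationField U) z X j i)) 0 := by
    refine HasDerivAt.fun_sum fun i _ => HasDerivAt.fun_sum fun j _ => ?_
    have := (h.hasDerivAt_dMat hΩ i j hz X).mul (h.hasDerivAt_dMat hΩ j i hz X)
    rwa [h.initial] at this
  refine (((reCLM.hasFDerivAt).comp_hasDerivAt (0 : ℝ) h1).const_mul (1 / 2)).congr_deriv ?_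
  have h2 : ∑ i, ∑ j, (dMat (variationField U) z X i j * dMat (projField u) z X j i
        + dMat (projField u) z X i j * dMat (variationField U) z X j i)
      = 2 * (dMat (variationField U) z X * dMat (projField u) z X).trace := by
    simp only [Finset.sum_add_distrib, two_mul, Matrix.trace, Matrix.diag, Matrix.mul_apply]
    congr 1
    rw [Finset.sum_comm]
    exact Finset.sum_congr rfl fun i _ => Finset.sum_congr rfl fun j _ => mul_comm _ _
  rw [h2]
  simp

/-- The first variation of the area of a conformal immersion. -/
theorem IsVariation.hasDerivAt_area (hΩ : IsOpen Ω) (h : IsVariation u U K) (hc : IsConformal u) :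
    HasDerivAt (fun t => area K (U t)) (∫ z in K, (1 / 2) *
      (((dMat (variationField U) z 1 * dMat (projField u) z 1).trace).re
        + ((dMat (variationField U) z I * dMat (projField u) z I).trace).re)) 0 := by
  set q : ℝ × ℂ → ℝ := fun p =>
    metric (U p.1) p.2 1 1 * metric (U p.1) p.2 I I - metric (U p.1) p.2 1 I ^ 2 with hq
  have hqs : ContDiffOn ℝ ∞ q (univ ×ˢ Ω) :=
    ((h.contDiffOn_metric hΩ 1 1).mul (h.contDiffOn_metric hΩ I I)).sub
      ((h.contDiffOn_metric hΩ 1 I).pow 2)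
  have hO : IsOpen ((univ : Set ℝ) ×ˢ Ω) := isOpen_univ.prod hΩ
  -- The area density is smooth only where the Gram determinant is positive. This open set contains
  -- {0} × K because the metric at t = 0 is conformal.
  set W : Set (ℝ × ℂ) := (univ ×ˢ Ω) ∩ q ⁻¹' Ioi 0
  have hW : IsOpen W := hqs.continuousOn.isOpen_inter_preimage hO isOpen_Ioi
  have hs : ContDiffOn ℝ ∞ (fun p => Real.sqrt (q p)) W :=
    ContDiffOn.sqrt (hqs.mono inter_subset_left) fun p hp => (ne_of_gt hp.2)
  have hconf : ∀ z ∈ Ω, ∃ c : ℝ, 0 < c ∧ metric (U 0) z 1 1 = c ∧ metric (U 0) z I I = c ∧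
      metric (U 0) z 1 I = 0 := by
    intro z hz
    obtain ⟨ρ, hρ⟩ := hc z hz
    rw [h.initial]
    exact ⟨Real.exp (2 * ρ), Real.exp_pos _, by simp [hρ], by simp [hρ], by simp [hρ]⟩
  have hKW : ∀ z ∈ K, ((0 : ℝ), z) ∈ W := by
    intro z hz
    obtain ⟨c, hc0, h1, h2, h3⟩ := hconf z (h.subset hz)
    refine ⟨⟨mem_univ _, h.subset hz⟩, ?_⟩
    simp only [hq, mem_preimage, mem_Ioi, h1, h2, h3]
    rw [zero_pow two_ne_zero, sub_zero]
    exact mul_pos hc0 hc0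
  have hmain := hasDerivAt_setIntegral_of_contDiffOn hW hs h.compact hKW
  refine hmain.congr_deriv (setIntegral_congr_fun h.compact.measurableSet fun z hz => ?_)
  have hzΩ := h.subset hz
  obtain ⟨c, hc0, h1, h2, h3⟩ := hconf z hzΩ
  have hd : HasDerivAt (fun t => Real.sqrt (q (t, z)))
      (fderiv ℝ (fun p => Real.sqrt (q p)) (0, z) (1, 0)) 0 := by
    have hf : HasFDerivAt (fun p => Real.sqrt (q p)) _ ((0 : ℝ), z) :=
      ((hs.differentiableOn (by simp)).differentiableAt (hW.mem_nhds (hKW z hz))).hasFDerivAt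
    exact hf.comp_hasDerivAt (0 : ℝ)
      ((hasDerivAt_id (0 : ℝ)).prodMk (hasDerivAt_const (0 : ℝ) z))
  have hm : DifferentiableAt ℝ (fun t => metric (U t) z 1 I) 0 :=
    ((((h.contDiffOn_metric hΩ 1 I).differentiableOn (by simp)).differentiableAt
      (hO.mem_nhds ⟨mem_univ _, hzΩ⟩)).hasFDerivAt.comp_hasDerivAt (0 : ℝ)
        ((hasDerivAt_id (0 : ℝ)).prodMk (hasDerivAt_const (0 : ℝ) z))).differentiableAt
  -- At t = 0 the diagonal entries both equal c and the off-diagonal one vanishes. The derivative of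
  -- the latter therefore drops out, and the density has derivative half the sum of those of the
  -- diagonal entries.
  have hqd := ((h.hasDerivAt_metric hΩ hzΩ 1).mul (h.hasDerivAt_metric hΩ hzΩ I)).sub
    (hm.hasDerivAt.pow 2)
  have hne : metric (U 0) z 1 1 * metric (U 0) z I I - metric (U 0) z 1 I ^ 2 ≠ 0 := by
    rw [h1, h2, h3]
    simp [hc0.ne']
  have hsd := hqd.sqrt hne
  refine (hd.unique hsd).trans ?_
  have hsq : Real.sqrt (c * c - 0 ^ 2) = c := by
    rw [zero_pow two_ne_zero, sub_zero, Real.sqrt_mul_self hc0.le]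
  simp only [Pi.sub_apply, Pi.mul_apply, Pi.pow_apply, h1, h2, h3, hsq]
  field_simp
  ring

end FirstVariation

/-! ### The tension field in an adapted frame -/

section Tension

variable {Ω : Set ℂ} {M : ℂ → Mat3}

theorem IsAdapted.dMat_mc_zero (hΩ : IsOpen Ω) (h : IsAdapted Ω M) {z : ℂ} (hz : z ∈ Ω) (Y : ℂ) :
    dMat (fun w => mc M w I) z Y 0 2 = -(starRingEnd ℂ) (dMat (fun w => mc M w 1) z Y 1 2) := by
  have e : (fun w => mc M w I 0 2) =ᶠ[𝓝 z] fun w => -(starRingEnd ℂ) (mc M w 1 1 2) := by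
    filter_upwards [hΩ.mem_nhds hz] with w hw using h.rot_zero w hw
  have hd := (h.smooth.mc hΩ 1).diffMatAt hΩ hz 1 2
  have h1 := (conjCLE.hasFDerivAt.comp z hd.hasFDerivAt).neg.fderiv
  change fderiv ℝ (fun w => mc M w I 0 2) z Y = _
  rw [e.fderiv_eq]
  exact DFunLike.congr_fun h1 Y

theorem IsAdapted.dMat_mc_one (hΩ : IsOpen Ω) (h : IsAdapted Ω M) {z : ℂ} (hz : z ∈ Ω) (Y : ℂ) :
    dMat (fun w => mc M w I) z Y 1 2 = (starRingEnd ℂ) (dMat (fun w => mc M w 1) z Y 0 2) := by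
  have e : (fun w => mc M w I 1 2) =ᶠ[𝓝 z] fun w => (starRingEnd ℂ) (mc M w 1 0 2) := by
    filter_upwards [hΩ.mem_nhds hz] with w hw using h.rot_one w hw
  have hd := (h.smooth.mc hΩ 1).diffMatAt hΩ hz 0 2
  have h1 := (conjCLE.hasFDerivAt.comp z hd.hasFDerivAt).fderiv
  change fderiv ℝ (fun w => mc M w I 1 2) z Y = _
  rw [e.fderiv_eq]
  exact DFunLike.congr_fun h1 Y

/-- The vector `(∂A_x/∂x + A_x² + ∂A_y/∂y + A_y²) e₃` is
`tr(A_x) A_x e₃ + tr(A_y) A_y e₃` modulo `e₃`. -/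
theorem IsAdapted.tension (hΩ : IsOpen Ω) (h : IsAdapted Ω M) {z : ℂ} (hz : z ∈ Ω) {k : Fin 3}
    (hk : k ≠ 2) :
    dMat (fun w => mc M w 1) z 1 k 2 + (mc M z 1 * mc M z 1) k 2
      + (dMat (fun w => mc M w I) z I k 2 + (mc M z I * mc M z I) k 2)
      = (mc M z 1).trace * mc M z 1 k 2 + (mc M z I).trace * mc M z I k 2 := by
  have hflat := mc_flat hΩ h.smooth h.unitary hz
  have hc := conj_mc_apply hΩ h.smooth h.unitary hz
  have r0 := h.rot_zero z hz
  have r1 := h.rot_one z hz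
  have hd0 := h.dMat_mc_zero hΩ hz
  have hd1 := h.dMat_mc_one hΩ hz
  have hc0 := hc I 0 2
  have hc1 := hc I 1 2
  rw [r0, map_neg, conj_conj] at hc0
  rw [r1, conj_conj] at hc1
  rw [hc] at r0 r1
  -- Conjugation exchanges the two components through J: the conjugate of the second row of the
  -- flatness equation gives the tension equation for k = 0, and that of the first row gives it for
  -- k = 1.
  have f0 := congrArg (starRingEnd ℂ) (congrFun (congrFun hflat 0) 2)
  have f1 := congrArg (starRingEnd ℂ) (congrFun (congrFun hflat 1) 2)
  simp only [Matrix.add_apply, Matrix.mul_apply, Fin.sum_univ_three, map_add, map_mul, map_neg, hc,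
    hd0, hd1, conj_conj, h.horizontal z hz, map_zero] at f0 f1
  have e : ∀ A : Mat3, A.trace = A 0 0 + A 1 1 + A 2 2 := fun A => by
    simp [Matrix.trace, Fin.sum_univ_three]
  have e' : ∀ (A : Mat3) i, (A * A) i 2 = A i 0 * A 0 2 + A i 1 * A 1 2 + A i 2 * A 2 2 :=
    fun A i => by simp [Matrix.mul_apply, Fin.sum_univ_three]
  have hh1 := h.horizontal z hz 1
  have hh2 := h.horizontal z hz I
  rw [e, e, e', e', hh1, hh2]
  generalize mc M z 1 = A at *
  generalize mc M z I = B at *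
  fin_cases k
  · simp only [Fin.zero_eta, hd0]
    linear_combination (-1) * f1 - A 1 1 * hc1 - A 0 1 * hc0 - B 1 1 * r0 + B 0 1 * r1
  · simp only [Fin.mk_one, hd1]
    linear_combination f0 + A 1 0 * hc1 + A 0 0 * hc0 + B 1 0 * r0 - B 0 0 * r1
  · exact absurd rfl hk

theorem conj_dMat_mc (hΩ : IsOpen Ω) (hM : SmoothMatOn M Ω) (hU : UnitaryOn M Ω) {z : ℂ}
    (hz : z ∈ Ω) (X Y : ℂ) (i j : Fin 3) :
    (starRingEnd ℂ) (dMat (fun w => mc M w X) z Y i j) = -dMat (fun w => mc M w X) z Y j i := by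
  have hd := (hM.mc hΩ X).diffMatAt hΩ hz
  have h1 : dMat (fun w => star (mc M w X)) z Y = dMat (fun w => (-1) * mc M w X) z Y :=
    dMat_congr_on hΩ (fun w hw => by rw [star_mc hΩ hM hU hw, neg_one_mul]) hz Y
  rw [dMat_star hd, dMat_const_mul _ hd, neg_one_mul] at h1
  simpa using! congrFun (congrFun h1 j) i

/-- The derivative of MNM† is M([A, N] + dN)M†, applied to N = [A, L] with L the projector onto the
last coordinate. -/
theorem dMat_dMat_projector {P : ℂ → Mat3} (hΩ : IsOpen Ω) (hM : SmoothMatOn M Ω)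
    (hU : UnitaryOn M Ω) (hP : ∀ z ∈ Ω, P z = M z * lastProj * star (M z)) {z : ℂ} (hz : z ∈ Ω)
    (X : ℂ) : dMat (fun w => dMat P w X) z X = M z * (
      mc M z X * (mc M z X * lastProj - lastProj * mc M z X)
      - (mc M z X * lastProj - lastProj * mc M z X) * mc M z X
      + (dMat (fun w => mc M w X) z X * lastProj - lastProj * dMat (fun w => mc M w X) z X))
      * star (M z) := by
  have hd := hM.diffMatAt hΩ hz
  have hm := (hM.mc hΩ X).diffMatAt hΩ hz
  have hl := DiffMatAt.const lastProj z
  have e : ∀ w ∈ Ω, dMat P w X = M w * ((mc M w X * lastProj) + ((-lastProj) * mc M w X))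
      * star (M w) := fun w hw => by
    rw [dMat_projector hΩ hM hU hP hw]
    noncomm_ring
  have hadd : DiffMatAt (fun w => (mc M w X * lastProj) + ((-lastProj) * mc M w X)) z := fun i j =>
    (hm.mul hl i j).add ((DiffMatAt.const (-lastProj) z).mul hm i j)
  have dadd : dMat (fun w => (mc M w X * lastProj) + ((-lastProj) * mc M w X)) z X
      = dMat (fun w => mc M w X * lastProj) z X + dMat (fun w => (-lastProj) * mc M w X) z X := by
    ext i j
    exact DFunLike.congr_fun (fderiv_fun_add (hm.mul hl i j)
      ((DiffMatAt.const (-lastProj) z).mul hm i j)) X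
  rw [dMat_congr_on hΩ e hz, dMat_mul (hd.mul hadd) hd.star, dMat_mul hd hadd, dadd,
    dMat_mul hm hl, dMat_const, dMat_const_mul _ hm, dMat_star hd, dMat_eq_mul_mc hU hz, star_mul,
    star_mc hΩ hM hU hz]
  noncomm_ring

/-- Pairing of a tangent vector with the Laplacian of the field of projectors. -/
theorem IsAdapted.re_trace_laplacian {P : ℂ → Mat3} (hΩ : IsOpen Ω) (h : IsAdapted Ω M)
    (hP : ∀ z ∈ Ω, P z = M z * lastProj * star (M z)) {z : ℂ} (hz : z ∈ Ω) {ξ : Mat3}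
    (hξ : star ξ = ξ) (ht : ξ = ξ * P z + P z * ξ) :
    (1 / 2) * ((ξ * dMat (fun w => dMat P w 1) z 1).trace.re
        + (ξ * dMat (fun w => dMat P w I) z I).trace.re)
      = -((mc M z 1).trace.im * (P z * ξ * dMat P z 1).trace.im
        + (mc M z I).trace.im * (P z * ξ * dMat P z I).trace.im) := by
  have hU := h.unitary z hz
  have hU' := h.unitary.mul_star hz
  -- The matrix n is ξ expressed in the frame. Tangency makes all its entries vanish except those of
  -- the last row and column off the diagonal.
  obtain ⟨n, hn⟩ : ∃ n, n = star (M z) * ξ * M z := ⟨_, rfl⟩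
  have hξn : ξ = M z * n * star (M z) := by
    calc ξ = (M z * star (M z)) * ξ * (M z * star (M z)) := by rw [hU', one_mul, mul_one]
      _ = _ := by rw [hn]; noncomm_ring
  have hns : star n = n := by
    rw [hn, star_mul, star_mul, star_star, hξ, mul_assoc]
  have hnt : n = n * lastProj + lastProj * n := by
    calc n = star (M z) * (ξ * P z + P z * ξ) * M z := by rw [← ht, hn]
      _ = (star (M z) * ξ * M z) * lastProj * (star (M z) * M z)
          + (star (M z) * M z) * lastProj * (star (M z) * ξ * M z) := by
          rw [hP z hz]; noncomm_ring
      _ = _ := by rw [hU, ← hn, mul_one, one_mul]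
  have trL : ∀ L : Mat3, (ξ * (M z * L * star (M z))).trace = (n * L).trace := by
    intro L
    calc _ = (M z * (n * (star (M z) * M z) * L * star (M z))).trace := by
          rw [hξn]; congr 1; noncomm_ring
      _ = _ := by rw [hU, Matrix.trace_mul_comm, mul_one, mul_assoc, hU, mul_one]
  have trN : ∀ L : Mat3, (P z * ξ * (M z * L * star (M z))).trace = (lastProj * n * L).trace := by
    intro L
    calc _ = (M z * (lastProj * (star (M z) * M z) * n * (star (M z) * M z) * L
          * star (M z))).trace := by
          rw [hξn, hP z hz]; congr 1; noncomm_ring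
      _ = _ := by rw [hU, Matrix.trace_mul_comm, mul_one, mul_one, mul_assoc, hU, mul_one]
  rw [dMat_dMat_projector hΩ h.smooth h.unitary hP hz,
    dMat_dMat_projector hΩ h.smooth h.unitary hP hz,
    dMat_projector hΩ h.smooth h.unitary hP hz, dMat_projector hΩ h.smooth h.unitary hP hz,
    trL, trL, trN, trN]
  have z00 : n 0 0 = 0 := by
    have := congrFun (congrFun hnt 0) 0
    simpa [lastProj, Matrix.mul_apply, Fin.sum_univ_three, Matrix.single_apply] using this
  have z01 : n 0 1 = 0 := by
    have := congrFun (congrFun hnt 0) 1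
    simpa [lastProj, Matrix.mul_apply, Fin.sum_univ_three, Matrix.single_apply] using this
  have z10 : n 1 0 = 0 := by
    have := congrFun (congrFun hnt 1) 0
    simpa [lastProj, Matrix.mul_apply, Fin.sum_univ_three, Matrix.single_apply] using this
  have z11 : n 1 1 = 0 := by
    have := congrFun (congrFun hnt 1) 1
    simpa [lastProj, Matrix.mul_apply, Fin.sum_univ_three, Matrix.single_apply] using this
  have z22 : n 2 2 = 0 := by
    have := congrFun (congrFun hnt 2) 2
    simpa [lastProj, Matrix.mul_apply, Fin.sum_univ_three, Matrix.single_apply] using this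
  have s0 : n 0 2 = (starRingEnd ℂ) (n 2 0) := by
    conv_lhs => rw [← hns]
    rfl
  have s1 : n 1 2 = (starRingEnd ℂ) (n 2 1) := by
    conv_lhs => rw [← hns]
    rfl
  -- Paired with such an n, the second derivative of P only contributes through the last column of
  -- ∂A + A² and through its conjugate, hence twice a real part.
  have key : ∀ A D : Mat3, A 2 2 = 0 → (∀ i j, (starRingEnd ℂ) (A i j) = -A j i) →
      (∀ i j, (starRingEnd ℂ) (D i j) = -D j i) →
      (n * (A * (A * lastProj - lastProj * A) - (A * lastProj - lastProj * A) * A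
        + (D * lastProj - lastProj * D))).trace.re
      = 2 * (n 2 0 * (D 0 2 + (A * A) 0 2) + n 2 1 * (D 1 2 + (A * A) 1 2)).re := by
    intro A D hA hAs hDs
    have e : (n * (A * (A * lastProj - lastProj * A) - (A * lastProj - lastProj * A) * A
        + (D * lastProj - lastProj * D))).trace
        = (n 2 0 * (D 0 2 + (A * A) 0 2) + n 2 1 * (D 1 2 + (A * A) 1 2))
          + (starRingEnd ℂ) (n 2 0 * (D 0 2 + (A * A) 0 2) + n 2 1 * (D 1 2 + (A * A) 1 2)) := by
      rw [commutator_lastProj, commutator_lastProj]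
      simp only [Matrix.trace, Matrix.diag, Matrix.mul_apply, Fin.sum_univ_three,
        Matrix.add_apply, Matrix.sub_apply, z00, z01, z10, z11, z22, s0, s1, hA, map_add, map_mul,
        hAs, hDs]
      simp
      ring
    rw [e, add_re, conj_re]
    ring
  have hc := conj_mc_apply hΩ h.smooth h.unitary hz
  have hcd := conj_dMat_mc hΩ h.smooth h.unitary hz
  rw [key _ _ (h.horizontal z hz 1) (hc 1) (hcd 1 1), key _ _ (h.horizontal z hz I) (hc I) (hcd I I)]
  have t0 := h.tension hΩ hz (k := 0) (by decide)
  have t1 := h.tension hΩ hz (k := 1) (by decide)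
  have hs : ∀ A : Mat3, (lastProj * n * (A * lastProj - lastProj * A)).trace
      = n 2 0 * A 0 2 + n 2 1 * A 1 2 := by
    intro A
    rw [commutator_lastProj]
    simp [Matrix.trace, Matrix.diag, Matrix.mul_apply, Fin.sum_univ_three, lastProj,
      Matrix.single_apply]
  rw [hs, hs]
  have htr : ∀ X, (mc M z X).trace = (mc M z X).trace.im * I := by
    intro X
    apply Complex.ext
    · have h1 : (starRingEnd ℂ) (mc M z X).trace = -(mc M z X).trace := by
        simp only [Matrix.trace, Matrix.diag, Fin.sum_univ_three, map_add, hc]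
        ring
      have h2 := congrArg re h1
      rw [conj_re, neg_re] at h2
      have : (mc M z X).trace.re = 0 := by linarith
      simp [this]
    · simp
  have hsum : (n 2 0 * (dMat (fun w => mc M w 1) z 1 0 2 + (mc M z 1 * mc M z 1) 0 2)
      + n 2 1 * (dMat (fun w => mc M w 1) z 1 1 2 + (mc M z 1 * mc M z 1) 1 2))
      + (n 2 0 * (dMat (fun w => mc M w I) z I 0 2 + (mc M z I * mc M z I) 0 2)
      + n 2 1 * (dMat (fun w => mc M w I) z I 1 2 + (mc M z I * mc M z I) 1 2))
      = ((mc M z 1).trace.im * I) * (n 2 0 * mc M z 1 0 2 + n 2 1 * mc M z 1 1 2)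
        + ((mc M z I).trace.im * I) * (n 2 0 * mc M z I 0 2 + n 2 1 * mc M z I 1 2) := by
    rw [← htr, ← htr]
    linear_combination n 2 0 * t0 + n 2 1 * t1
  have hre := (add_re _ _).symm.trans ((congrArg re hsum).trans (add_re _ _))
  have hI : ∀ (r : ℝ) (s : ℂ), ((r * I) * s).re = -(r * s.im) := fun r s => by
    simp [mul_re]
  rw [hI, hI] at hre
  linarith

end Tension

end HSLagrangian
end

open scoped ContDiff

noncomputable section

namespace HSLagrangian

open Set Filter Topology Complex MeasureTheory

/-! ### Hamiltonian stationary means harmonic Lagrangian angle -/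

/-- The differential of the Lagrangian angle of a frame. -/
def angleForm (M : ℂ → Mat3) (X z : ℂ) : ℝ := (mc M z X).trace.im

/-- The Lagrangian angle is harmonic. -/
def HarmonicAngle (Ω : Set ℂ) (M : ℂ → Mat3) : Prop :=
  ∀ z ∈ Ω, fderiv ℝ (angleForm M 1) z 1 + fderiv ℝ (angleForm M I) z I = 0

section

variable {Ω : Set ℂ}

theorem contDiffOn_trace {M : ℂ → Mat3} (hM : SmoothMatOn M Ω) :
    ContDiffOn ℝ ∞ (fun z => (M z).trace) Ω := by
  simp only [Matrix.trace, Matrix.diag]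
  exact ContDiffOn.sum fun i _ => hM i i

theorem contDiffOn_angleForm {M : ℂ → Mat3} (hΩ : IsOpen Ω) (hM : SmoothMatOn M Ω) (X : ℂ) :
    ContDiffOn ℝ ∞ (angleForm M X) Ω :=
  imCLM.contDiff.comp_contDiffOn (contDiffOn_trace (hM.mc hΩ X))

theorem continuousOn_fderiv_apply_of_contDiffOn {V : ℂ → ℝ} (hΩ : IsOpen Ω) (h : ContDiffOn ℝ ∞ V Ω)
    (X : ℂ) : ContinuousOn (fun z => fderiv ℝ V z X) Ω :=
  (h.continuousOn_fderiv_of_isOpen hΩ (by simp)).clm_apply continuousOn_const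

theorem fderiv_re_trace {M : ℂ → Mat3} {z : ℂ} (hM : DiffMatAt M z) (X : ℂ) :
    fderiv ℝ (fun w => (M w).trace.re) z X = (dMat M z X).trace.re := by
  have hd : DifferentiableAt ℝ (fun w => (M w).trace) z := by
    simp only [Matrix.trace, Matrix.diag]
    exact DifferentiableAt.fun_sum fun i _ => hM i i
  have h1 := (reCLM.hasFDerivAt.comp z hd.hasFDerivAt).fderiv
  rw [← fderiv_trace hM]
  exact DFunLike.congr_fun h1 X

variable {u : Ω → CP2} {F : Ω → U3} {U : ℝ → Ω → CP2} {K : Set ℂ}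

/-- The derivative of the area along a Hamiltonian variation. -/
theorem IsVariation.hasDerivAt_area_of_hamiltonian (hΩ : IsOpen Ω) (hF : IsAdapted Ω (matField F))
    (hu : ∀ z, u z = lastColLine (F z)) (h : IsVariation u U K) {f : ℂ → ℝ} (hf : ContDiff ℝ ∞ f)
    (hω : ∀ z ∈ Ω, ∀ X : ℂ,
      (Matrix.trace (projField u z * variationField U z * dMat (projField u) z X)).im
        + fderiv ℝ f z X = 0) :
    HasDerivAt (fun t => area K (U t)) (-∫ z in K, (angleForm (matField F) 1 z * fderiv ℝ f z 1
      + angleForm (matField F) I z * fderiv ℝ f z I)) 0 := by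
  refine (h.hasDerivAt_area hΩ (hF.isConformal hΩ hu)).congr_deriv ?_
  have hP := projField_eq hu
  have hPs : SmoothMatOn (projField u) Ω := hF.isSmooth hu
  have hξs := h.smooth_variationField hΩ
  -- The integrand of the first variation is the divergence of this field minus ½ Re tr(ξ ΔP). The
  -- divergence integrates to zero because ξ vanishes off K. The Laplacian term is given by
  -- `IsAdapted.re_trace_laplacian`, in which ω(ξ, du) is replaced by -df.
  let V : ℂ → ℂ → ℝ := fun X z => (1 / 2) * (variationField U z * dMat (projField u) z X).trace.re
  have hV : ∀ X, ContDiffOn ℝ ∞ (V X) Ω := fun X => contDiffOn_const.mul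
    (reCLM.contDiff.comp_contDiffOn (contDiffOn_trace (hξs.mul (hPs.dMat hΩ X))))
  have hV0 : ∀ X, ∀ z ∉ K, V X z = 0 := fun X z hz => by
    simp [V, h.variationField_eq_zero hz]
  have hdV : ∀ X, ∀ z ∈ Ω, fderiv ℝ (V X) z X
      = (1 / 2) * ((dMat (variationField U) z X * dMat (projField u) z X).trace.re
        + (variationField U z * dMat (fun w => dMat (projField u) w X) z X).trace.re) := by
    intro X z hz
    have d1 := hξs.diffMatAt hΩ hz
    have d2 := (hPs.dMat hΩ X).diffMatAt hΩ hz
    have d3 : DifferentiableAt ℝ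
        (fun w => (variationField U w * dMat (projField u) w X).trace.re) z :=
      ((reCLM.contDiff.comp_contDiffOn (contDiffOn_trace
        (hξs.mul (hPs.dMat hΩ X)))).differentiableOn (by simp)).differentiableAt (hΩ.mem_nhds hz)
    have e1 := fderiv_re_trace (d1.mul d2) X
    rw [dMat_mul d1 d2, Matrix.trace_add, add_re] at e1
    rw [← e1]
    exact DFunLike.congr_fun (fderiv_const_mul d3 (1 / 2 : ℝ)) X
  have hpt : ∀ z ∈ K, (1 / 2) *
      (((dMat (variationField U) z 1 * dMat (projField u) z 1).trace).re
        + ((dMat (variationField U) z I * dMat (projField u) z I).trace).re)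
      = (fderiv ℝ (V 1) z 1 + fderiv ℝ (V I) z I)
        - (angleForm (matField F) 1 z * fderiv ℝ f z 1
          + angleForm (matField F) I z * fderiv ℝ f z I) := by
    intro z hz
    have hzΩ := h.subset hz
    have h1 := hF.re_trace_laplacian hΩ hP hzΩ (h.star_variationField hΩ hzΩ) (h.tangent hΩ hzΩ)
    have h2 := hω z hzΩ 1
    have h3 := hω z hzΩ I
    rw [hdV 1 z hzΩ, hdV I z hzΩ, ← neg_eq_of_add_eq_zero_right h2,
      ← neg_eq_of_add_eq_zero_right h3]
    simp only [angleForm]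
    linarith
  rw [setIntegral_congr_fun h.compact.measurableSet hpt]
  have i1 : ∀ X, IntegrableOn (fun z => fderiv ℝ (V X) z X) K := fun X =>
    ((continuousOn_fderiv_apply_of_contDiffOn hΩ (hV X) X).mono h.subset).integrableOn_compact
      h.compact
  have i2 : ∀ X, IntegrableOn (fun z => angleForm (matField F) X z * fderiv ℝ f z X) K := fun X =>
    (((contDiffOn_angleForm hΩ hF.smooth X).continuousOn.mono h.subset).mul
      ((hf.continuous_fderiv (by simp)).clm_apply continuous_const).continuousOn).integrableOn_compact
      h.compact
  rw [integral_sub, integral_add (i1 1) (i1 I),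
    setIntegral_fderiv_eq_zero hΩ (hV 1) h.compact h.subset (hV0 1),
    setIntegral_fderiv_eq_zero hΩ (hV I) h.compact h.subset (hV0 I)]
  · simp
  · exact (i1 1).add (i1 I)
  · exact (i2 1).add (i2 I)

/-- Integration by parts against the differential of the angle. -/
theorem setIntegral_angleForm_mul {M : ℂ → Mat3} (hΩ : IsOpen Ω) (hM : SmoothMatOn M Ω)
    (hK : IsCompact K) (hKΩ : K ⊆ Ω) {f : ℂ → ℝ} (hf : ContDiff ℝ ∞ f) (h0 : ∀ z ∉ K, f z = 0) :
    ∫ z in K, (angleForm M 1 z * fderiv ℝ f z 1 + angleForm M I z * fderiv ℝ f z I)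
      = -∫ z in K, f z * (fderiv ℝ (angleForm M 1) z 1 + fderiv ℝ (angleForm M I) z I) := by
  have hb := contDiffOn_angleForm hΩ hM
  have hV : ∀ X, ContDiffOn ℝ ∞ (fun z => f z * angleForm M X z) Ω := fun X =>
    hf.contDiffOn.mul (hb X)
  have hdV : ∀ X, ∀ z ∈ Ω, fderiv ℝ (fun z => f z * angleForm M X z) z X
      = f z * fderiv ℝ (angleForm M X) z X + angleForm M X z * fderiv ℝ f z X := by
    intro X z hz
    rw [fderiv_fun_mul (hf.differentiable (by simp) z)
      (((hb X).differentiableOn (by simp)).differentiableAt (hΩ.mem_nhds hz))]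
    rfl
  have hz : ∀ X, ∫ z in K, fderiv ℝ (fun z => f z * angleForm M X z) z X = 0 := fun X =>
    setIntegral_fderiv_eq_zero hΩ (hV X) hK hKΩ (fun z hz => by simp [h0 z hz]) X
  have i1 : ∀ X, IntegrableOn (fun z => fderiv ℝ (fun z => f z * angleForm M X z) z X) K := fun X =>
    ((continuousOn_fderiv_apply_of_contDiffOn hΩ (hV X) X).mono hKΩ).integrableOn_compact hK
  have i2 : ∀ X, IntegrableOn (fun z => f z * fderiv ℝ (angleForm M X) z X) K := fun X =>
    (hf.continuous.continuousOn.mul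
      ((continuousOn_fderiv_apply_of_contDiffOn hΩ (hb X) X).mono hKΩ)).integrableOn_compact hK
  have hpt : ∀ z ∈ K, angleForm M 1 z * fderiv ℝ f z 1 + angleForm M I z * fderiv ℝ f z I
      = (fderiv ℝ (fun z => f z * angleForm M 1 z) z 1
        + fderiv ℝ (fun z => f z * angleForm M I z) z I)
        - f z * (fderiv ℝ (angleForm M 1) z 1 + fderiv ℝ (angleForm M I) z I) := by
    intro z hzK
    rw [hdV 1 z (hKΩ hzK), hdV I z (hKΩ hzK)]
    ring
  rw [setIntegral_congr_fun hK.measurableSet hpt, integral_sub, integral_add (i1 1) (i1 I), hz, hz]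
  · simp
  · exact (i1 1).add (i1 I)
  · simp only [mul_add]
    exact (i2 1).add (i2 I)

theorem HarmonicAngle.isHamiltonianStationary (hΩ : IsOpen Ω) (hF : IsAdapted Ω (matField F))
    (hu : ∀ z, u z = lastColLine (F z)) (hh : HarmonicAngle Ω (matField F)) :
    IsHamiltonianStationary u := by
  rintro U K hU ⟨f, hf, hfc, hfΩ, hω⟩
  refine (hU.hasDerivAt_area_of_hamiltonian hΩ hF hu hf hω).congr_deriv ?_
  -- The potential need not be supported in K: off K the variation field vanishes, hence so does df,
  -- but f may be a nonzero constant there. Integration by parts is carried out on K ∪ supp f, and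
  -- the integrand involving df vanishes on the added part.
  have hKf : K ⊆ K ∪ tsupport f := subset_union_left
  have hc : IsCompact (K ∪ tsupport f) := hU.compact.union hfc
  have hΩ' : K ∪ tsupport f ⊆ Ω := union_subset hU.subset hfΩ
  have h0 : ∀ z ∈ (K ∪ tsupport f) \ K, angleForm (matField F) 1 z * fderiv ℝ f z 1
      + angleForm (matField F) I z * fderiv ℝ f z I = 0 := by
    rintro z ⟨hz, hzK⟩
    have h1 := hω z (hΩ' hz)
    simp only [hU.variationField_eq_zero hzK, mul_zero, zero_mul, Matrix.trace_zero, zero_im,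
      zero_add] at h1
    rw [h1, h1]
    ring
  rw [← setIntegral_eq_of_subset_of_forall_sdiff_eq_zero hc.measurableSet hKf h0,
    setIntegral_angleForm_mul hΩ hF.smooth hc hΩ' hf
      (fun z hz => image_eq_zero_of_notMem_tsupport fun h => hz (Or.inr h)), neg_neg]
  rw [setIntegral_congr_fun (g := fun _ => (0 : ℝ)) hc.measurableSet
    fun z hz => by simp only [hh z (hΩ' hz), mul_zero]]
  simp

end

end HSLagrangian
end

open scoped ContDiff

noncomputable section

namespace HSLagrangian

open Set Filter Topology Complex MeasureTheory

/-! ### Hamiltonian variations with a given potential -/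

section TestVariation

variable {Ω : Set ℂ} {u : Ω → CP2} {F : Ω → U3}

theorem mulVec_ne_zero (g : U3) {y : Fin 3 → ℂ} (hy : y 2 = 1) : (g : Mat3).mulVec y ≠ 0 := by
  intro h
  have h1 := congrArg (star (g : Mat3)).mulVec h
  rw [Matrix.mulVec_mulVec, Matrix.UnitaryGroup.star_mul_self, Matrix.one_mulVec,
    Matrix.mulVec_zero] at h1
  rw [h1] at hy
  exact zero_ne_one hy

/-- The vector `t η + e₃`. -/
def shifted (η : Fin 3 → ℂ) (t : ℝ) : Fin 3 → ℂ := (t : ℂ) • η + Pi.single 2 1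

theorem shifted_two {η : Fin 3 → ℂ} (hη : η 2 = 0) (t : ℝ) : shifted η t 2 = 1 := by
  simp [shifted, hη]

/-- The variation `t ↦ [F (t η + e₃)]` of `[F e₃]`. -/
def frameVariation (F : Ω → U3) (η : ℂ → Fin 3 → ℂ) (hη : ∀ z, η z 2 = 0) (t : ℝ) (z : Ω) : CP2 :=
  Projectivization.mk ℂ ((F z : Mat3).mulVec (shifted (η z) t))
    (mulVec_ne_zero (F z) (shifted_two (hη z) t))

theorem mulVec_dotProduct_star (g : U3) (y : Fin 3 → ℂ) :
    (g : Mat3).mulVec y ⬝ᵥ star ((g : Mat3).mulVec y) = y ⬝ᵥ star y := by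
  rw [dotProduct_comm, Matrix.star_mulVec, ← Matrix.dotProduct_mulVec, Matrix.mulVec_mulVec]
  have : (g : Mat3).conjTranspose * (g : Mat3) = 1 := Matrix.UnitaryGroup.star_mul_self g
  rw [this, Matrix.one_mulVec, dotProduct_comm]

theorem projField_frameVariation {η : ℂ → Fin 3 → ℂ} (hη : ∀ z, η z 2 = 0) (t : ℝ) {z : ℂ}
    (hz : z ∈ Ω) (i j : Fin 3) : projField (frameVariation F η hη t) z i j
      = (shifted (η z) t ⬝ᵥ star (shifted (η z) t))⁻¹
        * ((matField F z).mulVec (shifted (η z) t) i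
          * (starRingEnd ℂ) ((matField F z).mulVec (shifted (η z) t) j)) := by
  rw [projField, zeroExt_apply _ hz, frameVariation, proj_mk, mulVec_dotProduct_star,
    matField_apply F hz]
  simp [Matrix.vecMulVec_apply]

theorem shifted_dotProduct {η : Fin 3 → ℂ} (hη : η 2 = 0) (t : ℝ) :
    shifted η t ⬝ᵥ star (shifted η t)
      = ((1 + t ^ 2 * (normSq (η 0) + normSq (η 1)) : ℝ) : ℂ) := by
  simp only [dotProduct, Fin.sum_univ_three, shifted, Pi.star_apply, Pi.add_apply, Pi.smul_apply,
    hη, ofReal_add, ofReal_mul, normSq_eq_conj_mul_self]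
  simp
  ring

theorem isVariation_frameVariation (hF : SmoothMatOn (matField F) Ω)
    (hu : ∀ z, u z = lastColLine (F z)) {η : ℂ → Fin 3 → ℂ} (hη : ∀ z, η z 2 = 0)
    (hηs : ∀ k, ContDiffOn ℝ ∞ (fun z => η z k) Ω) {K : Set ℂ} (hK : IsCompact K) (hKΩ : K ⊆ Ω)
    (h0 : ∀ z ∉ K, η z = 0) : IsVariation u (frameVariation F η hη) K := by
  have hlast : ∀ z : Ω, (F z : Mat3).mulVec (Pi.single 2 1) = fun i => (F z : Mat3) i 2 := by
    intro z
    funext i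
    simp [Matrix.mulVec_single]
  have hzero : ∀ (t : ℝ) (z : Ω), (t : ℂ) • η z = 0 → frameVariation F η hη t z = u z := by
    intro t z h
    have e : (F z : Mat3).mulVec (shifted (η z) t) = fun i => (F z : Mat3) i 2 := by
      rw [shifted, h, zero_add, hlast]
    rw [hu, frameVariation, lastColLine]
    congr 1
  refine ⟨fun i j => ?_, ?_, hK, hKΩ, fun t z hz => ?_⟩
  · have hfst : ContDiffOn ℝ ∞ (fun p : ℝ × ℂ => ((p.1 : ℝ) : ℂ)) (univ ×ˢ Ω) :=
      (ofRealCLM.contDiff.comp contDiff_fst).contDiffOn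
    have hcomp : ∀ {g : ℂ → ℂ}, ContDiffOn ℝ ∞ g Ω →
        ContDiffOn ℝ ∞ (fun p : ℝ × ℂ => g p.2) (univ ×ˢ Ω) := fun hg =>
      hg.comp contDiffOn_snd fun p hp => hp.2
    have hsh : ∀ k, ContDiffOn ℝ ∞ (fun p : ℝ × ℂ => shifted (η p.2) p.1 k) (univ ×ˢ Ω) :=
      fun k => (hfst.mul (hcomp (hηs k))).add contDiffOn_const
    have hv : ∀ k, ContDiffOn ℝ ∞
        (fun p : ℝ × ℂ => (matField F p.2).mulVec (shifted (η p.2) p.1) k) (univ ×ˢ Ω) :=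
      fun k => by
        simp only [Matrix.mulVec, dotProduct]
        exact ContDiffOn.sum fun l _ => (hcomp (hF k l)).mul (hsh l)
    have hn : ContDiffOn ℝ ∞
        (fun p : ℝ × ℂ => (shifted (η p.2) p.1 ⬝ᵥ star (shifted (η p.2) p.1))) (univ ×ˢ Ω) :=
      ContDiffOn.sum fun l _ => (hsh l).mul (conjCLE.contDiff.comp_contDiffOn (hsh l))
    have hne : ∀ p ∈ (univ : Set ℝ) ×ˢ Ω,
        (shifted (η p.2) p.1 ⬝ᵥ star (shifted (η p.2) p.1)) ≠ 0 := by
      intro p _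
      rw [shifted_dotProduct (hη _)]
      have h1 := normSq_nonneg (η p.2 0)
      have h2 := normSq_nonneg (η p.2 1)
      exact_mod_cast (by positivity : (0 : ℝ) < 1 + p.1 ^ 2 * (normSq (η p.2 0)
        + normSq (η p.2 1))).ne'
    refine ((hn.inv hne).mul ((hv i).mul (conjCLE.contDiff.comp_contDiffOn (hv j)))).congr ?_
    intro p hp
    exact projField_frameVariation hη p.1 hp.2 i j
  · funext z
    exact hzero 0 z (by simp)
  · exact hzero t z (by rw [h0 _ hz, smul_zero])

theorem variationField_frameVariation {η : ℂ → Fin 3 → ℂ} (hη : ∀ z, η z 2 = 0) {z : ℂ}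
    (hz : z ∈ Ω) : variationField (frameVariation F η hη) z = matField F z
      * !![0, 0, η z 0; 0, 0, η z 1; (starRingEnd ℂ) (η z 0), (starRingEnd ℂ) (η z 1), 0]
      * star (matField F z) := by
  ext i j
  have hsh : ∀ k, HasDerivAt (fun t : ℝ => shifted (η z) t k) (η z k) 0 := by
    intro k
    have := ((hasDerivAt_id (0 : ℝ)).ofReal_comp.mul_const (η z k)).add_const
      ((Pi.single 2 1 : Fin 3 → ℂ) k)
    rw [ofReal_one, one_mul] at this
    exact this
  have hv : ∀ k, HasDerivAt (fun t : ℝ => (matField F z).mulVec (shifted (η z) t) k)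
      ((matField F z).mulVec (η z) k) 0 := fun k => by
    simp only [Matrix.mulVec, dotProduct]
    exact HasDerivAt.fun_sum fun l _ => (hsh l).const_mul _
  have hv' : ∀ k, HasDerivAt (fun t : ℝ => (starRingEnd ℂ) ((matField F z).mulVec
      (shifted (η z) t) k)) ((starRingEnd ℂ) ((matField F z).mulVec (η z) k)) 0 := fun k =>
    (hv k).star
  -- The squared length 1 + t²|η|² is stationary at t = 0, so the normalisation does not contribute
  -- to the variation field.
  have hn : HasDerivAt (fun t : ℝ => (shifted (η z) t ⬝ᵥ star (shifted (η z) t))⁻¹) 0 0 := by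
    have h1 : HasDerivAt (fun t : ℝ => 1 + t ^ 2 * (normSq (η z 0) + normSq (η z 1))) 0 0 := by
      simpa using! (((hasDerivAt_id (0 : ℝ)).pow 2).mul_const
        (normSq (η z 0) + normSq (η z 1))).const_add 1
    have h2 := h1.ofReal_comp.fun_inv (by simp)
    simp only [shifted_dotProduct (hη z)]
    simpa using h2
  have hall := hn.mul ((hv i).mul (hv' j))
  have e0 : shifted (η z) 0 = Pi.single 2 1 := by simp [shifted]
  have hd := hall.congr_of_eventuallyEq (f₁ := fun t => projField (frameVariation F η hη t) z i j)
    (Eventually.of_forall fun t => projField_frameVariation hη t hz i j)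
  refine hd.deriv.trans ?_
  rw [shifted_dotProduct (hη z), e0]
  simp only [Matrix.mul_apply, Fin.sum_univ_three, Matrix.mulVec, dotProduct,
    Matrix.star_apply, hη, Pi.mul_apply]
  simp
  ring

theorem trace_projector_tangent {M P : ℂ → Mat3} (hΩ : IsOpen Ω) (hM : SmoothMatOn M Ω)
    (hU : UnitaryOn M Ω) (hP : ∀ z ∈ Ω, P z = M z * lastProj * star (M z)) {z : ℂ} (hz : z ∈ Ω)
    (n : Mat3) (X : ℂ) : (P z * (M z * n * star (M z)) * dMat P z X).trace
      = n 2 0 * mc M z X 0 2 + n 2 1 * mc M z X 1 2 := by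
  have hUz := hU z hz
  rw [dMat_projector hΩ hM hU hP hz, hP z hz]
  generalize hN : mc M z X * lastProj - lastProj * mc M z X = N
  have e : (M z * lastProj * star (M z) * (M z * n * star (M z)) * (M z * N * star (M z))).trace
      = (lastProj * n * N).trace := by
    calc _ = (M z * (lastProj * (star (M z) * M z) * n * (star (M z) * M z) * N
          * star (M z))).trace := by congr 1; noncomm_ring
      _ = _ := by rw [hUz, Matrix.trace_mul_comm, mul_one, mul_one, mul_assoc, hUz, mul_one]
  rw [e, ← hN, commutator_lastProj]
  simp [Matrix.trace, Matrix.diag, Matrix.mul_apply, Fin.sum_univ_three, lastProj,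
    Matrix.single_apply]

/-- The coordinates in the frame of the Hamiltonian field of the potential `f`. -/
def hamiltonianCoord (M : ℂ → Mat3) (f : ℂ → ℝ) (z : ℂ) : Fin 3 → ℂ :=
  ![I * (confFactor M z : ℂ)⁻¹ * (fderiv ℝ f z 1 * mc M z 1 0 2 + fderiv ℝ f z I * mc M z I 0 2),
    I * (confFactor M z : ℂ)⁻¹ * (fderiv ℝ f z 1 * mc M z 1 1 2 + fderiv ℝ f z I * mc M z I 1 2),
    0]

theorem contDiffOn_confFactor {M : ℂ → Mat3} (hΩ : IsOpen Ω) (hM : SmoothMatOn M Ω) :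
    ContDiffOn ℝ ∞ (confFactor M) Ω := by
  have h1 : ∀ i j, ContDiffOn ℝ ∞ (fun z => normSq (mc M z 1 i j)) Ω := fun i j => by
    simp only [normSq_apply]
    have hr := reCLM.contDiff.comp_contDiffOn (hM.mc hΩ 1 i j)
    have hi := imCLM.contDiff.comp_contDiffOn (hM.mc hΩ 1 i j)
    exact (hr.mul hr).add (hi.mul hi)
  exact (h1 0 2).add (h1 1 2)

/-- Every test function f is a potential: the coordinates η = i e^{-2ρ}(f_x α(∂x) + f_y α(∂y))
define a variation [F(tη + e₃)] with Hamiltonian field of potential f. Stationarity then says that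
the divergence of dβ is orthogonal to all test functions. -/
theorem IsHamiltonianStationary.harmonicAngle (hΩ : IsOpen Ω) (hF : IsAdapted Ω (matField F))
    (hu : ∀ z, u z = lastColLine (F z)) (hs : IsHamiltonianStationary u) :
    HarmonicAngle Ω (matField F) := by
  set M := matField F
  have hb := contDiffOn_angleForm hΩ hF.smooth
  have hcont : ContinuousOn
      (fun z => fderiv ℝ (angleForm M 1) z 1 + fderiv ℝ (angleForm M I) z I) Ω :=
    (continuousOn_fderiv_apply_of_contDiffOn hΩ (hb 1) 1).add
      (continuousOn_fderiv_apply_of_contDiffOn hΩ (hb I) I)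
  have key : ∀ f : ℂ → ℝ, ContDiff ℝ ∞ f → HasCompactSupport f → tsupport f ⊆ Ω →
      ∫ z, f z • (fderiv ℝ (angleForm M 1) z 1 + fderiv ℝ (angleForm M I) z I) = 0 := by
    intro f hf hfc hfΩ
    have h2 : ∀ z, hamiltonianCoord M f z 2 = 0 := fun z => rfl
    have hfd : ∀ X, ContDiffOn ℝ ∞ (fun z => (fderiv ℝ f z X : ℂ)) Ω := fun X =>
      ofRealCLM.contDiff.comp_contDiffOn
        ((hf.fderiv_right (m := ∞) (by simp)).clm_apply contDiff_const).contDiffOn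
    have hci : ContDiffOn ℝ ∞ (fun z => (confFactor M z : ℂ)⁻¹) Ω :=
      (ofRealCLM.contDiff.comp_contDiffOn (contDiffOn_confFactor hΩ hF.smooth)).inv fun z hz => by
        simpa using (hF.nondeg z hz).ne'
    have hcs : ∀ k, ContDiffOn ℝ ∞ (fun z => hamiltonianCoord M f z k) Ω := by
      have hk : ∀ k, ContDiffOn ℝ ∞ (fun z => I * (confFactor M z : ℂ)⁻¹ * (fderiv ℝ f z 1 *
          mc M z 1 k 2 + fderiv ℝ f z I * mc M z I k 2)) Ω := fun k =>
        (contDiffOn_const.mul hci).mul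
          (((hfd 1).mul (hF.smooth.mc hΩ 1 k 2)).add ((hfd I).mul (hF.smooth.mc hΩ I k 2)))
      intro k
      fin_cases k
      · exact hk 0
      · exact hk 1
      · exact contDiffOn_const
    have hzero : ∀ z ∉ tsupport f, hamiltonianCoord M f z = 0 := by
      intro z hz
      have h0 : fderiv ℝ f z = 0 :=
        fderiv_eq_zero_off hfc (fun w hw => image_eq_zero_of_notMem_tsupport hw) hz
      funext k
      fin_cases k <;> simp [hamiltonianCoord, h0]
    have hvar := isVariation_frameVariation hF.smooth hu h2 hcs hfc hfΩ hzero
    have hω : ∀ z ∈ Ω, ∀ X : ℂ, (Matrix.trace (projField u z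
        * variationField (frameVariation F (hamiltonianCoord M f) h2) z
        * dMat (projField u) z X)).im + fderiv ℝ f z X = 0 := by
      intro z hz X
      rw [variationField_frameVariation h2 hz,
        trace_projector_tangent hΩ hF.smooth hF.unitary (projField_eq hu) hz]
      have e1 := hF.herm hz 1 X
      have e2 := hF.herm hz I X
      have hne : ((confFactor M z : ℝ) : ℂ) ≠ 0 := by
        exact_mod_cast (hF.nondeg z hz).ne'
      -- The products of α(∂x) and α(∂y) with α(X) are e^{2ρ}X.re and e^{2ρ}X.im, so the factor
      -- e^{-2ρ} cancels and conj(i) = -i leaves -i df(X).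
      have e3 : (starRingEnd ℂ) (hamiltonianCoord M f z 0) * mc M z X 0 2
          + (starRingEnd ℂ) (hamiltonianCoord M f z 1) * mc M z X 1 2
          = ((-(fderiv ℝ f z X) : ℝ) : ℂ) * I := by
        rw [fderiv_real_basis (fderiv ℝ f z) X]
        simp only [one_mul, conj_re, I_mul_re, conj_im, neg_neg] at e1 e2
        simp only [hamiltonianCoord, Matrix.cons_val_zero, Matrix.cons_val_one, map_mul, map_add,
          map_inv₀, conj_I, conj_ofReal, smul_eq_mul]
        push_cast at e1 e2 ⊢
        field_simp
        linear_combination (-(fderiv ℝ f z 1 : ℂ)) * e1 - (fderiv ℝ f z I : ℂ) * e2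
      have e4 : (!![0, 0, hamiltonianCoord M f z 0; 0, 0, hamiltonianCoord M f z 1;
          (starRingEnd ℂ) (hamiltonianCoord M f z 0),
          (starRingEnd ℂ) (hamiltonianCoord M f z 1), 0] : Mat3) 2 0 * mc M z X 0 2
          + (!![0, 0, hamiltonianCoord M f z 0; 0, 0, hamiltonianCoord M f z 1;
          (starRingEnd ℂ) (hamiltonianCoord M f z 0),
          (starRingEnd ℂ) (hamiltonianCoord M f z 1), 0] : Mat3) 2 1 * mc M z X 1 2
          = ((-(fderiv ℝ f z X) : ℝ) : ℂ) * I := e3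
      rw [e4]
      simp
    have hd1 := hs _ _ hvar ⟨f, hf, hfc, hfΩ, hω⟩
    have hd2 := hvar.hasDerivAt_area_of_hamiltonian hΩ hF hu hf hω
    have h3 := hd1.unique hd2
    rw [setIntegral_angleForm_mul hΩ hF.smooth hfc hfΩ hf
      (fun z hz => image_eq_zero_of_notMem_tsupport hz), neg_neg] at h3
    rw [← setIntegral_eq_integral_of_forall_compl_eq_zero (s := tsupport f) fun z hz => by
      rw [image_eq_zero_of_notMem_tsupport hz, zero_smul]]
    exact h3.symm
  have hae := hΩ.ae_eq_zero_of_integral_contDiff_smul_eq_zero (μ := volume)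
    (hcont.locallyIntegrableOn hΩ.measurableSet) key
  have hae' : (fun z => fderiv ℝ (angleForm M 1) z 1 + fderiv ℝ (angleForm M I) z I)
      =ᵐ[volume.restrict Ω] fun _ => 0 := (ae_restrict_iff' hΩ.measurableSet).mpr hae
  exact fun z hz => Measure.eqOn_open_of_ae_eq hae' hΩ hcont continuousOn_const hz

end TestVariation

end HSLagrangian
end

/-! ### From extended framings to adapted frames with harmonic angle. -/

open scoped ContDiff

noncomputable section

namespace HSLagrangian

open Set Filter Topology Complex MeasureTheory

/-! ### Trigonometric polynomials of degree two -/

/-- The Fourier coefficients of a function on the circle. -/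
def circleCoeff (φ : Circle → ℂ) (k : ℤ) : ℂ :=
  (2 * Real.pi : ℂ)⁻¹ * ∫ θ in (0 : ℝ)..(2 * Real.pi), exp (-(k * θ * I)) * φ (Circle.exp θ)

theorem continuous_coeff_integrand {φ : Circle → ℂ} (hφ : Continuous φ) (k : ℤ) :
    Continuous fun θ : ℝ => exp (-(k * θ * I)) * φ (Circle.exp θ) :=
  (by fun_prop : Continuous fun θ : ℝ => exp (-(k * θ * I))).mul
    (hφ.comp Circle.exp.continuous)

theorem circleCoeff_add {φ ψ : Circle → ℂ} (hφ : Continuous φ) (hψ : Continuous ψ) (k : ℤ) :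
    circleCoeff (fun l => φ l + ψ l) k = circleCoeff φ k + circleCoeff ψ k := by
  simp only [circleCoeff, mul_add]
  rw [intervalIntegral.integral_add
    ((continuous_coeff_integrand hφ k).intervalIntegrable _ _)
    ((continuous_coeff_integrand hψ k).intervalIntegrable _ _), mul_add]

theorem circleCoeff_const_mul (φ : Circle → ℂ) (c : ℂ) (k : ℤ) :
    circleCoeff (fun l => c * φ l) k = c * circleCoeff φ k := by
  simp only [circleCoeff]
  rw [mul_left_comm c, ← intervalIntegral.integral_const_mul c]
  congr 2
  funext θ
  ring

theorem circleCoeff_conj (φ : Circle → ℂ) (k : ℤ) :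
    circleCoeff (fun l => (starRingEnd ℂ) (φ l)) k = (starRingEnd ℂ) (circleCoeff φ (-k)) := by
  simp only [circleCoeff]
  rw [map_mul, intervalIntegral.integral_of_le (by positivity),
    intervalIntegral.integral_of_le (by positivity), ← integral_conj]
  congr 1
  · simp [← ofReal_ofNat, conj_ofReal]
  · congr 1
    funext θ
    rw [map_mul, ← exp_conj]
    simp

theorem circleCoeff_zpow (n k : ℤ) :
    circleCoeff (fun l => (l : ℂ) ^ n) k = if k = n then 1 else 0 := by
  have e : ∀ θ : ℝ, exp (-(k * θ * I)) * (Circle.exp θ : ℂ) ^ n = exp (((n - k : ℤ) * I) * θ) := by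
    intro θ
    rw [Circle.coe_exp, ← exp_int_mul, ← exp_add]
    congr 1
    push_cast
    ring
  simp only [circleCoeff, e]
  have hpi : (2 * Real.pi : ℂ) ≠ 0 := by simp [Real.pi_ne_zero]
  split_ifs with h
  · subst h
    simp only [sub_self, Int.cast_zero, zero_mul, exp_zero, intervalIntegral.integral_const,
      sub_zero, real_smul, mul_one]
    push_cast
    exact inv_mul_cancel₀ hpi
  · have hn : ((n - k : ℤ) : ℂ) * I ≠ 0 :=
      mul_ne_zero (by exact_mod_cast sub_ne_zero.mpr (Ne.symm h)) I_ne_zero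
    rw [integral_exp_mul_complex hn]
    have : ((n - k : ℤ) : ℂ) * I * ((2 * Real.pi : ℝ) : ℂ) = (n - k : ℤ) * (2 * Real.pi * I) := by
      push_cast; ring
    rw [this, exp_int_mul_two_pi_mul_I]
    simp

/-- The Laurent polynomial with the given coefficients of degrees `-2, …, 2`. -/
def laurent (a b c d e : ℂ) (l : Circle) : ℂ :=
  a * (l : ℂ) ^ (-2 : ℤ) + b * (l : ℂ) ^ (-1 : ℤ) + c * (l : ℂ) ^ (0 : ℤ) + d * (l : ℂ) ^ (1 : ℤ)
    + e * (l : ℂ) ^ (2 : ℤ)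

theorem continuous_circle_zpow (n : ℤ) : Continuous fun l : Circle => (l : ℂ) ^ n :=
  Continuous.zpow₀ (f := fun l : Circle => (l : ℂ)) (by fun_prop) n
    fun l => Or.inl (Circle.coe_ne_zero l)

theorem circleCoeff_laurent (a b c d e : ℂ) (k : ℤ) :
    circleCoeff (laurent a b c d e) k = (if k = -2 then a else 0) + (if k = -1 then b else 0)
      + (if k = 0 then c else 0) + (if k = 1 then d else 0) + (if k = 2 then e else 0) := by
  have hc : ∀ (x : ℂ) (n : ℤ), Continuous fun l : Circle => x * (l : ℂ) ^ n := fun x n =>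
    continuous_const.mul (continuous_circle_zpow n)
  have h1 := hc a (-2)
  have h2 := h1.fun_add (hc b (-1))
  have h3 := h2.fun_add (hc c 0)
  have h4 := h3.fun_add (hc d 1)
  change circleCoeff (fun l => a * (l : ℂ) ^ (-2 : ℤ) + b * (l : ℂ) ^ (-1 : ℤ)
    + c * (l : ℂ) ^ (0 : ℤ) + d * (l : ℂ) ^ (1 : ℤ) + e * (l : ℂ) ^ (2 : ℤ)) k = _
  rw [circleCoeff_add h4 (hc e 2), circleCoeff_add h3 (hc d 1), circleCoeff_add h2 (hc c 0),
    circleCoeff_add h1 (hc b (-1))]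
  simp only [circleCoeff_const_mul, circleCoeff_zpow, mul_ite, mul_one, mul_zero]

/-- A Fourier series with finitely many nonzero coefficients is summable, so it converges pointwise
to the continuous function. -/
theorem eq_laurent_of_circleCoeff {φ : Circle → ℂ} (hφ : Continuous φ)
    (h : ∀ k : ℤ, k ≤ -3 ∨ 3 ≤ k → circleCoeff φ k = 0) (l : Circle) :
    φ l = laurent (circleCoeff φ (-2)) (circleCoeff φ (-1)) (circleCoeff φ 0) (circleCoeff φ 1)
      (circleCoeff φ 2) l := by
  have : Fact (0 < 2 * Real.pi) := ⟨by positivity⟩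
  let f : C(AddCircle (2 * Real.pi), ℂ) :=
    ⟨fun x => φ x.toCircle, hφ.comp AddCircle.continuous_toCircle⟩
  have e : ∀ θ : ℝ, AddCircle.toCircle (θ : AddCircle (2 * Real.pi)) = Circle.exp θ := by
    intro θ
    rw [AddCircle.toCircle_apply_mk]
    congr 1
    field_simp
  have hcoef : ∀ k, fourierCoeff f k = circleCoeff φ k := by
    intro k
    rw [fourierCoeff_eq_intervalIntegral f k 0, circleCoeff, zero_add, real_smul]
    congr 1
    · push_cast
      simp
    · refine intervalIntegral.integral_congr fun θ _ => ?_
      simp only [smul_eq_mul, fourier_coe_apply]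
      congr 1
      · congr 1
        have : (Real.pi : ℂ) ≠ 0 := by simp [Real.pi_ne_zero]
        push_cast
        field_simp
      · exact congrArg φ (e θ)
  have hz : ∀ k ∉ ({-2, -1, 0, 1, 2} : Finset ℤ), fourierCoeff f k = 0 := by
    intro k hk
    rw [hcoef]
    refine h k ?_
    simp at hk
    omega
  obtain ⟨θ, rfl⟩ := Circle.exp_surjective l
  have hs := has_pointwise_sum_fourier_series_of_summable (f := f)
    (summable_of_ne_finset_zero (s := {-2, -1, 0, 1, 2}) hz) (θ : AddCircle (2 * Real.pi))
  have hs' := hasSum_sum_of_ne_finset_zero (L := .unconditional ℤ) (f := fun i => fourierCoeff f i •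
    fourier i (θ : AddCircle (2 * Real.pi))) (s := {-2, -1, 0, 1, 2})
    fun k hk => by rw [hz k hk, zero_smul]
  have := hs.unique hs'
  have hf : f (θ : AddCircle (2 * Real.pi)) = φ (Circle.exp θ) := congrArg φ (e θ)
  rw [hf] at this
  rw [this]
  have hfo : ∀ n : ℤ, fourier n (θ : AddCircle (2 * Real.pi)) = (Circle.exp θ : ℂ) ^ n := by
    intro n
    rw [fourier_apply, AddCircle.toCircle_zsmul, e]
    simp
  simp [hcoef, hfo, laurent, add_assoc]

theorem laurent_injective {a b c d e a' b' c' d' e' : ℂ}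
    (h : ∀ l, laurent a b c d e l = laurent a' b' c' d' e' l) :
    a = a' ∧ b = b' ∧ c = c' ∧ d = d' ∧ e = e' := by
  have h' : ∀ k, circleCoeff (laurent a b c d e) k = circleCoeff (laurent a' b' c' d' e') k :=
    fun k => by rw [funext h]
  simp only [circleCoeff_laurent] at h'
  exact ⟨by simpa using h' (-2), by simpa using h' (-1), by simpa using h' 0,
    by simpa using h' 1, by simpa using h' 2⟩

/-- The degree k coefficient is multiplied by i^k. The twisting condition thereby becomes an
eigenvalue condition on each Fourier coefficient. -/
theorem laurent_circleI_mul (a b c d e : ℂ) (l : Circle) :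
    laurent a b c d e (circleI * l) = laurent (-a) (-I * b) c (I * d) (-e) l := by
  have hI : ((circleI : Circle) : ℂ) = I := rfl
  simp only [laurent, Circle.coe_mul, mul_zpow, hI]
  have h2 : I ^ (2 : ℤ) = -1 := by rw [zpow_ofNat, I_sq]
  rw [zpow_neg I 2, h2, zpow_neg_one I, inv_I, zpow_one, zpow_zero]
  ring

theorem laurent_const_mul (a b c d e x : ℂ) (l : Circle) :
    x * laurent a b c d e l = laurent (x * a) (x * b) (x * c) (x * d) (x * e) l := by
  simp only [laurent]
  ring

end HSLagrangian
end

open scoped ContDiff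

noncomputable section

namespace HSLagrangian

open Set Filter Topology Complex MeasureTheory

/-! ### The Maurer–Cartan form of an extended framing -/

variable {Ω : Set ℂ}

theorem entry_matField_atParam (F : Ω → twistedLoopGroup) (l : Circle) (i j : Fin 3) {z : ℂ}
    (hz : z ∈ Ω) : matField (atParam F l) z i j
      = ContinuousMap.evalCLM ℝ l
        (zeroExt (fun z => entryLoop (F z : C(Circle, U3)) i j) z) := by
  rw [matField_apply _ hz, zeroExt_apply _ hz]
  rfl

theorem smoothMatOn_atParam {F : Ω → twistedLoopGroup}
    (h : ∀ i j, ContDiffOn ℝ ∞ (zeroExt fun z => entryLoop (F z : C(Circle, U3)) i j) Ω)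
    (l : Circle) : SmoothMatOn (matField (atParam F l)) Ω := fun i j =>
  ((ContinuousMap.evalCLM ℝ l : C(Circle, ℂ) →L[ℝ] ℂ).contDiff.comp_contDiffOn (h i j)).congr fun _ hz =>
    entry_matField_atParam F l i j hz

theorem dMat_atParam_apply (hΩ : IsOpen Ω) {F : Ω → twistedLoopGroup}
    (h : ∀ i j, ContDiffOn ℝ ∞ (zeroExt fun z => entryLoop (F z : C(Circle, U3)) i j) Ω)
    (l : Circle) {z : ℂ} (hz : z ∈ Ω) (X : ℂ) (i j : Fin 3) :
    dMat (matField (atParam F l)) z X i j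
      = (fderiv ℝ (zeroExt fun z => entryLoop (F z : C(Circle, U3)) i j) z X : C(Circle, ℂ)) l := by
  have hd := (((h i j).differentiableOn (by simp)).differentiableAt (hΩ.mem_nhds hz)).hasFDerivAt
  have h1 := (ContinuousMap.evalCLM ℝ l : C(Circle, ℂ) →L[ℝ] ℂ).hasFDerivAt.comp z hd
  have h2 : (fun w => matField (atParam F l) w i j) =ᶠ[𝓝 z]
      (ContinuousMap.evalCLM ℝ l : C(Circle, ℂ) →L[ℝ] ℂ)
        ∘ zeroExt (fun z => entryLoop (F z : C(Circle, U3)) i j) :=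
    eventually_of_mem (hΩ.mem_nhds hz) fun w hw => entry_matField_atParam F l i j hw
  rw [dMat, Matrix.of_apply, (h1.congr_of_eventuallyEq h2).fderiv]
  rfl

theorem maurerCartan_eq_mc (F : Ω → twistedLoopGroup) (l : Circle) (z : Ω) (X : ℂ) :
    maurerCartan F l z X = mc (matField (atParam F l)) z X := by
  rw [maurerCartan, mc, matField_apply _ z.2]
  rfl

theorem continuous_mc_atParam (hΩ : IsOpen Ω) {F : Ω → twistedLoopGroup}
    (h : ∀ i j, ContDiffOn ℝ ∞ (zeroExt fun z => entryLoop (F z : C(Circle, U3)) i j) Ω)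
    {z : ℂ} (hz : z ∈ Ω) (X : ℂ) (i j : Fin 3) :
    Continuous fun l => mc (matField (atParam F l)) z X i j := by
  simp only [mc, Matrix.mul_apply, Matrix.star_apply, dMat_atParam_apply hΩ h _ hz]
  refine continuous_finsetSum _ fun k _ => Continuous.mul ?_ (ContinuousMap.continuous _)
  refine continuous_star.comp ?_
  simp only [matField_apply _ hz]
  exact (entryLoop (F ⟨z, hz⟩ : C(Circle, U3)) k i).continuous

/-- `τ` on unitary matrices, without inverses. -/
def conjTwist (M : Mat3) : Mat3 :=
  !![0, 1, 0; -1, 0, 0; 0, 0, 1] * M.map (starRingEnd ℂ) * !![0, -1, 0; 1, 0, 0; 0, 0, 1]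

theorem conjTwist_eq (M : Mat3) : conjTwist M =
    !![(starRingEnd ℂ) (M 1 1), -(starRingEnd ℂ) (M 1 0), (starRingEnd ℂ) (M 1 2);
      -(starRingEnd ℂ) (M 0 1), (starRingEnd ℂ) (M 0 0), -(starRingEnd ℂ) (M 0 2);
      (starRingEnd ℂ) (M 2 1), -(starRingEnd ℂ) (M 2 0), (starRingEnd ℂ) (M 2 2)] := by
  ext i j
  fin_cases i <;> fin_cases j <;> simp [conjTwist, Matrix.mul_apply, Matrix.vecMul, dotProduct, Fin.sum_univ_three]

theorem conjTwist_mul (M N : Mat3) : conjTwist (M * N) = conjTwist M * conjTwist N := by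
  ext i j
  fin_cases i <;> fin_cases j <;>
    simp [conjTwist_eq, Matrix.mul_apply, Fin.sum_univ_three] <;> ring

theorem conjTwist_star (M : Mat3) : conjTwist (star M) = star (conjTwist M) := by
  ext i j
  fin_cases i <;> fin_cases j <;> simp [conjTwist_eq]

theorem conjTwist_one : conjTwist 1 = 1 := by
  ext i j
  fin_cases i <;> fin_cases j <;> simp [conjTwist_eq]

theorem tau_eq_conjTwist {M : Mat3} (h : M * star M = 1) : tau M = conjTwist M := by
  have : (M.transpose)⁻¹ = M.map (starRingEnd ℂ) := by
    refine Matrix.inv_eq_left_inv ?_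
    have := congrArg Matrix.transpose h
    rw [Matrix.transpose_mul, Matrix.transpose_one] at this
    exact this
  rw [tau, conjTwist, this]

theorem DiffMatAt.conjTwist {M : ℂ → Mat3} {z : ℂ} (h : DiffMatAt M z) :
    DiffMatAt (fun w => conjTwist (M w)) z := fun i j => by
  have hc : ∀ i j, DifferentiableAt ℝ (fun w => (starRingEnd ℂ) (M w i j)) z := fun i j =>
    conjCLE.differentiableAt.comp z (h i j)
  simp only [conjTwist_eq]
  fin_cases i <;> fin_cases j <;> simp [hc]

/-- Complex conjugation of the entries is real linear and thus passes to the differential. The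
twisting condition on F_λ is in this way inherited by A_λ. -/
theorem dMat_conjTwist {M : ℂ → Mat3} {z : ℂ} (h : DiffMatAt M z) (X : ℂ) :
    dMat (fun w => conjTwist (M w)) z X = conjTwist (dMat M z X) := by
  have hc : ∀ i j, fderiv ℝ (fun w => (starRingEnd ℂ) (M w i j)) z X
      = (starRingEnd ℂ) (fderiv ℝ (fun w => M w i j) z X) := fun i j =>
    DFunLike.congr_fun (conjCLE.hasFDerivAt.comp z (h i j).hasFDerivAt).fderiv X
  simp only [conjTwist_eq]
  ext i j
  fin_cases i <;> fin_cases j <;> simp [dMat, hc]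

theorem mc_conjTwist {M : ℂ → Mat3} {z : ℂ} (h : DiffMatAt M z) (X : ℂ) :
    mc (fun w => conjTwist (M w)) z X = conjTwist (mc M z X) := by
  rw [mc, dMat_conjTwist h, mc, conjTwist_mul, conjTwist_star]

theorem matField_circleI_mul (F : Ω → twistedLoopGroup) (l : Circle) {z : ℂ} (hz : z ∈ Ω) :
    matField (atParam F (circleI * l)) z = conjTwist (matField (atParam F l) z) := by
  have h := (F ⟨z, hz⟩).2 l
  rw [matField_apply _ hz, matField_apply _ hz, ← tau_eq_conjTwist]
  · exact h.symm
  · exact Matrix.mem_unitaryGroup_iff.mp (atParam F l ⟨z, hz⟩).2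

theorem mc_circleI_mul (hΩ : IsOpen Ω) {F : Ω → twistedLoopGroup}
    (h : ∀ i j, ContDiffOn ℝ ∞ (zeroExt fun z => entryLoop (F z : C(Circle, U3)) i j) Ω)
    (l : Circle) {z : ℂ} (hz : z ∈ Ω) (X : ℂ) :
    mc (matField (atParam F (circleI * l))) z X
      = conjTwist (mc (matField (atParam F l)) z X) := by
  rw [← mc_conjTwist ((smoothMatOn_atParam h l).diffMatAt hΩ hz), mc, mc,
    matField_circleI_mul F l hz, dMat_congr_on hΩ (fun w hw => matField_circleI_mul F l hw) hz]

/-- The twisted Maurer–Cartan form, as a Laurent polynomial in `λ`. -/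
def laurentForm (α p q s b : ℂ) (X : ℂ) (l : Circle) : Mat3 :=
  let t : ℂ := I * (α * X * (l : ℂ)⁻¹ ^ 2 + (starRingEnd ℂ) (α * X * (l : ℂ)⁻¹ ^ 2))
  let v : ℂ := X * (l : ℂ)⁻¹ * p - I * (starRingEnd ℂ) (X * (l : ℂ)⁻¹ * q)
  let w : ℂ := X * (l : ℂ)⁻¹ * q + I * (starRingEnd ℂ) (X * (l : ℂ)⁻¹ * p)
  !![s + t, b, v; -(starRingEnd ℂ) b, -s + t, w; -(starRingEnd ℂ) v, -(starRingEnd ℂ) w, 0]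

/-- Skew-Hermitian symmetry exchanges degrees k and -k, so only degrees -2 to 2 occur. Twisting
confines degree ±1 to the last row and column, and degree 0 to the traceless part of the block. The
coefficients α, p, q do not depend on X since the modes -2 and -1 are multiples of dz; only the
degree 0 data s, b do. -/
theorem IsExtendedFraming.exists_laurentForm (hΩ : IsOpen Ω) {z₀ : Ω} {F : Ω → twistedLoopGroup}
    (h : IsExtendedFraming z₀ F) {z : ℂ} (hz : z ∈ Ω) :
    ∃ α p q : ℂ, (p ≠ 0 ∨ q ≠ 0) ∧ ∀ X, ∃ s b, ∀ l,
      mc (matField (atParam F l)) z X = laurentForm α p q s b X l := by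
  obtain ⟨a, -, ha⟩ := h.mode_neg_two
  let φ : ℂ → Fin 3 → Fin 3 → Circle → ℂ := fun X i j l => mc (matField (atParam F l)) z X i j
  have hφc : ∀ X i j, Continuous (φ X i j) := fun X i j => continuous_mc_atParam hΩ h.smooth hz X i j
  have hmode : ∀ k X i j, fourierMode F k ⟨z, hz⟩ X i j = circleCoeff (φ X i j) k := by
    intro k X i j
    simp only [fourierMode, circleCoeff, Matrix.of_apply, maurerCartan_eq_mc, φ]
  have hskew : ∀ X i j l, φ X i j l = -(starRingEnd ℂ) (φ X j i l) := fun X i j l => by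
    rw [eq_neg_iff_add_eq_zero, add_comm, ← eq_neg_iff_add_eq_zero]
    exact conj_mc_apply hΩ (smoothMatOn_atParam h.smooth l) (unitaryOn_matField _) hz X j i
  have hskew' : ∀ X i j l, (starRingEnd ℂ) (φ X i j l) = -φ X j i l := fun X i j l => by
    rw [hskew X j i l, neg_neg]
  have hconj : ∀ X i j k, circleCoeff (φ X i j) k = -(starRingEnd ℂ) (circleCoeff (φ X j i) (-k)) := by
    intro X i j k
    rw [← circleCoeff_conj, ← neg_one_mul, ← circleCoeff_const_mul]
    congr 1
    funext l
    rw [hskew X i j l, neg_one_mul]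
  have hlow : ∀ X i j k, k ≤ -3 → circleCoeff (φ X i j) k = 0 := by
    intro X i j k hk
    rw [← hmode, h.mode_le_neg_three k hk]
    rfl
  have hhigh : ∀ X i j k, 3 ≤ k → circleCoeff (φ X i j) k = 0 := by
    intro X i j k hk
    rw [hconj, hlow X j i (-k) (by omega), map_zero, neg_zero]
  have hL : ∀ X i j l, φ X i j l = laurent (circleCoeff (φ X i j) (-2))
      (circleCoeff (φ X i j) (-1)) (circleCoeff (φ X i j) 0) (circleCoeff (φ X i j) 1)
      (circleCoeff (φ X i j) 2) l := fun X i j l =>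
    eq_laurent_of_circleCoeff (hφc X i j) (fun k hk => hk.elim (hlow X i j k) (hhigh X i j k)) l
  have hneg2 : ∀ X i j, circleCoeff (φ X i j) (-2)
      = ((a z * X) • Matrix.diagonal ![I, I, 0] : Mat3) i j := fun X i j => by
    rw [← hmode, ha]
  set A := fourierModeDz F (-1) ⟨z, hz⟩ with hA
  have hneg1 : ∀ X i j, circleCoeff (φ X i j) (-1) = X * A i j := by
    intro X i j
    have h1 : circleCoeff (φ X i j) (-1) = X.re * circleCoeff (φ 1 i j) (-1)
        + X.im * circleCoeff (φ I i j) (-1) := by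
      rw [← circleCoeff_const_mul, ← circleCoeff_const_mul,
        ← circleCoeff_add ((hφc 1 i j).const_mul _) ((hφc I i j).const_mul _)]
      congr 1
      funext l
      simp only [φ]
      rw [mc_basis]
      simp
    have h2 := congrFun (congrFun (h.mode_neg_one ⟨z, hz⟩) i) j
    simp only [fourierModeDzbar, Matrix.smul_apply, Matrix.add_apply, hmode, smul_eq_mul,
      Matrix.zero_apply] at h2
    have h3 : A i j = 1 / 2 * (circleCoeff (φ 1 i j) (-1) - I * circleCoeff (φ I i j) (-1)) := by
      rw [hA]
      simp only [fourierModeDz, Matrix.smul_apply, Matrix.sub_apply, hmode, smul_eq_mul]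
    rw [h1, h3]
    conv_rhs => rw [← re_add_im X]
    linear_combination ((X.im : ℂ) * (-I) + X.re) * h2 
      + X.im * circleCoeff (φ I i j) (-1) * I_sq
  have htw : ∀ X l, (Matrix.of fun i j => φ X i j (circleI * l))
      = conjTwist (Matrix.of fun i j => φ X i j l) := fun X l =>
    mc_circleI_mul hΩ h.smooth l hz X
  -- Under λ ↦ iλ the coefficients of degrees -1 and 0 acquire the factors -i and 1, so each
  -- symmetry between two entries gives one relation in each of these degrees.
  have htwist : ∀ X i j i' j' (s : ℂ), (∀ l, φ X i j (circleI * l) = s * φ X i' j' l) →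
      -I * (X * A i j) = s * (X * A i' j') ∧
      circleCoeff (φ X i j) 0 = s * circleCoeff (φ X i' j') 0 := by
    intro X i j i' j' s hs
    have h1 : ∀ l, _ = _ := hs
    simp only [hL X, laurent_circleI_mul, laurent_const_mul] at h1
    obtain ⟨-, h2, h3, -, -⟩ := laurent_injective h1
    rw [hneg1, hneg1] at h2
    exact ⟨h2, h3⟩
  have hent : ∀ X i j l, φ X i j (circleI * l)
      = conjTwist (Matrix.of fun i j => φ X i j l) i j := fun X i j l =>
    congrFun (congrFun (htw X l) i) j
  have e00 := fun X => htwist X 0 0 1 1 (-1) fun l => by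
    rw [hent, conjTwist_eq]; simp [hskew']
  have e11 := fun X => htwist X 1 1 0 0 (-1) fun l => by
    rw [hent, conjTwist_eq]; simp [hskew']
  have e01 := fun X => htwist X 0 1 0 1 1 fun l => by
    rw [hent, conjTwist_eq]; simp [hskew']
  have e10 := fun X => htwist X 1 0 1 0 1 fun l => by
    rw [hent, conjTwist_eq]; simp [hskew']
  have e22 := fun X => htwist X 2 2 2 2 (-1) fun l => by
    rw [hent, conjTwist_eq]; simp [hskew']
  have e02 := fun X => htwist X 0 2 2 1 (-1) fun l => by
    rw [hent, conjTwist_eq]; simp [hskew']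
  have e12 := fun X => htwist X 1 2 2 0 1 fun l => by
    rw [hent, conjTwist_eq]; simp [hskew']
  have e20 := fun X => htwist X 2 0 1 2 (-1) fun l => by
    rw [hent, conjTwist_eq]; simp [hskew']
  have e21 := fun X => htwist X 2 1 0 2 1 fun l => by
    rw [hent, conjTwist_eq]; simp [hskew']
  have cancel : ∀ {x : ℂ} (c d : ℂ), c ≠ d → c * x = d * x → x = 0 := fun {x} c d hcd hx =>
    (mul_eq_mul_right_iff.mp hx).resolve_left hcd
  have hI1 : -I ≠ 1 := fun hh => by simpa using congrArg re hh
  have hI2 : -I ≠ -1 := fun hh => by simpa using congrArg re hh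
  have h11 : (-1 : ℂ) ≠ 1 := by norm_num
  have A01 : A 0 1 = 0 := cancel _ _ hI1 (by simpa using (e01 1).1)
  have A10 : A 1 0 = 0 := cancel _ _ hI1 (by simpa using (e10 1).1)
  have A22 : A 2 2 = 0 := cancel _ _ hI2 (by simpa using (e22 1).1)
  have A00 : A 0 0 = 0 := by
    have h1 := (e00 1).1
    have h2 := (e11 1).1
    refine cancel _ _ h11 ?_
    linear_combination -I * h1 - h2 - A 0 0 * I_sq
  have A11 : A 1 1 = 0 := by
    have h1 := (e00 1).1
    linear_combination h1 + I * A00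
  have A20 : A 2 0 = -I * A 1 2 := by
    have h1 := (e12 1).1
    linear_combination -h1
  have A21 : A 2 1 = I * A 0 2 := by
    have h1 := (e02 1).1
    linear_combination h1
  have z22 : ∀ X, circleCoeff (φ X 2 2) 0 = 0 := fun X =>
    cancel 1 (-1) h11.symm (by simpa using (e22 X).2)
  have z02 : ∀ X, circleCoeff (φ X 0 2) 0 = 0 := fun X => by
    have h1 := (e02 X).2
    have h2 := (e21 X).2
    exact cancel 1 (-1) h11.symm (by linear_combination h1 - h2)
  have z12 : ∀ X, circleCoeff (φ X 1 2) 0 = 0 := fun X => by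
    have h1 := (e12 X).2
    have h2 := (e20 X).2
    exact cancel 1 (-1) h11.symm (by linear_combination h1 + h2)
  have z11 : ∀ X, circleCoeff (φ X 1 1) 0 = -circleCoeff (φ X 0 0) 0 := fun X => by
    have h1 := (e11 X).2
    linear_combination h1
  refine ⟨a z, A 0 2, A 1 2, ?_, fun X => ?_⟩
  · by_contra! hh
    refine h.nondegenerate ⟨z, hz⟩ ?_
    rw [← hA]
    ext i j
    fin_cases i <;> fin_cases j <;> simp [A00, A01, A10, A11, A20, A21, A22, hh.1, hh.2]
  have hp1 : ∀ i j, circleCoeff (φ X i j) 1 = -(starRingEnd ℂ) (X * A j i) := fun i j => by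
    rw [hconj, hneg1]
  have hp2 : ∀ i j, circleCoeff (φ X i j) 2
      = -(starRingEnd ℂ) (((a z * X) • Matrix.diagonal ![I, I, 0] : Mat3) j i) := fun i j => by
    rw [hconj, hneg2]
  refine ⟨circleCoeff (φ X 0 0) 0, circleCoeff (φ X 0 1) 0, fun l => ?_⟩
  have hl : (starRingEnd ℂ) (l : ℂ) = (l : ℂ)⁻¹ := (Circle.coe_inv_eq_conj l).symm
  have hlx : ∀ i j, φ X i j l = laurentForm (a z) (A 0 2) (A 1 2) (circleCoeff (φ X 0 0) 0)
      (circleCoeff (φ X 0 1) 0) X l i j := by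
    have h00 : φ X 0 0 l = _ := hL X 0 0 l
    have h01 : φ X 0 1 l = _ := hL X 0 1 l
    have h11 : φ X 1 1 l = _ := hL X 1 1 l
    have h02 : φ X 0 2 l = _ := hL X 0 2 l
    have h12 : φ X 1 2 l = _ := hL X 1 2 l
    have h22 : φ X 2 2 l = _ := hL X 2 2 l
    simp only [hneg1, hneg2, hp1, hp2, z22, z02, z12, z11, A00, A01, A10, A11, A20, A21, A22,
      laurent] at h00 h01 h11 h02 h12 h22
    have h10 := hskew X 1 0 l
    have h20 := hskew X 2 0 l
    have h21 := hskew X 2 1 l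
    rw [h01] at h10
    rw [h02] at h20
    rw [h12] at h21
    intro i j
    fin_cases i <;> fin_cases j <;>
      simp [laurentForm, h00, h01, h10, h11, h02, h12, h22, h20, h21, hl, zpow_neg] <;> ring
  ext i j
  exact hlx i j

end HSLagrangian
end

open scoped ContDiff

noncomputable section

namespace HSLagrangian

open Set Filter Topology Complex MeasureTheory

/-! ### Insertion of the spectral parameter -/

variable {Ω : Set ℂ}

/-- The matrix valued form obtained from `A` by inserting the spectral parameter `c = λ⁻¹`. -/
def twistForm (A : ℂ → Mat3) (c X : ℂ) : Mat3 :=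
  !![A X 0 0 + ((A (c ^ 2 * X)).trace - (A X).trace) / 2, A X 0 1, A (c * X) 0 2;
    A X 1 0, A X 1 1 + ((A (c ^ 2 * X)).trace - (A X).trace) / 2, A (c * X) 1 2;
    A (c * X) 2 0, A (c * X) 2 1, A X 2 2]

theorem twistForm_one (A : ℂ → Mat3) (X : ℂ) : twistForm A 1 X = A X := by
  ext i j
  fin_cases i <;> fin_cases j <;> simp [twistForm]

theorem trace_twistForm {A : ℂ → Mat3} (c X : ℂ) (h : A X 2 2 = 0) :
    (twistForm A c X).trace = (A (c ^ 2 * X)).trace := by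
  have := Matrix.trace_fin_three (A X)
  rw [h] at this
  rw [Matrix.trace_fin_three (twistForm A c X)]
  simp [twistForm, h]
  linear_combination -this

section extended

variable {z₀ : Ω} {F : Ω → twistedLoopGroup}

/-- In `laurentForm` the parameter only occurs through λ⁻¹X in the last row and column and through
λ⁻²X in the trace. All A_λ are thus determined by A₁. -/
theorem IsExtendedFraming.mc_eq_twistForm (hΩ : IsOpen Ω) (h : IsExtendedFraming z₀ F) (l : Circle)
    {z : ℂ} (hz : z ∈ Ω) (X : ℂ) : mc (matField (atParam F l)) z X
      = twistForm (mc (matField (atParam F 1)) z) (l : ℂ)⁻¹ X := by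
  obtain ⟨α, p, q, -, hL⟩ := h.exists_laurentForm hΩ hz
  obtain ⟨s, b, h1⟩ := hL X
  obtain ⟨s', b', h2⟩ := hL ((l : ℂ)⁻¹ * X)
  obtain ⟨s'', b'', h3⟩ := hL ((l : ℂ)⁻¹ ^ 2 * X)
  simp only [twistForm, h1, h2, h3, Matrix.trace_fin_three]
  ext i j
  fin_cases i <;> fin_cases j <;> simp [laurentForm] <;> ring

theorem IsExtendedFraming.isAdapted (hΩ : IsOpen Ω) (h : IsExtendedFraming z₀ F) :
    IsAdapted Ω (matField (atParam F 1)) where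
  smooth := smoothMatOn_atParam h.smooth 1
  unitary := unitaryOn_matField _
  horizontal z hz X := by
    obtain ⟨α, p, q, -, hL⟩ := h.exists_laurentForm hΩ hz
    obtain ⟨s, b, h1⟩ := hL X
    rw [h1]
    simp [laurentForm]
  rot_zero z hz := by
    obtain ⟨α, p, q, -, hL⟩ := h.exists_laurentForm hΩ hz
    obtain ⟨s, b, h1⟩ := hL 1
    obtain ⟨s', b', h2⟩ := hL I
    rw [h1, h2]
    simp [laurentForm]
    linear_combination (starRingEnd ℂ) q * I_sq
  rot_one z hz := by
    obtain ⟨α, p, q, -, hL⟩ := h.exists_laurentForm hΩ hz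
    obtain ⟨s, b, h1⟩ := hL 1
    obtain ⟨s', b', h2⟩ := hL I
    rw [h1, h2]
    simp [laurentForm]
    linear_combination -(starRingEnd ℂ) p * I_sq
  nondeg z hz := by
    obtain ⟨α, p, q, hpq, hL⟩ := h.exists_laurentForm hΩ hz
    obtain ⟨s, b, h1⟩ := hL 1
    have e0 : mc (matField (atParam F 1)) z 1 0 2 = p - I * (starRingEnd ℂ) q := by
      rw [h1]; simp [laurentForm]
    have e1 : mc (matField (atParam F 1)) z 1 1 2 = q + I * (starRingEnd ℂ) p := by
      rw [h1]; simp [laurentForm]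
    rw [confFactor, e0, e1]
    -- The two equations read p = i conj q and q = -i conj p. Substituting one in the other gives q
    -- = -q, hence p = q = 0.
    by_contra! hh
    have n0 := normSq_nonneg (p - I * (starRingEnd ℂ) q)
    have n1 := normSq_nonneg (q + I * (starRingEnd ℂ) p)
    have h0 : p - I * (starRingEnd ℂ) q = 0 := normSq_eq_zero.mp (by linarith)
    have h1 : q + I * (starRingEnd ℂ) p = 0 := normSq_eq_zero.mp (by linarith)
    have h0' := congrArg (starRingEnd ℂ) h0
    simp only [map_sub, map_mul, conj_I, conj_conj, map_zero] at h0'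
    have hq : q = 0 := by linear_combination (1 / 2 : ℂ) * h1 - (1 / 2 : ℂ) * I * h0' + (1 / 2 : ℂ) * q * I_sq
    have hp : p = 0 := by simpa [hq] using h0
    exact hpq.elim (fun h => h hp) fun h => h hq

theorem mc_neg (M : ℂ → Mat3) (z X : ℂ) : mc M z (-X) = -mc M z X := by
  rw [mc_basis M z (-X), mc_basis M z X]
  simp [add_comm]

/-- At λ = e^{iπ/4} one has λ⁻² = -i, so the trace of A_λ is i dβ composed with a quarter turn. The
trace of the flatness equation, in which commutators vanish, says that this form is closed. -/
theorem IsExtendedFraming.harmonicAngle (hΩ : IsOpen Ω) (h : IsExtendedFraming z₀ F) :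
    HarmonicAngle Ω (matField (atParam F 1)) := by
  intro z hz
  set M := matField (atParam F 1)
  have hl : ((Circle.exp (Real.pi / 4) : Circle) : ℂ)⁻¹ ^ 2 = -I := by
    rw [Circle.coe_exp, ← exp_neg, ← exp_nat_mul, ← exp_neg_pi_div_two_mul_I]
    congr 1
    push_cast
    ring
  set l : Circle := Circle.exp (Real.pi / 4)
  set N := matField (atParam F l)
  have hN : SmoothMatOn N Ω := smoothMatOn_atParam h.smooth l
  have hM : SmoothMatOn M Ω := smoothMatOn_atParam h.smooth 1
  have htr : ∀ w ∈ Ω, ∀ X, (mc N w X).trace = (mc M w (-I * X)).trace := fun w hw X => by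
    rw [h.mc_eq_twistForm hΩ l hw, trace_twistForm _ _ ((h.isAdapted hΩ).horizontal w hw X), hl]
  have hflat := congrArg Matrix.trace (mc_flat hΩ hN (unitaryOn_matField _) hz)
  rw [Matrix.trace_add, Matrix.trace_add, Matrix.trace_mul_comm] at hflat
  have hflat := add_right_cancel hflat
  rw [← fderiv_trace ((hN.mc hΩ 1).diffMatAt hΩ hz), ← fderiv_trace ((hN.mc hΩ I).diffMatAt hΩ hz)]
    at hflat
  have e1 : (fun w => (mc N w 1).trace) =ᶠ[𝓝 z] fun w => -(mc M w I).trace :=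
    eventually_of_mem (hΩ.mem_nhds hz) fun w hw => by
      beta_reduce
      rw [htr w hw, mul_one, mc_neg, Matrix.trace_neg]
  have e2 : (fun w => (mc N w I).trace) =ᶠ[𝓝 z] fun w => (mc M w 1).trace :=
    eventually_of_mem (hΩ.mem_nhds hz) fun w hw => by
      beta_reduce
      rw [htr w hw, neg_mul, I_mul_I, neg_neg]
  rw [e1.fderiv_eq, e2.fderiv_eq, fderiv_fun_neg, neg_apply] at hflat
  have him : ∀ X Y, fderiv ℝ (angleForm M X) z Y
      = (fderiv ℝ (fun w => (mc M w X).trace) z Y).im := fun X Y => by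
    have hd := ((contDiffOn_trace (hM.mc hΩ X)).differentiableOn (by simp)).differentiableAt
      (hΩ.mem_nhds hz)
    exact DFunLike.congr_fun (imCLM.hasFDerivAt.comp z hd.hasFDerivAt).fderiv Y
  rw [him, him, ← hflat]
  simp

end extended

end HSLagrangian
end

/-! ### From adapted frames with harmonic angle to extended framings. -/

open scoped ContDiff

noncomputable section

namespace HSLagrangian

open Set Filter Topology Complex MeasureTheory

/-! ### Flatness of the twisted form -/

variable {Ω : Set ℂ}

theorem star_twistForm {A : ℂ → Mat3} (hA' : ∀ X i j, (starRingEnd ℂ) (A X i j) = -A X j i)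
    (c X : ℂ) : star (twistForm A c X) = -twistForm A c X := by
  ext i j
  fin_cases i <;> fin_cases j <;>
    simp [twistForm, hA', Matrix.trace_fin_three] <;> ring

/-- The pointwise algebra behind the flatness of A_λ, with B Y in the role of the derivative of A
along Y. Flatness of A alone does not suffice: the rotation of the last column brings in the tension
equation, and that of the trace brings in harmonicity. -/
theorem twistForm_flat {A : ℂ → Mat3} {B : ℂ → ℂ → Mat3}
    (hA : ∀ X, A X = (X.re : ℂ) • A 1 + (X.im : ℂ) • A I)
    (hB : ∀ Y X, B Y X = (X.re : ℂ) • B Y 1 + (X.im : ℂ) • B Y I)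
    (hA' : ∀ X i j, (starRingEnd ℂ) (A X i j) = -A X j i)
    (hB' : ∀ Y X i j, (starRingEnd ℂ) (B Y X i j) = -B Y X j i)
    (hA22 : ∀ X, A X 2 2 = 0) (hB22 : ∀ Y X, B Y X 2 2 = 0)
    (hr0 : A I 0 2 = -(starRingEnd ℂ) (A 1 1 2)) (hr1 : A I 1 2 = (starRingEnd ℂ) (A 1 0 2))
    (hflat : B I 1 + A I * A 1 = B 1 I + A 1 * A I)
    (htens : ∀ k, k ≠ 2 → B 1 1 k 2 + (A 1 * A 1) k 2 + (B I I k 2 + (A I * A I) k 2)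
      = (A 1).trace * A 1 k 2 + (A I).trace * A I k 2)
    (hharm : (B 1 1).trace + (B I I).trace = 0) {c : ℂ} (hc : c.re ^ 2 + c.im ^ 2 = 1) :
    twistForm (B I) c 1 + twistForm A c I * twistForm A c 1
      = twistForm (B 1) c I + twistForm A c 1 * twistForm A c I := by
  have hc' : (c.re : ℂ) ^ 2 + (c.im : ℂ) ^ 2 = 1 := by exact_mod_cast hc
  have htr := congrArg Matrix.trace hflat
  rw [Matrix.trace_add, Matrix.trace_add, Matrix.trace_mul_comm (A 1)] at htr
  have htr := add_right_cancel htr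
  have hre : ∀ i j, (B I 1 + A I * A 1) i j = (B 1 I + A 1 * A I) i j := fun i j => by rw [hflat]
  have hA20 : A 1 2 0 = -(starRingEnd ℂ) (A 1 0 2) := by rw [hA' 1 0 2, neg_neg]
  have hA21 : A 1 2 1 = -(starRingEnd ℂ) (A 1 1 2) := by rw [hA' 1 1 2, neg_neg]
  have hI20 : A I 2 0 = A 1 1 2 := by
    have := hA' I 0 2
    rw [hr0, map_neg, conj_conj] at this
    exact (neg_injective this).symm
  have hI21 : A I 2 1 = -A 1 0 2 := by
    have := hA' I 1 2
    rw [hr1, conj_conj] at this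
    rw [this, neg_neg]
  have sq : (c ^ 2).re = c.re ^ 2 - c.im ^ 2 ∧ (c ^ 2).im = 2 * c.re * c.im := by
    constructor <;> simp [pow_two] <;> ring
  have e1 : A (c * 1) = (c.re : ℂ) • A 1 + (c.im : ℂ) • A I := by rw [hA (c * 1)]; simp
  have eI : A (c * I) = (-c.im : ℂ) • A 1 + (c.re : ℂ) • A I := by rw [hA (c * I)]; simp
  have f1 : ∀ Y, B Y (c * 1) = (c.re : ℂ) • B Y 1 + (c.im : ℂ) • B Y I := fun Y => by
    rw [hB Y (c * 1)]; simp
  have fI : ∀ Y, B Y (c * I) = (-c.im : ℂ) • B Y 1 + (c.re : ℂ) • B Y I := fun Y => by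
    rw [hB Y (c * I)]; simp
  have e1' : (A (c ^ 2 * 1)).trace = (c.re ^ 2 - c.im ^ 2 : ℂ) * (A 1).trace
      + (2 * c.re * c.im : ℂ) * (A I).trace := by
    rw [hA (c ^ 2 * 1), Matrix.trace_add, Matrix.trace_smul, Matrix.trace_smul]
    simp [sq.1, sq.2]
  have eI' : (A (c ^ 2 * I)).trace = -(2 * c.re * c.im : ℂ) * (A 1).trace
      + (c.re ^ 2 - c.im ^ 2 : ℂ) * (A I).trace := by
    rw [hA (c ^ 2 * I), Matrix.trace_add, Matrix.trace_smul, Matrix.trace_smul]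
    simp [sq.1, sq.2]
  have f1' : (B I (c ^ 2 * 1)).trace = (c.re ^ 2 - c.im ^ 2 : ℂ) * (B I 1).trace
      + (2 * c.re * c.im : ℂ) * (B I I).trace := by
    rw [hB I (c ^ 2 * 1), Matrix.trace_add, Matrix.trace_smul, Matrix.trace_smul]
    simp [sq.1, sq.2]
  have fI' : (B 1 (c ^ 2 * I)).trace = -(2 * c.re * c.im : ℂ) * (B 1 1).trace
      + (c.re ^ 2 - c.im ^ 2 : ℂ) * (B 1 I).trace := by
    rw [hB 1 (c ^ 2 * I), Matrix.trace_add, Matrix.trace_smul, Matrix.trace_smul]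
    simp [sq.1, sq.2]
  have tA1 : ((A (c ^ 2 * 1)).trace - (A 1).trace) / 2
      = -c.im ^ 2 * (A 1).trace + c.re * c.im * (A I).trace := by
    rw [e1']
    linear_combination (1 / 2) * (A 1).trace * hc'
  have tAI : ((A (c ^ 2 * I)).trace - (A I).trace) / 2
      = -(c.re * c.im) * (A 1).trace - c.im ^ 2 * (A I).trace := by
    rw [eI']
    linear_combination (1 / 2) * (A I).trace * hc'
  -- The scalar corrections of the block differ by Re c · Im c times the divergence of the trace,
  -- which is zero by harmonicity.
  have tB : ((B I (c ^ 2 * 1)).trace - (B I 1).trace) / 2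
      = ((B 1 (c ^ 2 * I)).trace - (B 1 I).trace) / 2 := by
    rw [f1', fI', htr]
    linear_combination c.re * c.im * hharm
  have g00 := hre 0 0
  have g01 := hre 0 1
  have g10 := hre 1 0
  have g11 := hre 1 1
  have g02 := hre 0 2
  have g12 := hre 1 2
  have t0 := htens 0 (by decide)
  have t1 := htens 1 (by decide)
  simp only [Matrix.add_apply, Matrix.mul_apply, Fin.sum_univ_three, hA22, hA20, hA21, hI20, hI21,
    hr0, hr1] at g00 g01 g10 g11 g02 g12 t0 t1
  have T1 : twistForm A c 1 =
      !![A 1 0 0 + (-c.im ^ 2 * (A 1).trace + c.re * c.im * (A I).trace), A 1 0 1,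
          c.re * A 1 0 2 - c.im * (starRingEnd ℂ) (A 1 1 2);
        A 1 1 0, A 1 1 1 + (-c.im ^ 2 * (A 1).trace + c.re * c.im * (A I).trace),
          c.re * A 1 1 2 + c.im * (starRingEnd ℂ) (A 1 0 2);
        -c.re * (starRingEnd ℂ) (A 1 0 2) + c.im * A 1 1 2,
          -c.re * (starRingEnd ℂ) (A 1 1 2) - c.im * A 1 0 2, 0] := by
    rw [twistForm, tA1, e1, hA22]
    ext i j
    fin_cases i <;> fin_cases j <;> simp [hr0, hr1, hA20, hA21, hI20, hI21] <;> ring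
  have TI : twistForm A c I =
      !![A I 0 0 + (-(c.re * c.im) * (A 1).trace - c.im ^ 2 * (A I).trace), A I 0 1,
          -c.im * A 1 0 2 - c.re * (starRingEnd ℂ) (A 1 1 2);
        A I 1 0, A I 1 1 + (-(c.re * c.im) * (A 1).trace - c.im ^ 2 * (A I).trace),
          -c.im * A 1 1 2 + c.re * (starRingEnd ℂ) (A 1 0 2);
        c.im * (starRingEnd ℂ) (A 1 0 2) + c.re * A 1 1 2,
          c.im * (starRingEnd ℂ) (A 1 1 2) - c.re * A 1 0 2, 0] := by
    rw [twistForm, tAI, eI, hA22]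
    ext i j
    fin_cases i <;> fin_cases j <;> simp [hr0, hr1, hA20, hA21, hI20, hI21] <;> ring
  -- The flatness equation enters with the factor Re c and the tension equation with Im c. The trace
  -- terms of the latter are balanced by the scalar correction of the block.
  have k02 : (twistForm (B I) c 1 + twistForm A c I * twistForm A c 1) 0 2
      = (twistForm (B 1) c I + twistForm A c 1 * twistForm A c I) 0 2 := by
    rw [T1, TI, twistForm, twistForm, f1, fI]
    simp
    linear_combination c.re * g02 + c.im * t0 - c.im * ((A 1).trace * A 1 0 2
      - (A I).trace * (starRingEnd ℂ) (A 1 1 2)) * hc'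
  have k12 : (twistForm (B I) c 1 + twistForm A c I * twistForm A c 1) 1 2
      = (twistForm (B 1) c I + twistForm A c 1 * twistForm A c I) 1 2 := by
    rw [T1, TI, twistForm, twistForm, f1, fI]
    simp
    linear_combination c.re * g12 + c.im * t1 - c.im * ((A 1).trace * A 1 1 2
      + (A I).trace * (starRingEnd ℂ) (A 1 0 2)) * hc'
  -- Both sides are built from skew-Hermitian matrices and their difference is again skew-Hermitian,
  -- so the last row follows from the last column.
  have hskew : ∀ i j, (starRingEnd ℂ)
      ((twistForm (B I) c 1 + twistForm A c I * twistForm A c 1) i j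
        - (twistForm (B 1) c I + twistForm A c 1 * twistForm A c I) i j)
      = -((twistForm (B I) c 1 + twistForm A c I * twistForm A c 1) j i
        - (twistForm (B 1) c I + twistForm A c 1 * twistForm A c I) j i) := by
    have hsA := fun X => star_twistForm hA' c X
    have hsB := fun Y X => star_twistForm (hB' Y) c X
    have key : star ((twistForm (B I) c 1 + twistForm A c I * twistForm A c 1)
        - (twistForm (B 1) c I + twistForm A c 1 * twistForm A c I))
        = -((twistForm (B I) c 1 + twistForm A c I * twistForm A c 1)
        - (twistForm (B 1) c I + twistForm A c 1 * twistForm A c I)) := by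
      simp only [star_sub, star_add, star_mul, hsA, hsB]
      noncomm_ring
    intro i j
    simpa using! congrFun (congrFun key j) i
  have k20 := hskew 0 2
  have k21 := hskew 1 2
  rw [k02, sub_self, map_zero, eq_comm, neg_eq_zero, sub_eq_zero] at k20
  rw [k12, sub_self, map_zero, eq_comm, neg_eq_zero, sub_eq_zero] at k21
  -- In the upper block, the antisymmetrised products of the last column with the last row scale by
  -- |c|² = 1 and are thus unaffected by the twist.
  ext i j
  fin_cases i <;> fin_cases j
  · rw [T1, TI, twistForm, twistForm, tB]
    simp
    linear_combination g00 + ((starRingEnd ℂ) (A 1 0 2) * (starRingEnd ℂ) (A 1 1 2)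
      - A 1 0 2 * A 1 1 2) * hc'
  · rw [T1, TI, twistForm, twistForm]
    simp
    linear_combination g01 + (A 1 0 2 ^ 2 + (starRingEnd ℂ) (A 1 1 2) ^ 2) * hc'
  · exact k02
  · rw [T1, TI, twistForm, twistForm]
    simp
    linear_combination g10 - (A 1 1 2 ^ 2 + (starRingEnd ℂ) (A 1 0 2) ^ 2) * hc'
  · rw [T1, TI, twistForm, twistForm, tB]
    simp
    linear_combination g11 + (A 1 0 2 * A 1 1 2
      - (starRingEnd ℂ) (A 1 0 2) * (starRingEnd ℂ) (A 1 1 2)) * hc'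
  · exact k12
  · exact k20
  · exact k21
  · rw [T1, TI, twistForm, twistForm]
    simp [hB22]
    ring

end HSLagrangian
end

open scoped ContDiff

noncomputable section

namespace HSLagrangian

open Set Filter Topology Complex MeasureTheory

/-! ### Integration of the twisted form in the algebra of loops -/

variable {Ω : Set ℂ}

theorem dMat_twistForm_mc {M : ℂ → Mat3} (hΩ : IsOpen Ω) (hM : SmoothMatOn M Ω) {z : ℂ}
    (hz : z ∈ Ω) (c X Y : ℂ) : dMat (fun w => twistForm (mc M w) c X) z Y
      = twistForm (fun X' => dMat (fun w => mc M w X') z Y) c X := by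
  have hd := fun X' => (hM.mc hΩ X').diffMatAt hΩ hz
  have hd' : ∀ X', DifferentiableAt ℝ (fun w => (mc M w X').trace) z := fun X' =>
    ((contDiffOn_trace (hM.mc hΩ X')).differentiableOn (by simp)).differentiableAt
      (hΩ.mem_nhds hz)
  have key : ∀ i, fderiv ℝ (fun w => mc M w X i i
      + ((mc M w (c ^ 2 * X)).trace - (mc M w X).trace) / 2) z Y
      = fderiv ℝ (fun w => mc M w X i i) z Y + ((dMat (fun w => mc M w (c ^ 2 * X)) z Y).trace
        - (dMat (fun w => mc M w X) z Y).trace) / 2 := by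
    intro i
    rw [← fderiv_trace (hd _), ← fderiv_trace (hd _)]
    have h1 := (hd X i i).hasFDerivAt.fun_add
      (((hd' (c ^ 2 * X)).hasFDerivAt.fun_sub (hd' X).hasFDerivAt).mul_const (2⁻¹ : ℂ))
    simp only [div_eq_mul_inv]
    rw [h1.fderiv]
    simp [mul_comm]
  ext i j
  fin_cases i <;> fin_cases j
  · exact key 0
  · rfl
  · rfl
  · rfl
  · exact key 1
  · rfl
  · rfl
  · rfl
  · rfl

theorem fderiv_angleForm {M : ℂ → Mat3} (hΩ : IsOpen Ω) (hM : SmoothMatOn M Ω) {z : ℂ}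
    (hz : z ∈ Ω) (X Y : ℂ) :
    fderiv ℝ (angleForm M X) z Y = (dMat (fun w => mc M w X) z Y).trace.im := by
  have hd := ((contDiffOn_trace (hM.mc hΩ X)).differentiableOn (by simp)).differentiableAt
    (hΩ.mem_nhds hz)
  rw [← fderiv_trace ((hM.mc hΩ X).diffMatAt hΩ hz)]
  exact DFunLike.congr_fun (imCLM.hasFDerivAt.comp z hd.hasFDerivAt).fderiv Y

theorem dMat_mc_basis {M : ℂ → Mat3} (hΩ : IsOpen Ω) (hM : SmoothMatOn M Ω) {z : ℂ}
    (hz : z ∈ Ω) (Y X : ℂ) : dMat (fun w => mc M w X) z Y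
      = (X.re : ℂ) • dMat (fun w => mc M w 1) z Y + (X.im : ℂ) • dMat (fun w => mc M w I) z Y := by
  have hd := fun X' => (hM.mc hΩ X').diffMatAt hΩ hz
  ext i j
  have h1 := ((hd 1 i j).hasFDerivAt.const_mul (X.re : ℂ)).fun_add
    ((hd I i j).hasFDerivAt.const_mul (X.im : ℂ))
  have e : (fun w => mc M w X i j)
      = fun w => (X.re : ℂ) * mc M w 1 i j + (X.im : ℂ) * mc M w I i j := by
    funext w
    rw [mc_basis]
    rfl
  change fderiv ℝ (fun w => mc M w X i j) z Y = _
  rw [e, h1.fderiv]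
  rfl

theorem IsAdapted.twistForm_mc_flat {M : ℂ → Mat3} (hΩ : IsOpen Ω) (h : IsAdapted Ω M)
    (hh : HarmonicAngle Ω M) {z : ℂ} (hz : z ∈ Ω) {c : ℂ} (hc : c.re ^ 2 + c.im ^ 2 = 1) :
    dMat (fun w => twistForm (mc M w) c 1) z I
        + twistForm (mc M z) c I * twistForm (mc M z) c 1
      = dMat (fun w => twistForm (mc M w) c I) z 1
        + twistForm (mc M z) c 1 * twistForm (mc M z) c I := by
  have hU := h.unitary
  rw [dMat_twistForm_mc hΩ h.smooth hz, dMat_twistForm_mc hΩ h.smooth hz]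
  refine twistForm_flat (B := fun Y X => dMat (fun w => mc M w X) z Y) (mc_basis M z)
    (dMat_mc_basis hΩ h.smooth hz) (conj_mc_apply hΩ h.smooth hU hz)
    (fun Y X => conj_dMat_mc hΩ h.smooth hU hz X Y) (h.horizontal z hz) (fun Y X => ?_)
    (h.rot_zero z hz) (h.rot_one z hz) (mc_flat hΩ h.smooth hU hz) (fun k hk => h.tension hΩ hz hk)
    ?_ hc
  · have e : (fun w => mc M w X 2 2) =ᶠ[𝓝 z] fun _ => 0 :=
      eventually_of_mem (hΩ.mem_nhds hz) fun w hw => h.horizontal w hw X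
    simp only [dMat, Matrix.of_apply]
    rw [e.fderiv_eq]
    simp
  · have hre : ∀ X Y, (dMat (fun w => mc M w X) z Y).trace.re = 0 := fun X Y => by
      have h1 : (starRingEnd ℂ) (dMat (fun w => mc M w X) z Y).trace
          = -(dMat (fun w => mc M w X) z Y).trace := by
        simp only [Matrix.trace, Matrix.diag, map_sum, conj_dMat_mc hΩ h.smooth hU hz X Y,
          Finset.sum_neg_distrib]
      have h2 := congrArg re h1
      simp only [conj_re, neg_re] at h2
      linarith
    have h2 := hh z hz
    rw [fderiv_angleForm hΩ h.smooth hz, fderiv_angleForm hΩ h.smooth hz] at h2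
    apply Complex.ext
    · simp [hre]
    · simpa using h2

/-- By real linearity of A, the dependence on λ separates from that on A: continuous functions of λ
multiply entries and traces of A(1) and A(i). This makes z ↦ A_λ smooth into the space of loops. -/
theorem exists_twistForm_coeff (X : ℂ) (i j : Fin 3) : ∃ e₁ e₂ e₃ e₄ : C(Circle, ℂ),
    ∀ A : ℂ → Mat3, (∀ X, A X = (X.re : ℂ) • A 1 + (X.im : ℂ) • A I) → ∀ l : Circle,
      twistForm A (l : ℂ)⁻¹ X i j = A 1 i j * e₁ l + A I i j * e₂ l + (A 1).trace * e₃ l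
        + (A I).trace * e₄ l := by
  have hinv : Continuous fun l : Circle => (l : ℂ)⁻¹ := by
    simpa using continuous_circle_zpow (-1)
  have hre : ∀ n : ℕ, Continuous fun l : Circle => ((((l : ℂ)⁻¹ ^ n * X).re : ℝ) : ℂ) := fun n =>
    continuous_ofReal.comp (continuous_re.comp ((hinv.pow n).mul continuous_const))
  have him : ∀ n : ℕ, Continuous fun l : Circle => ((((l : ℂ)⁻¹ ^ n * X).im : ℝ) : ℂ) := fun n =>
    continuous_ofReal.comp (continuous_im.comp ((hinv.pow n).mul continuous_const))
  let r : ℕ → C(Circle, ℂ) := fun n => ⟨_, hre n⟩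
  let s : ℕ → C(Circle, ℂ) := fun n => ⟨_, him n⟩
  have hr : ∀ n (l : Circle), r n l = ((((l : ℂ)⁻¹ ^ n * X).re : ℝ) : ℂ) := fun _ _ => rfl
  have hs : ∀ n (l : Circle), s n l = ((((l : ℂ)⁻¹ ^ n * X).im : ℝ) : ℂ) := fun _ _ => rfl
  have exp1 : ∀ A : ℂ → Mat3, (∀ X, A X = (X.re : ℂ) • A 1 + (X.im : ℂ) • A I) → ∀ n (l : Circle),
      A ((l : ℂ)⁻¹ ^ n * X) i j = A 1 i j * r n l + A I i j * s n l := by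
    intro A hA n l
    rw [hA, hr, hs]
    simp [mul_comm]
  have exp2 : ∀ A : ℂ → Mat3, (∀ X, A X = (X.re : ℂ) • A 1 + (X.im : ℂ) • A I) → ∀ n (l : Circle),
      (A ((l : ℂ)⁻¹ ^ n * X)).trace = (A 1).trace * r n l + (A I).trace * s n l := by
    intro A hA n l
    rw [hA, hr, hs, Matrix.trace_add, Matrix.trace_smul, Matrix.trace_smul]
    simp [mul_comm]
  have off : ∀ n : ℕ, (∀ A : ℂ → Mat3, ∀ l : Circle,
      twistForm A (l : ℂ)⁻¹ X i j = A ((l : ℂ)⁻¹ ^ n * X) i j) →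
      ∃ e₁ e₂ e₃ e₄ : C(Circle, ℂ),
        ∀ A : ℂ → Mat3, (∀ X, A X = (X.re : ℂ) • A 1 + (X.im : ℂ) • A I) → ∀ l : Circle,
        twistForm A (l : ℂ)⁻¹ X i j = A 1 i j * e₁ l + A I i j * e₂ l + (A 1).trace * e₃ l
          + (A I).trace * e₄ l := fun n hn => by
    refine ⟨r n, s n, 0, 0, fun A hA l => ?_⟩
    rw [hn, exp1 A hA]
    simp
  have dia : (∀ A : ℂ → Mat3, ∀ l : Circle, twistForm A (l : ℂ)⁻¹ X i j
      = A X i j + ((A ((l : ℂ)⁻¹ ^ 2 * X)).trace - (A X).trace) / 2) →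
      ∃ e₁ e₂ e₃ e₄ : C(Circle, ℂ),
        ∀ A : ℂ → Mat3, (∀ X, A X = (X.re : ℂ) • A 1 + (X.im : ℂ) • A I) → ∀ l : Circle,
        twistForm A (l : ℂ)⁻¹ X i j = A 1 i j * e₁ l + A I i j * e₂ l + (A 1).trace * e₃ l
          + (A I).trace * e₄ l := fun hn => by
    refine ⟨r 0, s 0, (1 / 2 : ℂ) • (r 2 - r 0), (1 / 2 : ℂ) • (s 2 - s 0), fun A hA l => ?_⟩
    have h0 := exp1 A hA 0 l
    have h0' := exp2 A hA 0 l
    simp only [pow_zero, one_mul] at h0 h0'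
    rw [hn, exp2 A hA, h0, h0']
    simp
    ring
  fin_cases i <;> fin_cases j
  · exact dia fun _ _ => rfl
  · exact off 0 fun A l => by simp [twistForm]
  · exact off 1 fun A l => by simp [twistForm]
  · exact off 0 fun A l => by simp [twistForm]
  · exact dia fun _ _ => rfl
  · exact off 1 fun A l => by simp [twistForm]
  · exact off 1 fun A l => by simp [twistForm]
  · exact off 1 fun A l => by simp [twistForm]
  · exact off 0 fun A l => by simp [twistForm]

section loops

open scoped Matrix.Norms.Operator

/-- Matrices of continuous loops. -/
abbrev LoopMat := Matrix (Fin 3) (Fin 3) C(Circle, ℂ)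

/-- The uniform structure of the operator norm unfolds to the entrywise one, so completeness comes
from that of the space of continuous functions. -/
theorem completeSpace_loopMat :
    @CompleteSpace LoopMat NormedRing.toMetricSpace.toPseudoMetricSpace.toUniformSpace :=
  Matrix.instCompleteSpace (Fin 3) (Fin 3) C(Circle, ℂ)

/-- The entries of a matrix of loops, at the point `l`. -/
def loopEval (l : Circle) (Φ : LoopMat) : Mat3 := Matrix.of fun i j => Φ i j l

theorem loopEval_mul (l : Circle) (Φ Ψ : LoopMat) :
    loopEval l (Φ * Ψ) = loopEval l Φ * loopEval l Ψ := by
  ext i j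
  simp [loopEval, Matrix.mul_apply]

theorem loopEval_add (l : Circle) (Φ Ψ : LoopMat) :
    loopEval l (Φ + Ψ) = loopEval l Φ + loopEval l Ψ := rfl

theorem loopEval_one (l : Circle) : loopEval l 1 = 1 := by
  ext i j
  simp only [loopEval, Matrix.of_apply, Matrix.one_apply]
  split_ifs <;> rfl

theorem ext_loopEval {Φ Ψ : LoopMat} (h : ∀ l, loopEval l Φ = loopEval l Ψ) : Φ = Ψ := by
  ext i j l
  exact congrFun (congrFun (h l) i) j

/-- The `(i, j)` entry of a matrix of loops. -/
def entryCLM (i j : Fin 3) : LoopMat →L[ℝ] C(Circle, ℂ) :=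
  ⟨Matrix.entryLinearMap ℝ C(Circle, ℂ) i j, Continuous.matrix_elem continuous_id i j⟩

theorem DifferentiableAt.loopEval {Φ : ℂ → LoopMat} {z : ℂ} (h : DifferentiableAt ℝ Φ z)
    (l : Circle) : DiffMatAt (fun w => loopEval l (Φ w)) z := fun i j =>
  (((ContinuousMap.evalCLM ℝ l : C(Circle, ℂ) →L[ℝ] ℂ).comp (entryCLM i j)).hasFDerivAt.comp z
    h.hasFDerivAt).differentiableAt

theorem dMat_loopEval {Φ : ℂ → LoopMat} {z : ℂ} (h : DifferentiableAt ℝ Φ z) (l : Circle) (X : ℂ) :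
    dMat (fun w => loopEval l (Φ w)) z X = loopEval l (fderiv ℝ Φ z X) := by
  ext i j
  exact DFunLike.congr_fun (((ContinuousMap.evalCLM ℝ l : C(Circle, ℂ) →L[ℝ] ℂ).comp
    (entryCLM i j)).hasFDerivAt.comp z h.hasFDerivAt).fderiv X

theorem contDiffOn_loopMat {Φ : ℂ → LoopMat} (h : ∀ i j, ContDiffOn ℝ ∞ (fun z => Φ z i j) Ω) :
    ContDiffOn ℝ ∞ Φ Ω := by
  let T : (Fin 3 → Fin 3 → C(Circle, ℂ)) →L[ℝ] LoopMat :=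
    ⟨(Matrix.ofLinearEquiv ℝ).toLinearMap, continuous_id⟩
  exact T.contDiff.comp_contDiffOn (contDiffOn_pi.2 fun i => contDiffOn_pi.2 fun j => h i j)

theorem IsAdapted.exists_loopForm {M : ℂ → Mat3} (hΩ : IsOpen Ω) (h : IsAdapted Ω M) (X : ℂ) :
    ∃ a : ℂ → LoopMat, ContDiffOn ℝ ∞ a Ω ∧
      ∀ l z, loopEval l (a z) = twistForm (mc M z) (l : ℂ)⁻¹ X := by
  choose e₁ e₂ e₃ e₄ he using fun i j => exists_twistForm_coeff X i j
  refine ⟨fun z => Matrix.of fun i j => mc M z 1 i j • e₁ i j + mc M z I i j • e₂ i j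
    + (mc M z 1).trace • e₃ i j + (mc M z I).trace • e₄ i j,
    contDiffOn_loopMat fun i j => ?_, fun l z => ?_⟩
  · have hs : ∀ (f : ℂ → ℂ) (e : C(Circle, ℂ)), ContDiffOn ℝ ∞ f Ω →
        ContDiffOn ℝ ∞ (fun z => f z • e) Ω := fun f e hf => hf.smul contDiffOn_const
    exact (((hs _ _ (h.smooth.mc hΩ 1 i j)).add (hs _ _ (h.smooth.mc hΩ I i j))).add
      (hs _ _ (contDiffOn_trace (h.smooth.mc hΩ 1)))).add
      (hs _ _ (contDiffOn_trace (h.smooth.mc hΩ I)))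
  · ext i j
    rw [he i j (mc M z) (mc_basis M z)]
    simp [loopEval]

theorem circle_inv_re_sq_add_im_sq (l : Circle) : ((l : ℂ)⁻¹).re ^ 2 + ((l : ℂ)⁻¹).im ^ 2 = 1 := by
  have : normSq (l : ℂ)⁻¹ = 1 := by simp
  rw [normSq_apply] at this
  linarith

/-- The solution of `dΦ = Φ A_λ` with values in the loops. -/
theorem IsAdapted.exists_loop_solution {M : ℂ → Mat3} (hΩ : IsOpen Ω) [SimplyConnectedSpace Ω]
    (h : IsAdapted Ω M) (hh : HarmonicAngle Ω M) (z₀ : Ω) :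
    ∃ Φ : ℂ → LoopMat, (∀ i j, ContDiffOn ℝ ∞ (fun z => Φ z i j) Ω) ∧ Φ z₀ = 1 ∧
      ∀ l, ∀ z ∈ Ω, DiffMatAt (fun w => loopEval l (Φ w)) z ∧ ∀ X,
        dMat (fun w => loopEval l (Φ w)) z X
          = loopEval l (Φ z) * twistForm (mc M z) (l : ℂ)⁻¹ X := by
  have := completeSpace_loopMat
  obtain ⟨a₁, ha₁, e₁⟩ := h.exists_loopForm hΩ 1
  obtain ⟨a₂, ha₂, e₂⟩ := h.exists_loopForm hΩ I
  have hd : ∀ {a : ℂ → LoopMat}, ContDiffOn ℝ ∞ a Ω → ∀ {z}, z ∈ Ω →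
      DifferentiableAt ℝ a z := fun ha z hz =>
    (ha.differentiableOn (by simp)).differentiableAt (hΩ.mem_nhds hz)
  -- Flatness in the algebra of loops is verified after evaluation at each λ, where |λ⁻¹| = 1.
  obtain ⟨Φ, h0, hΦ⟩ := exists_solution hΩ ha₁ ha₂ (fun z hz => ext_loopEval fun l => by
    rw [loopEval_add, loopEval_add, loopEval_mul, loopEval_mul]
    refine (congrArg (· + _) (dMat_loopEval (hd ha₁ hz) l I).symm).trans
      (Eq.trans ?_ (congrArg (· + _) (dMat_loopEval (hd ha₂ hz) l 1)))
    simp only [e₁, e₂]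
    exact h.twistForm_mc_flat hΩ hh hz (circle_inv_re_sq_add_im_sq l)) z₀
  have hΦs := contDiffOn_of_solvesAt hΩ ha₁ ha₂ hΦ
  refine ⟨Φ, fun i j => (entryCLM i j).contDiff.comp_contDiffOn hΦs, h0, fun l z hz =>
    ⟨DifferentiableAt.loopEval (hd hΦs hz) l, fun X => ?_⟩⟩
  have hΦ' : ∀ X, fderiv ℝ Φ z X = X.re • (Φ z * a₁ z) + X.im • (Φ z * a₂ z) := fun X =>
    DFunLike.congr_fun (HasFDerivAt.fderiv (hΦ z hz)) X
  have key : ∀ c X, twistForm (mc M z) c X = (X.re : ℂ) • twistForm (mc M z) c 1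
      + (X.im : ℂ) • twistForm (mc M z) c I := by
    intro c X
    have h1 : ∀ c, mc M z (c * X) = (X.re : ℂ) • mc M z (c * 1) + (X.im : ℂ) • mc M z (c * I) := by
      intro c
      rw [mc_basis M z (c * X), mc_basis M z (c * 1), mc_basis M z (c * I)]
      ext i j
      simp
      ring
    have h2 := h1 1
    rw [one_mul, one_mul, one_mul] at h2
    ext i j
    fin_cases i <;> fin_cases j <;> simp [twistForm, h1, h2, -mul_one] <;> ring
  rw [key, dMat_basis, mul_add, Matrix.mul_smul, Matrix.mul_smul, dMat_loopEval (hd hΦs hz),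
    dMat_loopEval (hd hΦs hz), hΦ', hΦ', ← e₁, ← e₂, ← loopEval_mul,
    ← loopEval_mul]
  simp

end loops

end HSLagrangian
end

open scoped ContDiff

noncomputable section

namespace HSLagrangian

open Set Filter Topology Complex MeasureTheory

/-! ### The extended framing of an adapted frame with harmonic angle -/

variable {Ω : Set ℂ}

theorem isPreconnected_of_simplyConnectedSpace [SimplyConnectedSpace Ω] : IsPreconnected Ω :=
  isPreconnected_iff_preconnectedSpace.mpr inferInstance

/-- The derivative of NN† is N(T + T†)N† = 0 when T is skew-Hermitian. -/
theorem unitaryOn_of_dMat_eq {N : ℂ → Mat3} {T : ℂ → ℂ → Mat3} (hΩ : IsOpen Ω)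
    (hc : IsPreconnected Ω) (hd : ∀ z ∈ Ω, DiffMatAt N z)
    (h : ∀ z ∈ Ω, ∀ X, dMat N z X = N z * T z X) (hT : ∀ z ∈ Ω, ∀ X, star (T z X) = -T z X)
    {z₀ : ℂ} (hz₀ : z₀ ∈ Ω) (h₀ : N z₀ = 1) : UnitaryOn N Ω := by
  intro z hz
  have hconst : N z * star (N z) = N z₀ * star (N z₀) := by
    ext i j
    refine hΩ.is_const_of_fderiv_eq_zero (𝕜 := ℝ) hc
      (f := fun w => (N w * star (N w)) i j) (fun w hw => ?_) (fun w hw => ?_) hz hz₀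
    · exact (((hd w hw).mul (hd w hw).star) i j).differentiableWithinAt
    · ext X
      have : dMat (fun w => N w * star (N w)) w X = 0 := by
        rw [dMat_mul (hd w hw) (hd w hw).star, dMat_star (hd w hw), h w hw, star_mul, hT w hw]
        noncomm_ring
      exact congrFun (congrFun this i) j
  rw [h₀, star_one, mul_one] at hconst
  exact mul_eq_one_comm.mp hconst

/-- The adaptedness relations say that rotating X by -i conjugates the last column and applies J to
it. The trace is imaginary, so conjugation changes its sign, in agreement with (-i)² = -1. This is
the twisting condition at the level of forms. -/
theorem IsAdapted.conjTwist_twistForm {M : ℂ → Mat3} (hΩ : IsOpen Ω) (h : IsAdapted Ω M) {z : ℂ}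
    (hz : z ∈ Ω) (c X : ℂ) :
    conjTwist (twistForm (mc M z) c X) = twistForm (mc M z) (-I * c) X := by
  have hA' := conj_mc_apply hΩ h.smooth h.unitary hz
  have h22 := h.horizontal z hz
  have htr : ∀ Y, (mc M z Y).trace = mc M z Y 0 0 + mc M z Y 1 1 := fun Y => by
    rw [Matrix.trace_fin_three, h22, add_zero]
  have e2 : (-I * c) ^ 2 * X = -(c ^ 2 * X) := by
    linear_combination (c ^ 2 * X) * I_sq
  have key : ∀ Y, mc M z (-I * Y) 0 2 = (starRingEnd ℂ) (mc M z Y 1 2) ∧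
      mc M z (-I * Y) 1 2 = -(starRingEnd ℂ) (mc M z Y 0 2) := by
    intro Y
    rw [mc_basis M z (-I * Y), mc_basis M z Y]
    simp [h.rot_zero z hz, h.rot_one z hz]
    ring
  have e1 : -I * c * X = -I * (c * X) := by ring
  have r0 : mc M z (-I * (c * X)) 2 0 = -(starRingEnd ℂ) (mc M z (-I * (c * X)) 0 2) := by
    rw [hA', neg_neg]
  have r1 : mc M z (-I * (c * X)) 2 1 = -(starRingEnd ℂ) (mc M z (-I * (c * X)) 1 2) := by
    rw [hA', neg_neg]
  rw [conjTwist_eq]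
  simp only [twistForm, e2, e1, mc_neg, r0, r1, (key (c * X)).1, (key (c * X)).2]
  ext i j
  fin_cases i <;> fin_cases j <;> simp [hA', htr, h22, map_ofNat] <;> ring

/-- Writing Re and Im through λ⁻¹X and its conjugate λ conj X separates the degrees. Only the
coefficients of degrees -2 and -1 are constrained in `IsExtendedFraming`, so the others are left
unspecified. -/
theorem twistForm_eq_laurent {A : ℂ → Mat3} (hA : ∀ X, A X = (X.re : ℂ) • A 1 + (X.im : ℂ) • A I)
    (X : ℂ) (i j : Fin 3) : ∃ c₀ c₁ c₂ : ℂ, ∀ l : Circle, twistForm A (l : ℂ)⁻¹ X i j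
      = laurent (((-(I / 4) * ((A 1).trace - I * (A I).trace) * X)
            • Matrix.diagonal ![I, I, 0] : Mat3) i j)
          (X * !![0, 0, (A 1 0 2 - I * A I 0 2) / 2; 0, 0, (A 1 1 2 - I * A I 1 2) / 2;
            (A 1 2 0 - I * A I 2 0) / 2, (A 1 2 1 - I * A I 2 1) / 2, 0] i j) c₀ c₁ c₂ l := by
  have hre : ∀ Y : ℂ, (Y.re : ℂ) = (Y + (starRingEnd ℂ) Y) / 2 := fun Y => by
    rw [add_conj]; push_cast; ring
  have him : ∀ Y : ℂ, (Y.im : ℂ) = -(I / 2) * (Y - (starRingEnd ℂ) Y) := fun Y => by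
    rw [sub_conj]; push_cast; linear_combination (Y.im : ℂ) * I_sq
  have hl : ∀ l : Circle, (starRingEnd ℂ) (l : ℂ)⁻¹ = (l : ℂ) := fun l => by
    rw [← Circle.coe_inv, ← Circle.coe_inv_eq_conj, inv_inv]
  have lin : ∀ i j (l : Circle), A ((l : ℂ)⁻¹ * X) i j
      = X * ((A 1 i j - I * A I i j) / 2) * (l : ℂ)⁻¹
        + (starRingEnd ℂ) X * ((A 1 i j + I * A I i j) / 2) * l := fun i j l => by
    rw [hA, Matrix.add_apply, Matrix.smul_apply, Matrix.smul_apply, smul_eq_mul, smul_eq_mul, hre,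
      him, map_mul, hl]
    ring
  have tr : ∀ (l : Circle), (A ((l : ℂ)⁻¹ ^ 2 * X)).trace
      = X * (((A 1).trace - I * (A I).trace) / 2) * (l : ℂ)⁻¹ ^ 2
        + (starRingEnd ℂ) X * (((A 1).trace + I * (A I).trace) / 2) * (l : ℂ) ^ 2 := fun l => by
    rw [hA, Matrix.trace_add, Matrix.trace_smul, Matrix.trace_smul, smul_eq_mul, smul_eq_mul, hre,
      him, map_mul, map_pow, hl]
    ring
  have off : ∀ i j, (∀ l : Circle, twistForm A (l : ℂ)⁻¹ X i j = A ((l : ℂ)⁻¹ * X) i j) →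
      ∃ c₀ c₁ c₂ : ℂ, ∀ l : Circle, twistForm A (l : ℂ)⁻¹ X i j
        = laurent 0 (X * ((A 1 i j - I * A I i j) / 2)) c₀ c₁ c₂ l := fun i j hn =>
    ⟨0, (starRingEnd ℂ) X * ((A 1 i j + I * A I i j) / 2), 0, fun l => by
      rw [hn, lin]
      simp [laurent]⟩
  have cst : ∀ i j, (∀ l : Circle, twistForm A (l : ℂ)⁻¹ X i j = A X i j) →
      ∃ c₀ c₁ c₂ : ℂ, ∀ l : Circle, twistForm A (l : ℂ)⁻¹ X i j
        = laurent 0 0 c₀ c₁ c₂ l := fun i j hn =>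
    ⟨A X i j, 0, 0, fun l => by
      rw [hn]
      simp [laurent]⟩
  have dia : ∀ i, (∀ l : Circle, twistForm A (l : ℂ)⁻¹ X i i
      = A X i i + ((A ((l : ℂ)⁻¹ ^ 2 * X)).trace - (A X).trace) / 2) →
      ∃ c₀ c₁ c₂ : ℂ, ∀ l : Circle, twistForm A (l : ℂ)⁻¹ X i i
        = laurent (-(I / 4) * ((A 1).trace - I * (A I).trace) * X * I) 0 c₀ c₁ c₂ l := fun i hn =>
    ⟨A X i i - (A X).trace / 2, 0, (starRingEnd ℂ) X * (((A 1).trace + I * (A I).trace) / 2) / 2,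
      fun l => by
      rw [hn, tr]
      have h2 : (l : ℂ) ^ (2 : ℤ) = (l : ℂ) ^ 2 := zpow_ofNat _ 2
      simp only [laurent, zpow_neg, h2, ← inv_pow, zpow_zero]
      linear_combination ((1 / 4) * ((A 1).trace - I * (A I).trace) * X * (l : ℂ)⁻¹ ^ 2) * I_sq⟩
  fin_cases i <;> fin_cases j
  · simpa using dia 0 fun _ => rfl
  · simpa using cst 0 1 fun _ => rfl
  · simpa using off 0 2 fun _ => rfl
  · simpa using cst 1 0 fun _ => rfl
  · simpa using dia 1 fun _ => rfl
  · simpa using off 1 2 fun _ => rfl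
  · simpa using off 2 0 fun _ => rfl
  · simpa using off 2 1 fun _ => rfl
  · simpa using cst 2 2 fun _ => rfl

/-- The solution of dΦ = ΦA_λ in the algebra of loops inherits its properties from the form:
skew-Hermitian gives unitary, the symmetry of the form gives the twisting condition, and the degrees
of the form give the Fourier conditions. At λ = 1 it has the same form and base value as f. -/
theorem IsAdapted.exists_extendedFraming (hΩ : IsOpen Ω) [SimplyConnectedSpace Ω] {f : Ω → U3}
    (h : IsAdapted Ω (matField f)) (hh : HarmonicAngle Ω (matField f)) {z₀ : Ω} (h₀ : f z₀ = 1) :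
    ∃ F : Ω → twistedLoopGroup, IsExtendedFraming z₀ F ∧ atParam F 1 = f := by
  have hcon : IsPreconnected Ω := isPreconnected_of_simplyConnectedSpace
  obtain ⟨Φ, hΦs, hΦ0, hΦ⟩ := h.exists_loop_solution hΩ hh z₀
  have hskew : ∀ c, ∀ z ∈ Ω, ∀ X, star (twistForm (mc (matField f) z) c X)
      = -twistForm (mc (matField f) z) c X := fun c z hz X =>
    star_twistForm (conj_mc_apply hΩ h.smooth h.unitary hz) c X
  have hd := fun l z hz => (hΦ l z hz).1
  have hN0 : ∀ l, loopEval l (Φ z₀) = 1 := fun l => by rw [hΦ0, loopEval_one]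
  have hU : ∀ l, UnitaryOn (fun w => loopEval l (Φ w)) Ω := fun l =>
    unitaryOn_of_dMat_eq hΩ hcon (hd l) (fun z hz => (hΦ l z hz).2) (hskew _) z₀.2 (hN0 l)
  have hmc : ∀ l, ∀ z ∈ Ω, ∀ X, mc (fun w => loopEval l (Φ w)) z X
      = twistForm (mc (matField f) z) (l : ℂ)⁻¹ X := fun l z hz X => by
    rw [mc, (hΦ l z hz).2, ← mul_assoc, hU l z hz, one_mul]
  -- Both sides are unitary, equal 1 at z₀, and have the same Maurer–Cartan form because (iλ)⁻¹ =
  -- -iλ⁻¹.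
  have htw : ∀ l, ∀ z ∈ Ω, loopEval (circleI * l) (Φ z) = conjTwist (loopEval l (Φ z)) := by
    intro l z hz
    refine eq_of_mc_eq hΩ hcon (hd _) (fun w hw => (hd l w hw).conjTwist) (hU _) (fun w hw => ?_)
      (fun w hw X => ?_) z₀.2 ?_ hz
    · rw [← conjTwist_star, ← conjTwist_mul, hU l w hw, conjTwist_one]
    · rw [mc_conjTwist (hd l w hw), hmc _ w hw, hmc _ w hw, h.conjTwist_twistForm hΩ hw]
      congr 1
      have hI : ((circleI : Circle) : ℂ) = I := rfl
      rw [Circle.coe_mul, hI, mul_inv, inv_I]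
    · rw [hN0, hN0, conjTwist_one]
  have hmem : ∀ l (z : Ω), loopEval l (Φ z) ∈ Matrix.unitaryGroup (Fin 3) ℂ := fun l z =>
    Matrix.mem_unitaryGroup_iff'.mpr (hU l z z.2)
  have hcont : ∀ z : Ω, Continuous fun l => (⟨loopEval l (Φ z), hmem l z⟩ : U3) := fun z =>
    Continuous.subtype_mk (continuous_matrix fun i j => (Φ z i j).continuous) _
  let F : Ω → twistedLoopGroup := fun z => ⟨⟨fun l => ⟨loopEval l (Φ z), hmem l z⟩, hcont z⟩, by
    intro l
    change tau (loopEval l (Φ z)) = loopEval (circleI * l) (Φ z)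
    rw [htw l z z.2, tau_eq_conjTwist ((hU l).mul_star z.2)]⟩
  have hF : ∀ l, ∀ z ∈ Ω, matField (atParam F l) z = loopEval l (Φ z) := fun l z hz => by
    rw [matField_apply _ hz]
    rfl
  have hFmc : ∀ l (z : Ω) X, maurerCartan F l z X
      = twistForm (mc (matField f) z) (l : ℂ)⁻¹ X := fun l z X => by
    rw [maurerCartan_eq_mc, ← hmc l z z.2, mc, mc, hF l z z.2, dMat_congr_on hΩ (hF l) z.2]
  have hmode : ∀ k (z : Ω) X i j, fourierMode F k z X i j
      = circleCoeff (fun l => twistForm (mc (matField f) z) (l : ℂ)⁻¹ X i j) k := by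
    intro k z X i j
    simp only [fourierMode, circleCoeff, Matrix.of_apply, hFmc]
  have hlow : ∀ k (z : Ω) X i j, k ≤ -1 → fourierMode F k z X i j
      = (if k = -2 then ((-(I / 4) * ((mc (matField f) z 1).trace - I * (mc (matField f) z I).trace)
          * X) • Matrix.diagonal ![I, I, 0] : Mat3) i j else 0)
        + (if k = -1 then X * !![0, 0, (mc (matField f) z 1 0 2 - I * mc (matField f) z I 0 2) / 2;
            0, 0, (mc (matField f) z 1 1 2 - I * mc (matField f) z I 1 2) / 2;
            (mc (matField f) z 1 2 0 - I * mc (matField f) z I 2 0) / 2,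
            (mc (matField f) z 1 2 1 - I * mc (matField f) z I 2 1) / 2, 0] i j else 0) := by
    intro k z X i j hk
    obtain ⟨c₀, c₁, c₂, hc⟩ := twistForm_eq_laurent (mc_basis (matField f) z) X i j
    rw [hmode, funext hc]
    change circleCoeff (laurent _ _ _ _ _) k = _
    rw [circleCoeff_laurent, if_neg (by omega : ¬ k = 0), if_neg (by omega : ¬ k = 1),
      if_neg (by omega : ¬ k = 2)]
    simp only [add_zero]
  refine ⟨F, ⟨fun i j => (hΦs i j).congr fun z hz => ?_, ?_, fun k hk z X => ?_,
    ⟨fun z => -(I / 4) * ((mc (matField f) z 1).trace - I * (mc (matField f) z I).trace),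
      ?_, fun z X => ?_⟩, fun z => ?_, fun z hz => ?_⟩, ?_⟩
  · rw [zeroExt_apply _ hz]
    rfl
  · refine Subtype.ext (ContinuousMap.ext fun l => Subtype.ext ?_)
    exact hN0 l
  · ext i j
    rw [hlow k z X i j (by omega), if_neg (by omega), if_neg (by omega)]
    simp
  · exact contDiffOn_const.mul ((contDiffOn_trace (h.smooth.mc hΩ 1)).sub
      (contDiffOn_const.mul (contDiffOn_trace (h.smooth.mc hΩ I))))
  · ext i j
    rw [hlow (-2) z X i j (by omega)]
    simp
  · ext i j
    simp only [fourierModeDzbar, Matrix.smul_apply, Matrix.add_apply]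
    rw [hlow (-1) z 1 i j (by omega), hlow (-1) z I i j (by omega)]
    simp only [smul_eq_mul, if_neg (by omega : ¬ (-1 : ℤ) = -2), if_true, zero_add,
      Matrix.zero_apply, ← mul_assoc, I_mul_I]
    ring
  -- If the dz-part of the last column vanishes, then with the adaptedness relations A₁₃(∂x) = -i
  -- conj A₂₃(∂x) and A₂₃(∂x) = i conj A₁₃(∂x). Both entries are then zero, against the positivity
  -- of the conformal factor.
  · have key : ∀ k, (mc (matField f) z 1 k 2 - I * mc (matField f) z I k 2) / 2 = 0 ∨ k = 2 := by
      intro k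
      have h1 := congrFun (congrFun hz k) 2
      simp only [fourierModeDz, Matrix.smul_apply, Matrix.sub_apply] at h1
      rw [hlow (-1) z 1 k 2 (by omega), hlow (-1) z I k 2 (by omega)] at h1
      simp only [smul_eq_mul, if_neg (by omega : ¬ (-1 : ℤ) = -2), if_true, zero_add,
        Matrix.zero_apply, ← mul_assoc, I_mul_I] at h1
      have fin : ∀ x : ℂ, 1 / 2 * (1 * x - -1 * x) = 0 → x = 0 := fun x hx => by
        linear_combination hx
      fin_cases k
      · exact Or.inl (fin _ h1)
      · exact Or.inl (fin _ h1)
      · exact Or.inr rfl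
    have k0 := (key 0).resolve_right (by decide)
    have k1 := (key 1).resolve_right (by decide)
    rw [h.rot_zero z z.2] at k0
    rw [h.rot_one z z.2] at k1
    replace k0 : mc (matField f) z 1 0 2 + I * (starRingEnd ℂ) (mc (matField f) z 1 1 2) = 0 := by
      linear_combination 2 * k0
    have k0' := congrArg (starRingEnd ℂ) k0
    simp only [map_add, map_mul, conj_I, conj_conj, map_zero] at k0'
    have hq : mc (matField f) z 1 1 2 = 0 := by
      linear_combination k1 + (I / 2) * k0' + (mc (matField f) z 1 1 2 / 2) * I_sq
    have hp : mc (matField f) z 1 0 2 = 0 := by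
      simpa [hq] using k0
    have := h.nondeg z z.2
    rw [confFactor, hp, hq] at this
    simp at this
  · funext z
    refine Subtype.ext ?_
    change loopEval 1 (Φ z) = _
    rw [← matField_apply f z.2]
    refine eq_of_mc_eq hΩ hcon (hd 1) (fun w hw => h.smooth.diffMatAt hΩ hw) (hU 1)
      h.unitary (fun w hw X => ?_) z₀.2 ?_ z.2
    · rw [hmc 1 w hw, Circle.coe_one, inv_one, twistForm_one]
    · rw [hN0, matField_apply f z₀.2, h₀]
      rfl

end HSLagrangian
end

/-! ### Horizontal lifts and frames of Lagrangian immersions. -/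

open scoped ContDiff

noncomputable section

namespace HSLagrangian

open Set Filter Topology Complex MeasureTheory

/-! ### Horizontal lifts -/

theorem star_star_dotProduct (v w : Fin 3 → ℂ) :
    (starRingEnd ℂ) (star v ⬝ᵥ w) = star w ⬝ᵥ v := by
  simp [dotProduct, mul_comm]

theorem star_dotProduct_fderiv {v w : ℂ → Fin 3 → ℂ} {z : ℂ} (hv : DifferentiableAt ℝ v z)
    (hw : DifferentiableAt ℝ w z) : HasFDerivAt (fun z => star (v z) ⬝ᵥ w z)
      (fderiv ℝ (fun z => star (v z) ⬝ᵥ w z) z) z ∧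
    ∀ X, fderiv ℝ (fun z => star (v z) ⬝ᵥ w z) z X
      = star (fderiv ℝ v z X) ⬝ᵥ w z + star (v z) ⬝ᵥ fderiv ℝ w z X := by
  have hvi := fun i => hasFDerivAt_pi'.mp hv.hasFDerivAt i
  have hwi := fun i => hasFDerivAt_pi'.mp hw.hasFDerivAt i
  have h := HasFDerivAt.fun_sum (u := Finset.univ) fun (i : Fin 3) _ =>
    (conjCLE.hasFDerivAt.comp z (hvi i)).mul (hwi i)
  have h' : HasFDerivAt (fun z => star (v z) ⬝ᵥ w z) _ z := h
  refine ⟨h'.differentiableAt.hasFDerivAt, fun X => ?_⟩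
  rw [h'.fderiv]
  simp [dotProduct, Finset.sum_add_distrib, mul_comm, add_comm]

theorem fderiv_smul_vec {g : ℂ → ℂ} {v : ℂ → Fin 3 → ℂ} {z : ℂ} (hg : DifferentiableAt ℝ g z)
    (hv : DifferentiableAt ℝ v z) (X : ℂ) :
    fderiv ℝ (fun z => g z • v z) z X = fderiv ℝ g z X • v z + g z • fderiv ℝ v z X := by
  rw [fderiv_fun_smul hg hv]
  simp [add_comm]

theorem trace_vecMulVec_tangent {v x y : Fin 3 → ℂ} (hv : star v ⬝ᵥ v = 1) :
    (Matrix.vecMulVec v (star v) * (Matrix.vecMulVec x (star v) + Matrix.vecMulVec v (star x))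
      * (Matrix.vecMulVec y (star v) + Matrix.vecMulVec v (star y))).trace
    = star x ⬝ᵥ y + (star v ⬝ᵥ x) * (star v ⬝ᵥ y) + (star v ⬝ᵥ x) * (star y ⬝ᵥ v)
      + (star x ⬝ᵥ v) * (star y ⬝ᵥ v) := by
  simp only [mul_add, add_mul, Matrix.vecMulVec_mul_vecMulVec, Matrix.trace_add,
    Matrix.trace_vecMulVec, Matrix.vecMulVec_smul,
    Matrix.smul_mul, Matrix.trace_smul, hv, smul_eq_mul, dotProduct_comm v]
  ring

/-- A smooth unit vector field on `V` that spans the lines of the projectors `P`. -/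
structure IsUnitLift (V : Set ℂ) (P : ℂ → Mat3) (v : ℂ → Fin 3 → ℂ) : Prop where
  smooth : ContDiffOn ℝ ∞ v V
  unit : ∀ z ∈ V, star (v z) ⬝ᵥ v z = 1
  proj : ∀ z ∈ V, P z = Matrix.vecMulVec (v z) (star (v z))

/-- A smooth unit lift that is orthogonal to its differential. -/
structure IsHorizontalLift (V : Set ℂ) (P : ℂ → Mat3) (v : ℂ → Fin 3 → ℂ) : Prop
    extends IsUnitLift V P v where
  horizontal : ∀ z ∈ V, ∀ X, star (v z) ⬝ᵥ fderiv ℝ v z X = 0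

section lifts

variable {V : Set ℂ} {P : ℂ → Mat3} {v w : ℂ → Fin 3 → ℂ}

theorem IsUnitLift.differentiableAt (hV : IsOpen V) (h : IsUnitLift V P v) {z : ℂ} (hz : z ∈ V) :
    DifferentiableAt ℝ v z :=
  (h.smooth.differentiableOn (by simp)).differentiableAt (hV.mem_nhds hz)

/-- Differentiation of |v|² = 1: the connection form ⟨v, dv⟩ is purely imaginary. -/
theorem IsUnitLift.conj_connection (hV : IsOpen V) (h : IsUnitLift V P v) {z : ℂ} (hz : z ∈ V)
    (X : ℂ) : (starRingEnd ℂ) (star (v z) ⬝ᵥ fderiv ℝ v z X) = -(star (v z) ⬝ᵥ fderiv ℝ v z X) := by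
  have hd := h.differentiableAt hV hz
  have h1 := (star_dotProduct_fderiv hd hd).2 X
  have e : (fun z => star (v z) ⬝ᵥ v z) =ᶠ[𝓝 z] fun _ => 1 :=
    eventually_of_mem (hV.mem_nhds hz) h.unit
  rw [e.fderiv_eq] at h1
  rw [star_star_dotProduct]
  simp at h1
  exact eq_neg_of_add_eq_zero_left h1.symm

theorem IsUnitLift.dMat_proj (hV : IsOpen V) (h : IsUnitLift V P v) {z : ℂ} (hz : z ∈ V) (X : ℂ) :
    dMat P z X = Matrix.vecMulVec (fderiv ℝ v z X) (star (v z))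
      + Matrix.vecMulVec (v z) (star (fderiv ℝ v z X)) := by
  have hvi := fun i => hasFDerivAt_pi'.mp (h.differentiableAt hV hz).hasFDerivAt i
  rw [dMat_congr_on hV h.proj hz]
  ext i j
  have h1 := (hvi i).mul (conjCLE.hasFDerivAt.comp z (hvi j))
  change fderiv ℝ (fun w => v w i * (starRingEnd ℂ) (v w j)) z X = _
  have h2 : HasFDerivAt (fun w => v w i * (starRingEnd ℂ) (v w j)) _ z := h1
  rw [h2.fderiv]
  simp [Matrix.vecMulVec_apply, add_comm, mul_comm]

theorem IsUnitLift.trace_proj (hV : IsOpen V) (h : IsUnitLift V P v) {z : ℂ} (hz : z ∈ V)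
    (X Y : ℂ) : (P z * dMat P z X * dMat P z Y).trace = star (fderiv ℝ v z X) ⬝ᵥ fderiv ℝ v z Y
      + (star (v z) ⬝ᵥ fderiv ℝ v z X) * (star (v z) ⬝ᵥ fderiv ℝ v z Y) := by
  have hX := h.conj_connection hV hz X
  have hY := h.conj_connection hV hz Y
  rw [star_star_dotProduct] at hX hY
  rw [h.dMat_proj hV hz, h.dMat_proj hV hz, h.proj z hz, trace_vecMulVec_tangent (h.unit z hz), hX,
    hY]
  ring

theorem IsHorizontalLift.trace_proj (hV : IsOpen V) (h : IsHorizontalLift V P v) {z : ℂ}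
    (hz : z ∈ V) (X Y : ℂ) :
    (P z * dMat P z X * dMat P z Y).trace = star (fderiv ℝ v z X) ⬝ᵥ fderiv ℝ v z Y := by
  rw [h.toIsUnitLift.trace_proj hV hz, h.horizontal z hz, zero_mul, add_zero]

/-- The connection form of a unit lift is closed where the Kähler form vanishes. -/
theorem IsUnitLift.connection_closed (hV : IsOpen V) (h : IsUnitLift V P v)
    (hP : ∀ z ∈ V, ∀ X Y, (P z * dMat P z X * dMat P z Y).trace.im = 0) {z : ℂ} (hz : z ∈ V) :
    fderiv ℝ (fun w => star (v w) ⬝ᵥ fderiv ℝ v w 1) z I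
      = fderiv ℝ (fun w => star (v w) ⬝ᵥ fderiv ℝ v w I) z 1 := by
  have hd := h.differentiableAt hV hz
  have hd' : ∀ X, DifferentiableAt ℝ (fun w => fderiv ℝ v w X) z := fun X =>
    (((h.smooth.fderiv_of_isOpen hV (m := ∞) (by simp)).clm_apply
      contDiffOn_const).differentiableOn (by simp)).differentiableAt (hV.mem_nhds hz)
  rw [(star_dotProduct_fderiv hd (hd' 1)).2, (star_dotProduct_fderiv hd (hd' I)).2,
    fderiv_fderiv_symm hV h.smooth hz 1 I]
  -- The terms with second derivatives agree by symmetry. There remains the equality of ⟨v_y, v_x⟩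
  -- and ⟨v_x, v_y⟩, that is, the reality of these products. They differ from the trace of the
  -- Kähler form by a product of two imaginary numbers, which is real.
  congr 1
  have hr : ∀ X, (star (v z) ⬝ᵥ fderiv ℝ v z X).re = 0 := fun X => by
    have := congrArg re (h.conj_connection hV hz X)
    simp only [conj_re, neg_re] at this
    linarith
  have him : ∀ X Y, (star (fderiv ℝ v z X) ⬝ᵥ fderiv ℝ v z Y).im = 0 := fun X Y => by
    have := hP z hz X Y
    rw [h.trace_proj hV hz, add_im, mul_im, hr, hr] at this
    simpa using this
  rw [← star_star_dotProduct (fderiv ℝ v z I), conj_eq_iff_im.mpr (him I 1)]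

theorem IsUnitLift.eq_smul (hv : IsUnitLift V P v) {W : Set ℂ} (hw : IsUnitLift W P w) {z : ℂ}
    (hz : z ∈ V) (hz' : z ∈ W) : w z = (star (v z) ⬝ᵥ w z) • v z := by
  have h1 : (P z).mulVec (w z) = w z := by
    rw [hw.proj z hz', Matrix.vecMulVec_mulVec, hw.unit z hz']
    simp
  conv_lhs => rw [← h1, hv.proj z hz, Matrix.vecMulVec_mulVec]
  simp

/-- Each lift is a multiple of the other, so horizontality of both kills the two terms of the
derivative of ⟨v, w⟩. The phase between horizontal lifts is locally constant. -/
theorem IsHorizontalLift.eventually_dotProduct_eq {W : Set ℂ} (hV : IsOpen V) (hW : IsOpen W)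
    (hv : IsHorizontalLift V P v) (hw : IsHorizontalLift W P w) {z : ℂ} (hz : z ∈ V)
    (hz' : z ∈ W) : ∀ᶠ y in 𝓝 z, star (v y) ⬝ᵥ w y = star (v z) ⬝ᵥ w z := by
  obtain ⟨r, hr, hb⟩ := Metric.isOpen_iff.mp (hV.inter hW) z ⟨hz, hz'⟩
  refine eventually_of_mem (Metric.ball_mem_nhds z hr) fun y hy => ?_
  refine Metric.isOpen_ball.is_const_of_fderiv_eq_zero (𝕜 := ℝ)
    (f := fun y => star (v y) ⬝ᵥ w y) (convex_ball z r).isPreconnected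
    (fun x hx => ?_) (fun x hx => ?_) hy (Metric.mem_ball_self hr)
  · exact (star_dotProduct_fderiv (hv.differentiableAt hV (hb hx).1)
      (hw.differentiableAt hW (hb hx).2)).1.differentiableAt.differentiableWithinAt
  · ext X
    have h1 := hv.toIsUnitLift.eq_smul hw.toIsUnitLift (hb hx).1 (hb hx).2
    have h2 := hw.toIsUnitLift.eq_smul hv.toIsUnitLift (hb hx).2 (hb hx).1
    rw [(star_dotProduct_fderiv (hv.differentiableAt hV (hb hx).1)
      (hw.differentiableAt hW (hb hx).2)).2]
    have e1 : star (fderiv ℝ v x X) ⬝ᵥ w x = 0 := by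
      rw [h1, dotProduct_smul, ← star_star_dotProduct (v x), hv.horizontal x (hb hx).1]
      simp
    have e2 : star (v x) ⬝ᵥ fderiv ℝ w x X = 0 := by
      rw [h2, star_smul, smul_dotProduct, hw.horizontal x (hb hx).2]
      simp
    rw [e1, e2]
    simp

end lifts

end HSLagrangian
end

open scoped ContDiff

noncomputable section

namespace HSLagrangian

open Set Filter Topology Complex MeasureTheory

/-! ### Existence of horizontal lifts -/

variable {Ω : Set ℂ}

theorem star_dotProduct_self (w : Fin 3 → ℂ) : star w ⬝ᵥ w = ((∑ i, normSq (w i) : ℝ) : ℂ) := by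
  simp [dotProduct, normSq_eq_conj_mul_self]

theorem normalize_unit {w : Fin 3 → ℂ} {s : ℝ} (hs : 0 < s) (hw : star w ⬝ᵥ w = s) :
    star (((Real.sqrt s)⁻¹ : ℂ) • w) ⬝ᵥ (((Real.sqrt s)⁻¹ : ℂ) • w) = 1 ∧
    Matrix.vecMulVec (((Real.sqrt s)⁻¹ : ℂ) • w) (star (((Real.sqrt s)⁻¹ : ℂ) • w))
      = (s : ℂ)⁻¹ • Matrix.vecMulVec w (star w) := by
  have h1 : star ((Real.sqrt s : ℂ)⁻¹) = (Real.sqrt s : ℂ)⁻¹ := by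
    rw [star_inv₀]
    simp
  have h2 : (Real.sqrt s : ℂ)⁻¹ * (Real.sqrt s : ℂ)⁻¹ = (s : ℂ)⁻¹ := by
    rw [← mul_inv]
    congr 1
    exact_mod_cast Real.mul_self_sqrt hs.le
  have hs' : (s : ℂ) ≠ 0 := by exact_mod_cast hs.ne'
  constructor
  · rw [star_smul, smul_dotProduct, dotProduct_smul, hw, h1, smul_smul, h2, smul_eq_mul,
      inv_mul_cancel₀ hs']
  · rw [star_smul, h1, Matrix.smul_vecMulVec, Matrix.vecMulVec_smul, smul_smul, h2]

theorem exists_unit_rep (p : CP2) :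
    ∃ t : Fin 3 → ℂ, star t ⬝ᵥ t = 1 ∧ proj p = Matrix.vecMulVec t (star t) := by
  set s : ℝ := ∑ i, normSq (p.rep i) with hs
  have h1 : star p.rep ⬝ᵥ p.rep = (s : ℂ) := star_dotProduct_self _
  have hs0 : 0 < s := by
    refine lt_of_le_of_ne (Finset.sum_nonneg fun i _ => normSq_nonneg _) fun h => ?_
    refine rep_dotProduct_ne_zero p ?_
    rw [dotProduct_comm, h1, ← h, ofReal_zero]
  obtain ⟨h2, h3⟩ := normalize_unit hs0 h1
  exact ⟨_, h2, by rw [h3, proj, dotProduct_comm, h1]⟩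

/-- A fixed unit vector of the line at p is projected onto the nearby lines and normalised where its
projection is not zero. -/
theorem IsSmooth.exists_local_unitLift (hΩ : IsOpen Ω) {u : Ω → CP2} (hu : IsSmooth u) {p : ℂ}
    (hp : p ∈ Ω) : ∃ V : Set ℂ, IsOpen V ∧ p ∈ V ∧ V ⊆ Ω ∧
      ∃ v, IsUnitLift V (projField u) v := by
  have hrep : ∀ z ∈ Ω, ∃ t : Fin 3 → ℂ, star t ⬝ᵥ t = 1 ∧
      projField u z = Matrix.vecMulVec t (star t) := fun z hz => by
    rw [projField, zeroExt_apply _ hz]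
    exact exists_unit_rep _
  obtain ⟨v₀, hv₀, hP₀⟩ := hrep p hp
  let w : ℂ → Fin 3 → ℂ := fun z => (projField u z).mulVec v₀
  let s : ℂ → ℝ := fun z => ∑ i, normSq (w z i)
  have hw : ContDiffOn ℝ ∞ w Ω := by
    refine contDiffOn_pi.mpr fun i => ?_
    simp only [w, Matrix.mulVec, dotProduct]
    exact ContDiffOn.sum fun j _ => (hu i j).mul contDiffOn_const
  have hs : ContDiffOn ℝ ∞ s Ω := by
    refine ContDiffOn.sum fun i _ => ?_
    have hi := contDiffOn_pi.mp hw i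
    simp only [normSq_apply]
    exact ((reCLM.contDiff.comp_contDiffOn hi).mul (reCLM.contDiff.comp_contDiffOn hi)).add
      ((imCLM.contDiff.comp_contDiffOn hi).mul (imCLM.contDiff.comp_contDiffOn hi))
  have hws : ∀ z, star (w z) ⬝ᵥ w z = (s z : ℂ) := fun z => star_dotProduct_self _
  have hsp : s p = 1 := by
    have h1 : w p = v₀ := by
      simp only [w]
      rw [hP₀, Matrix.vecMulVec_mulVec, hv₀]
      simp
    have h2 := hws p
    rw [h1, hv₀] at h2
    exact_mod_cast h2.symm
  refine ⟨Ω ∩ s ⁻¹' Ioi 0, hs.continuousOn.isOpen_inter_preimage hΩ isOpen_Ioi,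
    ⟨hp, by simp [hsp]⟩, inter_subset_left,
    fun z => ((Real.sqrt (s z))⁻¹ : ℂ) • w z, ⟨?_, fun z hz => ?_, fun z hz => ?_⟩⟩
  · have h1 : ContDiffOn ℝ ∞ (fun z => (Real.sqrt (s z))⁻¹) (Ω ∩ s ⁻¹' Ioi 0) :=
      ((hs.mono inter_subset_left).sqrt fun z hz => ne_of_gt hz.2).inv
        fun z hz => (Real.sqrt_pos.mpr hz.2).ne'
    have h2 : ContDiffOn ℝ ∞ (fun z => ((Real.sqrt (s z) : ℂ))⁻¹) (Ω ∩ s ⁻¹' Ioi 0) :=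
      (ofRealCLM.contDiff.comp_contDiffOn h1).congr fun z _ => by simp
    exact h2.smul (hw.mono inter_subset_left)
  · exact (normalize_unit hz.2 (hws z)).1
  · rw [(normalize_unit hz.2 (hws z)).2]
    obtain ⟨t, ht, hPt⟩ := hrep z hz.1
    have hwt : w z = (star t ⬝ᵥ v₀) • t := by
      simp only [w]
      rw [hPt, Matrix.vecMulVec_mulVec]
      simp
    have hst := hws z
    have hs0 : (s z : ℂ) ≠ 0 := by exact_mod_cast ne_of_gt hz.2
    rw [hwt, star_smul, smul_dotProduct, dotProduct_smul, ht] at hst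
    simp only [smul_eq_mul, mul_one] at hst
    rw [hwt, star_smul, Matrix.smul_vecMulVec, Matrix.vecMulVec_smul, smul_smul, smul_smul, mul_assoc,
      mul_comm (star t ⬝ᵥ v₀), hst, inv_mul_cancel₀ hs0, one_smul, hPt]

/-- A unit lift v is corrected to gv with dg = -g⟨v, dv⟩. This scalar equation is flat because the
connection form of a Lagrangian map is closed. -/
theorem IsSmooth.exists_local_horizontalLift (hΩ : IsOpen Ω) {u : Ω → CP2} (hu : IsSmooth u)
    (hL : IsLagrangian u) {p : ℂ} (hp : p ∈ Ω) : ∃ V : Set ℂ, IsOpen V ∧ p ∈ V ∧ V ⊆ Ω ∧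
      ∃ v, IsHorizontalLift V (projField u) v := by
  obtain ⟨V, hV, hpV, hVΩ, v, hv⟩ := hu.exists_local_unitLift hΩ hp
  have hη : ∀ X, ContDiffOn ℝ ∞ (fun w => star (v w) ⬝ᵥ fderiv ℝ v w X) V := fun X => by
    have h1 : ContDiffOn ℝ ∞ (fun w => fderiv ℝ v w X) V :=
      (hv.smooth.fderiv_of_isOpen hV (m := ∞) (by simp)).clm_apply contDiffOn_const
    simp only [dotProduct]
    exact ContDiffOn.sum fun i _ => (conjCLE.contDiff.comp_contDiffOn
      (contDiffOn_pi.mp hv.smooth i)).mul (contDiffOn_pi.mp h1 i)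
  obtain ⟨W, g, hW, hpW, hWV, hgp, hg⟩ := exists_local_solution hV (hη 1).neg (hη I).neg
    (fun z hz => by
      have hcl := hv.connection_closed hV (fun z hz X Y => hL z (hVΩ hz) X Y) hz
      have e1 := fderiv_fun_neg (𝕜 := ℝ) (f := fun w => star (v w) ⬝ᵥ fderiv ℝ v w 1) (x := z)
      have e2 := fderiv_fun_neg (𝕜 := ℝ) (f := fun w => star (v w) ⬝ᵥ fderiv ℝ v w I) (x := z)
      rw [e1, e2, neg_apply, neg_apply, hcl, mul_comm]) hpV
  obtain ⟨r, hr, hb⟩ := Metric.isOpen_iff.mp hW p hpW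
  have hgd : ∀ z ∈ W, DifferentiableAt ℝ g z := fun z hz =>
    HasFDerivAt.differentiableAt (hg z hz)
  have hg' : ∀ z ∈ W, ∀ X, fderiv ℝ g z X = -(g z * (star (v z) ⬝ᵥ fderiv ℝ v z X)) := by
    intro z hz X
    have h1 : fderiv ℝ g z X = _ := DFunLike.congr_fun (HasFDerivAt.fderiv (hg z hz)) X
    rw [h1, realForm_apply, fderiv_real_basis (fderiv ℝ v z) X, dotProduct_add, dotProduct_smul,
      dotProduct_smul]
    simp only [real_smul]
    ring
  have hgs : ContDiffOn ℝ ∞ g W := contDiffOn_of_solvesAt hW ((hη 1).neg.mono hWV)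
    ((hη I).neg.mono hWV) hg
  have hvd : ∀ z ∈ W, DifferentiableAt ℝ v z := fun z hz => hv.differentiableAt hV (hWV hz)
  -- As the connection form is imaginary, |g|² has derivative zero. It equals 1 at p, hence on a
  -- ball, which is connected.
  have hnorm : ∀ z ∈ Metric.ball p r, (starRingEnd ℂ) (g z) * g z = 1 := by
    intro z hz
    have h1 : (starRingEnd ℂ) (g z) * g z = (starRingEnd ℂ) (g p) * g p := by
      refine Metric.isOpen_ball.is_const_of_fderiv_eq_zero (𝕜 := ℝ)
        (f := fun y => (starRingEnd ℂ) (g y) * g y) (convex_ball p r).isPreconnected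
        (fun x hx => ?_) (fun x hx => ?_) hz (Metric.mem_ball_self hr)
      · exact ((conjCLE.differentiableAt.comp x (hgd x (hb hx))).mul
          (hgd x (hb hx))).differentiableWithinAt
      · ext X
        have h2 : HasFDerivAt (fun y => (starRingEnd ℂ) (g y) * g y) _ x :=
          (conjCLE.hasFDerivAt.comp x (hgd x (hb hx)).hasFDerivAt).mul (hgd x (hb hx)).hasFDerivAt
        rw [h2.fderiv]
        have h3 := hv.conj_connection hV (hWV (hb hx)) X
        simp [hg' x (hb hx) X, h3]
        ring
    rw [h1, hgp]
    simp
  refine ⟨Metric.ball p r, Metric.isOpen_ball, Metric.mem_ball_self hr, hb.trans (hWV.trans hVΩ),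
    fun z => g z • v z, ⟨(hgs.mono hb).smul (hv.smooth.mono (hb.trans hWV)), fun z hz => ?_,
      fun z hz => ?_⟩, fun z hz X => ?_⟩
  · rw [star_smul, smul_dotProduct, dotProduct_smul, hv.unit z (hWV (hb hz)), smul_smul]
    simpa using hnorm z hz
  · rw [star_smul, Matrix.smul_vecMulVec, Matrix.vecMulVec_smul, smul_smul, mul_comm,
      hv.proj z (hWV (hb hz))]
    have : star (g z) * g z = 1 := hnorm z hz
    rw [this, one_smul]
  · rw [fderiv_smul_vec (hgd z (hb hz)) (hvd z (hb hz)), hg' z (hb hz), star_smul, smul_dotProduct,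
      dotProduct_add, dotProduct_smul, dotProduct_smul, hv.unit z (hWV (hb hz))]
    simp

end HSLagrangian
end

open scoped ContDiff

noncomputable section

namespace HSLagrangian

open Set Filter Topology Complex MeasureTheory

/-! ### Global lifts and frames -/

variable {Ω : Set ℂ}

theorem IsHorizontalLift.smul {V : Set ℂ} {P : ℂ → Mat3} {v : ℂ → Fin 3 → ℂ} (hV : IsOpen V)
    (h : IsHorizontalLift V P v) (k : Circle) :
    IsHorizontalLift V P fun z => (k : ℂ) • v z := by
  have hk : star (k : ℂ) * (k : ℂ) = 1 := by
    rw [mul_comm]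
    exact (Complex.mul_conj _).trans (by simp)
  refine ⟨⟨h.smooth.const_smul (k : ℂ), fun z hz => ?_, fun z hz => ?_⟩, fun z hz X => ?_⟩
  · rw [star_smul, smul_dotProduct, dotProduct_smul, h.unit z hz, smul_smul, hk, one_smul]
  · rw [star_smul, Matrix.smul_vecMulVec, Matrix.vecMulVec_smul, smul_smul, mul_comm, hk, one_smul,
      h.proj z hz]
  · rw [fderiv_fun_const_smul (h.differentiableAt hV hz), star_smul, smul_dotProduct, smul_apply,
      dotProduct_smul, h.horizontal z hz]
    simp

/-- The phases between local horizontal lifts are locally constant, so they are glued with G the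
circle group. -/
theorem IsSmooth.exists_horizontalLift (hΩ : IsOpen Ω) [SimplyConnectedSpace Ω] {u : Ω → CP2}
    (hu : IsSmooth u) (hL : IsLagrangian u) : ∃ v, IsHorizontalLift Ω (projField u) v := by
  have := hΩ.locallyPathConnectedSpace
  choose V hV hmem hVΩ v hv using fun p : Ω => hu.exists_local_horizontalLift hΩ hL p.2
  have hphase : ∀ i y : Ω, (y : ℂ) ∈ V i →
      star (v y y) ⬝ᵥ v i y ∈ Submonoid.unitSphere ℂ := by
    intro i y hy
    have h1 := (hv y).toIsUnitLift.eq_smul (hv i).toIsUnitLift (hmem y) hy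
    have h2 := (hv i).unit y hy
    rw [h1, star_smul, smul_dotProduct, dotProduct_smul, (hv y).unit y (hmem y)] at h2
    simp only [smul_eq_mul, mul_one] at h2
    have h3 : normSq (star (v y y) ⬝ᵥ v i y) = 1 := by
      have := normSq_eq_conj_mul_self (z := star (v y y) ⬝ᵥ v i y)
      exact_mod_cast this.trans h2
    simp only [Submonoid.unitSphere, Submonoid.mem_mk, Subsemigroup.mem_mk, mem_sphere_zero_iff_norm]
    rw [← Complex.sq_norm] at h3
    nlinarith [norm_nonneg (star (v y y) ⬝ᵥ v i y)]
  classical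
  -- The phase of the lift of index i is measured against the reference vector `v y y`, chosen
  -- independently at each point. The references cancel in s_j s_i⁻¹ = ⟨v_i, v_j⟩, so their lack of
  -- continuity is harmless. The default value 1 is never used.
  let s : Ω → Ω → Circle := fun i y => if h : (y : ℂ) ∈ V i then ⟨_, hphase i y h⟩ else 1
  have hs : ∀ i y : Ω, (y : ℂ) ∈ V i → v i y = (s i y : ℂ) • v y y := by
    intro i y hy
    have : (s i y : ℂ) = star (v y y) ⬝ᵥ v i y := by
      have h1 : s i y = ⟨_, hphase i y hy⟩ := dif_pos hy
      rw [h1]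
    rw [this]
    exact (hv y).toIsUnitLift.eq_smul (hv i).toIsUnitLift (hmem y) hy
  have hcoc : ∀ i j y : Ω, (y : ℂ) ∈ V i → (y : ℂ) ∈ V j →
      ((s j y * (s i y)⁻¹ : Circle) : ℂ) = star (v i y) ⬝ᵥ v j y := by
    intro i j y hi hj
    rw [hs i y hi, hs j y hj, star_smul, smul_dotProduct, dotProduct_smul,
      (hv y).unit y (hmem y), Circle.coe_mul, Circle.coe_inv_eq_conj]
    simp [mul_comm]
  obtain ⟨S, hS⟩ := exists_glued_of_locallyConst_cocycle (fun i : Ω => {y : Ω | (y : ℂ) ∈ V i})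
    (fun i => (hV i).preimage continuous_subtype_val) hmem s (fun i j x hi hj => by
      have h1 := (hv i).eventually_dotProduct_eq (hV i) (hV j) (hv j) hi hj
      have h2 : ∀ᶠ y : Ω in 𝓝 x, star (v i y) ⬝ᵥ v j y = star (v i x) ⬝ᵥ v j x :=
        continuous_subtype_val.continuousAt.eventually h1
      have h3 : ∀ᶠ y : Ω in 𝓝 x, (y : ℂ) ∈ V i ∩ V j :=
        continuous_subtype_val.continuousAt.eventually (((hV i).inter (hV j)).mem_nhds ⟨hi, hj⟩)
      filter_upwards [h2, h3] with y hy hy'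
      refine Circle.ext ?_
      rw [hcoc i j y hy'.1 hy'.2, hcoc i j x hi hj, hy])
  -- Near x the glued phase is a constant times s_x, so w is a constant multiple of the smooth lift
  -- of index x.
  let w : ℂ → Fin 3 → ℂ := zeroExt fun y : Ω => (S y : ℂ) • v y y
  have hloc : ∀ x : Ω, ∃ W : Set ℂ, IsOpen W ∧ (x : ℂ) ∈ W ∧ ∃ v', IsHorizontalLift W (projField u) v'
      ∧ ∀ y ∈ W, w y = v' y := by
    intro x
    obtain ⟨k, hk⟩ := hS x
    obtain ⟨T, hT, hTo, hxT⟩ := eventually_nhds_iff.mp hk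
    refine ⟨Subtype.val '' T ∩ V x, (hΩ.isOpenMap_subtype_val T hTo).inter (hV x),
      ⟨⟨x, hxT, rfl⟩, hmem x⟩, fun z => (k : ℂ) • v x z, ?_, ?_⟩
    · have := (hv x).smul (hV x) k
      exact ⟨⟨this.smooth.mono inter_subset_right, fun z hz => this.unit z hz.2,
        fun z hz => this.proj z hz.2⟩, fun z hz => this.horizontal z hz.2⟩
    · rintro _ ⟨⟨y, hy, rfl⟩, hyV⟩
      simp only [w]
      rw [zeroExt_apply _ y.2, hs x y hyV]
      simp only [Subtype.coe_eta]
      rw [hT y hy, Circle.coe_mul, mul_smul]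
  refine ⟨w, ⟨fun z hz => ?_, fun z hz => ?_, fun z hz => ?_⟩, fun z hz X => ?_⟩ <;>
    obtain ⟨W, hWo, hzW, v', hv', hw⟩ := hloc ⟨z, hz⟩ <;>
    have hev : w =ᶠ[𝓝 z] v' := eventually_of_mem (hWo.mem_nhds hzW) hw
  · exact ((hv'.smooth.contDiffAt (hWo.mem_nhds hzW)).congr_of_eventuallyEq hev).contDiffWithinAt
  · rw [hw z hzW, hv'.unit z hzW]
  · rw [hw z hzW, hv'.proj z hzW]
  · rw [hw z hzW, hev.fderiv_eq, hv'.horizontal z hzW]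

theorem proj_injective : Function.Injective proj := by
  intro p q h
  have h1 : (proj p).mulVec p.rep = p.rep := by
    rw [proj, Matrix.smul_mulVec, Matrix.vecMulVec_mulVec, dotProduct_comm (star p.rep)]
    simp [smul_smul, inv_mul_cancel₀ (rep_dotProduct_ne_zero p)]
  rw [h, proj, Matrix.smul_mulVec, Matrix.vecMulVec_mulVec] at h1
  rw [← p.mk_rep, ← q.mk_rep, Projectivization.mk_eq_mk_iff']
  refine ⟨(q.rep ⬝ᵥ star q.rep)⁻¹ * (star q.rep ⬝ᵥ p.rep), ?_⟩
  rw [mul_smul]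
  simpa using h1

/-- The frame `(e^{-ρ} ∂û/∂x, e^{-ρ} ∂û/∂y, û)`, where `s = e^{-ρ}`. -/
def liftFrame (s : ℂ → ℝ) (v : ℂ → Fin 3 → ℂ) (z : ℂ) : Mat3 :=
  Matrix.of fun i j => ![(s z : ℂ) * fderiv ℝ v z 1 i, (s z : ℂ) * fderiv ℝ v z I i, v z i] j

theorem star_liftFrame_mul_apply (s : ℂ → ℝ) (v : ℂ → Fin 3 → ℂ) (z : ℂ) (N : Mat3) (k : Fin 3) :
    (star (liftFrame s v z) * N) 0 k = (s z : ℂ) * (star (fderiv ℝ v z 1) ⬝ᵥ fun i => N i k) ∧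
    (star (liftFrame s v z) * N) 1 k = (s z : ℂ) * (star (fderiv ℝ v z I) ⬝ᵥ fun i => N i k) ∧
    (star (liftFrame s v z) * N) 2 k = star (v z) ⬝ᵥ fun i => N i k := by
  refine ⟨?_, ?_, ?_⟩ <;>
    simp [Matrix.mul_apply, liftFrame, dotProduct, Fin.sum_univ_three] <;> ring

/-- The rescaled partial derivatives of a horizontal lift and the lift itself are orthonormal:
conformality controls the real parts of the products, the Lagrangian condition their imaginary
parts, and horizontality the products with the lift. -/
theorem exists_adapted_frame (hΩ : IsOpen Ω) [SimplyConnectedSpace Ω] {u : Ω → CP2}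
    (hu : IsSmooth u) (hc : IsConformal u) (hL : IsLagrangian u) :
    ∃ F : Ω → U3, IsAdapted Ω (matField F) ∧ ∀ z, u z = lastColLine (F z) := by
  obtain ⟨v, hv⟩ := hu.exists_horizontalLift hΩ hL
  have hdv : ∀ X, ContDiffOn ℝ ∞ (fun z => fderiv ℝ v z X) Ω := fun X =>
    (hv.smooth.fderiv_of_isOpen hΩ (m := ∞) (by simp)).clm_apply contDiffOn_const
  have hprod : ∀ z ∈ Ω, ∀ X Y, star (fderiv ℝ v z X) ⬝ᵥ fderiv ℝ v z Y
      = (metric u z X Y : ℂ) := fun z hz X Y => by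
    rw [← hv.trace_proj hΩ hz]
    apply Complex.ext
    · rfl
    · exact hL z hz X Y
  have hconf : ∀ z ∈ Ω, metric u z I I = metric u z 1 1 ∧ metric u z 1 I = 0 ∧
      metric u z I 1 = 0 ∧ 0 < metric u z 1 1 := fun z hz => by
    obtain ⟨ρ, hρ⟩ := hc z hz
    rw [hρ, hρ, hρ, hρ]
    simp [Real.exp_pos]
  let s : ℂ → ℝ := fun z => (Real.sqrt (metric u z 1 1))⁻¹
  have hm : ContDiffOn ℝ ∞ (fun z => metric u z 1 1) Ω := by
    have hP : SmoothMatOn (projField u) Ω := hu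
    exact reCLM.contDiff.comp_contDiffOn
      (contDiffOn_trace ((hP.mul (hP.dMat hΩ 1)).mul (hP.dMat hΩ 1)))
  have hs : ContDiffOn ℝ ∞ (fun z => (s z : ℂ)) Ω :=
    ofRealCLM.contDiff.comp_contDiffOn ((hm.sqrt fun z hz => (hconf z hz).2.2.2.ne').inv
      fun z hz => (Real.sqrt_pos.mpr (hconf z hz).2.2.2).ne')
  have hs2 : ∀ z ∈ Ω, (s z : ℂ) * (s z * (metric u z 1 1 : ℂ)) = 1 := fun z hz => by
    have h0 := (hconf z hz).2.2.2
    have h1 : s z * (s z * metric u z 1 1) = 1 := by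
      have h2 := Real.mul_self_sqrt h0.le
      have h3 := (Real.sqrt_pos.mpr h0).ne'
      simp only [s]
      nth_rewrite 3 [← h2]
      field_simp
    exact_mod_cast h1
  have hs0 : ∀ z ∈ Ω, (s z : ℂ) ≠ 0 := fun z hz h => by
    have := hs2 z hz
    rw [h] at this
    simp at this
  have hcol0 : ∀ z, (fun i => liftFrame s v z i 0) = (s z : ℂ) • fderiv ℝ v z 1 := fun _ => rfl
  have hcol1 : ∀ z, (fun i => liftFrame s v z i 1) = (s z : ℂ) • fderiv ℝ v z I := fun _ => rfl
  have hcol2 : ∀ z, (fun i => liftFrame s v z i 2) = v z := fun _ => rfl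
  have hh : ∀ z ∈ Ω, ∀ X, star (fderiv ℝ v z X) ⬝ᵥ v z = 0 := fun z hz X => by
    rw [← star_star_dotProduct, hv.horizontal z hz, map_zero]
  have hU : UnitaryOn (liftFrame s v) Ω := by
    intro z hz
    obtain ⟨c1, c2, c3, -⟩ := hconf z hz
    obtain ⟨a0, a1, a2⟩ := star_liftFrame_mul_apply s v z (liftFrame s v z) 0
    obtain ⟨b0, b1, b2⟩ := star_liftFrame_mul_apply s v z (liftFrame s v z) 1
    obtain ⟨d0, d1, d2⟩ := star_liftFrame_mul_apply s v z (liftFrame s v z) 2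
    rw [hcol0, dotProduct_smul, hprod z hz, smul_eq_mul] at a0 a1
    rw [hcol0, dotProduct_smul, hv.horizontal z hz, smul_zero] at a2
    rw [hcol1, dotProduct_smul, hprod z hz, smul_eq_mul] at b0 b1
    rw [hcol1, dotProduct_smul, hv.horizontal z hz, smul_zero] at b2
    rw [hcol2, hh z hz, mul_zero] at d0 d1
    rw [hcol2, hv.unit z hz] at d2
    rw [hs2 z hz] at a0
    rw [c3, ofReal_zero, mul_zero, mul_zero] at a1
    rw [c2, ofReal_zero, mul_zero, mul_zero] at b0
    rw [c1, hs2 z hz] at b1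
    ext i j
    fin_cases i <;> fin_cases j
    · exact a0
    · exact b0
    · exact d0
    · exact a1
    · exact b1
    · exact d1
    · exact a2
    · exact b2
    · exact d2
  have hmemU : ∀ z : Ω, liftFrame s v z ∈ Matrix.unitaryGroup (Fin 3) ℂ := fun z =>
    Matrix.mem_unitaryGroup_iff'.mpr (hU z z.2)
  let F : Ω → U3 := fun z => ⟨liftFrame s v z, hmemU z⟩
  have hF : ∀ z ∈ Ω, matField F z = liftFrame s v z := fun z hz => matField_apply F hz
  have hsm : SmoothMatOn (liftFrame s v) Ω := fun i j => by
    fin_cases j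
    · exact hs.mul (contDiffOn_pi.mp (hdv 1) i)
    · exact hs.mul (contDiffOn_pi.mp (hdv I) i)
    · exact contDiffOn_pi.mp hv.smooth i
  have hdcol : ∀ z ∈ Ω, ∀ X, (fun i => dMat (liftFrame s v) z X i 2) = fderiv ℝ v z X := by
    intro z hz X
    funext i
    have h1 := hasFDerivAt_pi'.mp (hv.differentiableAt hΩ hz).hasFDerivAt i
    change fderiv ℝ (fun w => v w i) z X = _
    rw [h1.fderiv]
    rfl
  have hmc : ∀ z ∈ Ω, ∀ X, mc (matField F) z X = mc (liftFrame s v) z X := fun z hz X => by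
    rw [mc, mc, hF z hz, dMat_congr_on hΩ hF hz]
  have hmc2 : ∀ z ∈ Ω, ∀ X, mc (matField F) z X 0 2 = s z * metric u z 1 X ∧
      mc (matField F) z X 1 2 = s z * metric u z I X ∧ mc (matField F) z X 2 2 = 0 := by
    intro z hz X
    obtain ⟨h0, h1, h2⟩ := star_liftFrame_mul_apply s v z (dMat (liftFrame s v) z X) 2
    rw [hdcol z hz] at h0 h1 h2
    rw [hmc z hz]
    refine ⟨h0.trans ?_, h1.trans ?_, h2.trans (hv.horizontal z hz X)⟩ <;> rw [hprod z hz]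
  refine ⟨F, ⟨hsm.congr hF, fun z hz => ?_, fun z hz X => (hmc2 z hz X).2.2, fun z hz => ?_,
    fun z hz => ?_, fun z hz => ?_⟩, fun z => ?_⟩
  · rw [hF z hz]
    exact hU z hz
  · rw [(hmc2 z hz I).1, (hmc2 z hz 1).2.1, (hconf z hz).2.1, (hconf z hz).2.2.1]
    simp
  · rw [(hmc2 z hz I).2.1, (hmc2 z hz 1).1, (hconf z hz).1]
    simp
  · rw [confFactor, (hmc2 z hz 1).1]
    refine add_pos_of_pos_of_nonneg (normSq_pos.mpr (mul_ne_zero (hs0 z hz) ?_)) (normSq_nonneg _)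
    exact_mod_cast (hconf z hz).2.2.2.ne'
  · refine proj_injective ?_
    rw [proj_lastColLine]
    have h1 := hv.proj z z.2
    rw [projField, zeroExt_apply _ z.2] at h1
    refine h1.trans ?_
    ext i j
    rw [mul_lastProj_mul_star_apply]
    rfl

end HSLagrangian
end

/-! ### Normalisation and uniqueness of frames. -/

open scoped ContDiff

noncomputable section

namespace HSLagrangian

open Set Filter Topology Complex MeasureTheory

/-! ### Constant changes of frame -/

variable {Ω : Set ℂ}

theorem IsAdapted.of_mc_eq {M N : ℂ → Mat3} (h : IsAdapted Ω M) (hN : SmoothMatOn N Ω)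
    (hU : UnitaryOn N Ω) (he : ∀ z ∈ Ω, ∀ X, mc N z X = mc M z X) : IsAdapted Ω N where
  smooth := hN
  unitary := hU
  horizontal z hz X := by rw [he z hz, h.horizontal z hz]
  rot_zero z hz := by rw [he z hz, he z hz, h.rot_zero z hz]
  rot_one z hz := by rw [he z hz, he z hz, h.rot_one z hz]
  nondeg z hz := by
    rw [confFactor, he z hz]
    exact h.nondeg z hz

theorem HarmonicAngle.of_trace_eq {M N : ℂ → Mat3} (hΩ : IsOpen Ω) (h : HarmonicAngle Ω M)
    (he : ∀ z ∈ Ω, ∀ X, (mc N z X).trace = (mc M z X).trace) : HarmonicAngle Ω N := by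
  intro z hz
  have e : ∀ X, angleForm N X =ᶠ[𝓝 z] angleForm M X := fun X =>
    eventually_of_mem (hΩ.mem_nhds hz) fun w hw => congrArg im (he w hw X)
  rw [(e 1).fderiv_eq, (e I).fderiv_eq]
  exact h z hz

theorem matField_mul_left (g : U3) (f : Ω → U3) {z : ℂ} (hz : z ∈ Ω) :
    matField (fun z => g * f z) z = (g : Mat3) * matField f z := by
  rw [matField_apply _ hz, matField_apply _ hz]
  rfl

theorem matField_mul_right (g : U3) (f : Ω → U3) {z : ℂ} (hz : z ∈ Ω) :
    matField (fun z => f z * g) z = matField f z * (g : Mat3) := by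
  rw [matField_apply _ hz, matField_apply _ hz]
  rfl

theorem mc_congr_on {M N : ℂ → Mat3} (hΩ : IsOpen Ω) (h : ∀ z ∈ Ω, M z = N z) {z : ℂ} (hz : z ∈ Ω)
    (X : ℂ) : mc M z X = mc N z X := by
  rw [mc, mc, h z hz, dMat_congr_on hΩ h hz]

theorem mc_matField_mul_left (hΩ : IsOpen Ω) (g : U3) {f : Ω → U3}
    (hf : SmoothMatOn (matField f) Ω) {z : ℂ} (hz : z ∈ Ω) (X : ℂ) :
    mc (matField fun z => g * f z) z X = mc (matField f) z X := by
  rw [mc_congr_on hΩ (fun w hw => matField_mul_left g f hw) hz,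
    mc_const_mul (Matrix.UnitaryGroup.star_mul_self g) (hf.diffMatAt hΩ hz)]

theorem IsAdapted.mul_left (hΩ : IsOpen Ω) (g : U3) {f : Ω → U3} (h : IsAdapted Ω (matField f)) :
    IsAdapted Ω (matField fun z => g * f z) :=
  h.of_mc_eq (((SmoothMatOn.const _ Ω).mul h.smooth).congr fun _ hz => matField_mul_left g f hz)
    (unitaryOn_matField _) fun _ hz X => mc_matField_mul_left hΩ g h.smooth hz X

theorem HarmonicAngle.mul_left (hΩ : IsOpen Ω) (g : U3) {f : Ω → U3}
    (hf : SmoothMatOn (matField f) Ω) (h : HarmonicAngle Ω (matField f)) :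
    HarmonicAngle Ω (matField fun z => g * f z) :=
  h.of_trace_eq hΩ fun _ hz X => by rw [mc_matField_mul_left hΩ g hf hz]

theorem star_eq_adjugate {k : Matrix (Fin 2) (Fin 2) ℂ}
    (hk : k ∈ Matrix.specialUnitaryGroup (Fin 2) ℂ) : star k = k.adjugate := by
  obtain ⟨h1, h2⟩ := Matrix.mem_specialUnitaryGroup_iff.mp hk
  calc star k = star k * (k * k.adjugate) := by rw [Matrix.mul_adjugate, h2, one_smul, mul_one]
    _ = _ := by rw [← mul_assoc, Matrix.mem_unitaryGroup_iff'.mp h1, one_mul]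

theorem conj_apply_of_mem_specialUnitaryGroup {k : Matrix (Fin 2) (Fin 2) ℂ}
    (hk : k ∈ Matrix.specialUnitaryGroup (Fin 2) ℂ) :
    (starRingEnd ℂ) (k 0 0) = k 1 1 ∧ (starRingEnd ℂ) (k 0 1) = -k 1 0 ∧
      (starRingEnd ℂ) (k 1 0) = -k 0 1 ∧ (starRingEnd ℂ) (k 1 1) = k 0 0 := by
  have h := star_eq_adjugate hk
  rw [Matrix.adjugate_fin_two] at h
  exact ⟨congrFun (congrFun h 0) 0, congrFun (congrFun h 1) 0, congrFun (congrFun h 0) 1,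
    congrFun (congrFun h 1) 1⟩

theorem mc_matField_mul_right (hΩ : IsOpen Ω) (g : U3) {f : Ω → U3}
    (hf : SmoothMatOn (matField f) Ω) {z : ℂ} (hz : z ∈ Ω) (X : ℂ) :
    mc (matField fun z => f z * g) z X = star (g : Mat3) * mc (matField f) z X * (g : Mat3) := by
  rw [mc_congr_on hΩ (fun w hw => matField_mul_right g f hw) hz,
    mc_mul (hf.diffMatAt hΩ hz) (DiffMatAt.const _ z) (unitaryOn_matField f z hz)]
  simp only [mc, dMat_const, mul_zero, add_zero]

/-- Elements of SU(2) commute with the map x ↦ J conj x, so they preserve the adaptedness relations.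
-/
theorem IsAdapted.mul_right (hΩ : IsOpen Ω) {g : U3} {k : Matrix (Fin 2) (Fin 2) ℂ}
    (hk : k ∈ Matrix.specialUnitaryGroup (Fin 2) ℂ) (hg : (g : Mat3) = embed k) {f : Ω → U3}
    (h : IsAdapted Ω (matField f)) : IsAdapted Ω (matField fun z => f z * g) := by
  obtain ⟨k00, k01, k10, k11⟩ := conj_apply_of_mem_specialUnitaryGroup hk
  have hdet := (Matrix.mem_specialUnitaryGroup_iff.mp hk).2
  rw [Matrix.det_fin_two] at hdet
  have key : ∀ z ∈ Ω, ∀ X,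
      mc (matField fun z => f z * g) z X 0 2
        = k 1 1 * mc (matField f) z X 0 2 - k 0 1 * mc (matField f) z X 1 2 ∧
      mc (matField fun z => f z * g) z X 1 2
        = -k 1 0 * mc (matField f) z X 0 2 + k 0 0 * mc (matField f) z X 1 2 ∧
      mc (matField fun z => f z * g) z X 2 2 = mc (matField f) z X 2 2 := by
    intro z hz X
    rw [mc_matField_mul_right hΩ g h.smooth hz, hg]
    refine ⟨?_, ?_, ?_⟩ <;>
      simp [embed, Matrix.mul_apply, Fin.sum_univ_three, k00, k01, k10, k11]
    ring
  refine ⟨(h.smooth.mul (SmoothMatOn.const _ Ω)).congr fun _ hz => matField_mul_right g f hz,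
    unitaryOn_matField _, fun z hz X => ?_, fun z hz => ?_, fun z hz => ?_, fun z hz => ?_⟩
  · rw [(key z hz X).2.2, h.horizontal z hz]
  · rw [(key z hz I).1, (key z hz 1).2.1, h.rot_zero z hz, h.rot_one z hz]
    simp [k10, k00]
    ring
  · rw [(key z hz I).2.1, (key z hz 1).1, h.rot_zero z hz, h.rot_one z hz]
    simp [k11, k01]
    ring
  · rw [confFactor, (key z hz 1).1, (key z hz 1).2.1]
    have hpos := h.nondeg z hz
    rw [confFactor] at hpos
    by_contra! hh
    have n0 := normSq_nonneg (k 1 1 * mc (matField f) z 1 0 2 - k 0 1 * mc (matField f) z 1 1 2)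
    have n1 := normSq_nonneg (-k 1 0 * mc (matField f) z 1 0 2 + k 0 0 * mc (matField f) z 1 1 2)
    have h0 := normSq_eq_zero.mp (le_antisymm (by linarith) n0)
    have h1 := normSq_eq_zero.mp (le_antisymm (by linarith) n1)
    have p0 : mc (matField f) z 1 0 2 = 0 := by
      linear_combination k 0 0 * h0 + k 0 1 * h1 - mc (matField f) z 1 0 2 * hdet
    have p1 : mc (matField f) z 1 1 2 = 0 := by
      linear_combination k 1 0 * h0 + k 1 1 * h1 - mc (matField f) z 1 1 2 * hdet
    rw [p0, p1] at hpos
    simp at hpos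

theorem HarmonicAngle.mul_right (hΩ : IsOpen Ω) (g : U3) {f : Ω → U3}
    (hf : SmoothMatOn (matField f) Ω) (h : HarmonicAngle Ω (matField f)) :
    HarmonicAngle Ω (matField fun z => f z * g) :=
  h.of_trace_eq hΩ fun _ hz X => by
    rw [mc_matField_mul_right hΩ g hf hz, Matrix.trace_mul_comm, ← mul_assoc,
      Matrix.mem_unitaryGroup_iff.mp g.2, one_mul]

/-- A special unitary matrix that fixes the last basis vector comes from `SU(2)`. -/
theorem exists_embed_eq {N : Mat3} (hN : star N * N = 1) (hdet : N.det = 1)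
    (h0 : N 0 2 = 0) (h1 : N 1 2 = 0) (h2 : N 2 2 = 1) :
    !![N 0 0, N 0 1; N 1 0, N 1 1] ∈ Matrix.specialUnitaryGroup (Fin 2) ℂ ∧
      N = embed !![N 0 0, N 0 1; N 1 0, N 1 1] := by
  have e : ∀ i j, ∑ k, (starRingEnd ℂ) (N k i) * N k j = (1 : Mat3) i j := fun i j => by
    rw [← hN]
    rfl
  simp only [Fin.sum_univ_three] at e
  have r0 : N 2 0 = 0 := by simpa [h0, h1, h2] using e 2 0
  have r1 : N 2 1 = 0 := by simpa [h0, h1, h2] using e 2 1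
  have e00 := e 0 0
  have e01 := e 0 1
  have e10 := e 1 0
  have e11 := e 1 1
  simp only [r0, r1, map_zero, mul_zero, add_zero] at e00 e01 e10 e11
  refine ⟨Matrix.mem_specialUnitaryGroup_iff.mpr ⟨Matrix.mem_unitaryGroup_iff'.mpr ?_, ?_⟩, ?_⟩
  · ext i j
    fin_cases i <;> fin_cases j
    · simpa [Matrix.mul_apply, Fin.sum_univ_two] using e00
    · simpa [Matrix.mul_apply, Fin.sum_univ_two] using e01
    · simpa [Matrix.mul_apply, Fin.sum_univ_two] using e10
    · simpa [Matrix.mul_apply, Fin.sum_univ_two] using e11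
  · rw [Matrix.det_fin_three] at hdet
    rw [Matrix.det_fin_two]
    simpa [h0, h1, h2] using hdet
  · ext i j
    fin_cases i <;> fin_cases j <;> simp [embed, h0, h1, h2, r0, r1]

/-- The scalar unitary matrices. -/
def scalarU3 (c : Circle) : U3 :=
  ⟨(c : ℂ) • 1, by
    rw [Matrix.mem_unitaryGroup_iff, star_smul, star_one, Matrix.smul_mul, Matrix.mul_smul, one_mul,
      smul_smul]
    have : (c : ℂ) * star (c : ℂ) = 1 := (Complex.mul_conj _).trans (by simp)
    rw [this, one_smul]⟩

theorem lastColLine_scalarU3_mul (c : Circle) (g : U3) :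
    lastColLine (scalarU3 c * g) = lastColLine g := by
  rw [lastColLine, lastColLine, Projectivization.mk_eq_mk_iff']
  refine ⟨(c : ℂ), ?_⟩
  funext i
  simp [scalarU3]

theorem lastColLine_mul_of_col {g k : U3} (h0 : (k : Mat3) 0 2 = 0) (h1 : (k : Mat3) 1 2 = 0)
    (h2 : (k : Mat3) 2 2 = 1) : lastColLine (g * k) = lastColLine g := by
  unfold lastColLine
  congr 1
  funext i
  simp [Matrix.mul_apply, Fin.sum_univ_three, h0, h1, h2]

theorem lastColLine_one : lastColLine 1 = basePoint := by
  unfold lastColLine basePoint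
  congr 1
  funext i
  fin_cases i <;> simp

/-- A unitary matrix whose last column spans the base point is the product of a scalar matrix, of a
matrix `diag(c, 1, 1)` and of an element of `SU(2)`. -/
theorem exists_decomposition {G : U3} (hG : lastColLine G = basePoint) :
    ∃ (m c : Circle) (E : U3), G = scalarU3 m * rotation c * E ∧
      ∃ k ∈ Matrix.specialUnitaryGroup (Fin 2) ℂ, (E : Mat3) = embed k := by
  have hG' := Matrix.UnitaryGroup.star_mul_self G
  obtain ⟨a, ha⟩ := (Projectivization.mk_eq_mk_iff' ℂ _ _ _ _).mp hG
  have g0 : (G : Mat3) 0 2 = 0 := by simpa using (congrFun ha 0).symm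
  have g1 : (G : Mat3) 1 2 = 0 := by simpa using (congrFun ha 1).symm
  have hm : ‖(G : Mat3) 2 2‖ = 1 := by
    have h1 := congrFun (congrFun hG' 2) 2
    simp only [Matrix.mul_apply, Matrix.star_apply, Fin.sum_univ_three, g0, g1, mul_zero, zero_add,
      Matrix.one_apply_eq] at h1
    have h2 : normSq ((G : Mat3) 2 2) = 1 := by
      have := normSq_eq_conj_mul_self (z := (G : Mat3) 2 2)
      exact_mod_cast this.trans h1
    rw [← Complex.sq_norm] at h2
    nlinarith [norm_nonneg ((G : Mat3) 2 2)]
  -- The last column of G is a multiple of e₃, so its last entry has modulus one. Dividing by it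
  -- makes this column equal to e₃.
  let m : Circle := ⟨(G : Mat3) 2 2, by simp [Submonoid.unitSphere, hm]⟩
  have hmv : (m : ℂ) = (G : Mat3) 2 2 := rfl
  let G₁ : U3 := scalarU3 m⁻¹ * G
  have hG₁ : (G₁ : Mat3) = (m : ℂ)⁻¹ • (G : Mat3) := by simp [G₁, scalarU3]
  have hc : ‖(G₁ : Mat3).det‖ = 1 := by
    have h1 : (G₁ : Mat3).det ∈ unitary ℂ := Matrix.det_of_mem_unitary G₁.2
    exact CStarRing.norm_of_mem_unitary h1
  -- The rotation absorbs the remaining determinant, so that E has determinant 1 and fixes e₃.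
  let c : Circle := ⟨(G₁ : Mat3).det, by simp [Submonoid.unitSphere, hc]⟩
  have hcv : (c : ℂ) = (G₁ : Mat3).det := rfl
  have hRm : ∀ c : Circle, (rotation c : Mat3) = Matrix.diagonal ![(c : ℂ), 1, 1] := fun _ => rfl
  have hRd : ∀ c : Circle, (rotation c : Mat3).det = c := fun c => by
    rw [hRm, Matrix.det_diagonal]
    simp [Fin.prod_univ_three]
  let E : U3 := rotation c⁻¹ * G₁
  have hRR : rotation c * rotation c⁻¹ = 1 := by
    refine Subtype.ext ?_
    rw [Submonoid.coe_mul, hRm, hRm, Matrix.diagonal_mul_diagonal]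
    ext i j
    fin_cases i <;> fin_cases j <;> simp
  have hSS : scalarU3 m * scalarU3 m⁻¹ = 1 := by
    refine Subtype.ext ?_
    simp [scalarU3, smul_smul]
  have hE : (E : Mat3) = Matrix.diagonal ![((c⁻¹ : Circle) : ℂ), 1, 1] * (G₁ : Mat3) := rfl
  have hEdet : (E : Mat3).det = 1 := by
    change ((rotation c⁻¹ : Mat3) * (G₁ : Mat3)).det = 1
    rw [Matrix.det_mul, hRd, ← hcv, ← Circle.coe_mul]
    simp
  refine ⟨m, c, E, ?_, _, exists_embed_eq (Matrix.UnitaryGroup.star_mul_self E) hEdet ?_ ?_ ?_⟩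
  · simp only [E, G₁]
    rw [mul_assoc, ← mul_assoc (rotation c), hRR, one_mul, ← mul_assoc, hSS, one_mul]
  · rw [hE, Matrix.diagonal_mul, hG₁]
    simp [g0]
  · rw [hE, Matrix.diagonal_mul, hG₁]
    simp [g1]
  · rw [hE, Matrix.diagonal_mul, hG₁]
    simp [hmv]
    refine inv_mul_cancel₀ fun h => ?_
    rw [h] at hm
    simp at hm

/-- Every conformal Lagrangian immersion through the base point is, up to a rotation
`diag(c, 1, 1)`, framed by an adapted frame that is the identity at the base point. -/
theorem exists_normalized_frame (hΩ : IsOpen Ω) [SimplyConnectedSpace Ω] {z₀ : Ω} {u : Ω → CP2}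
    (hu : u ∈ stationaryImmersions Ω z₀) : ∃ (c : Circle) (f : Ω → U3),
      IsAdapted Ω (matField f) ∧ HarmonicAngle Ω (matField f) ∧ f z₀ = 1 ∧
        ∀ z, u z = lastColLine (rotation c * f z) := by
  obtain ⟨hs, -, hc, hL, hst, h0⟩ := hu
  obtain ⟨F, hF, huF⟩ := exists_adapted_frame hΩ hs hc hL
  have hh := hst.harmonicAngle hΩ hF huF
  obtain ⟨m, c, E, hG, k, hk, hE⟩ := exists_decomposition (G := F z₀) (by rw [← huF, h0])
  have hk' : star k ∈ Matrix.specialUnitaryGroup (Fin 2) ℂ :=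
    (⟨k, hk⟩⁻¹ : Matrix.specialUnitaryGroup (Fin 2) ℂ).2
  have hE' : ((E⁻¹ : U3) : Mat3) = embed (star k) := by
    change star (E : Mat3) = _
    rw [hE]
    ext i j
    fin_cases i <;> fin_cases j <;> simp [embed]
  have hadd := hF.mul_left hΩ (scalarU3 m * rotation c)⁻¹
  refine ⟨c, fun z => (scalarU3 m * rotation c)⁻¹ * F z * E⁻¹, hadd.mul_right hΩ hk' hE',
    HarmonicAngle.mul_right hΩ _ hadd.smooth (hh.mul_left hΩ _ hF.smooth), ?_, fun z => ?_⟩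
  · simp only [hG]
    group
  -- The scalar factor does not change the line and E fixes e₃, so of the three factors at z₀ only
  -- the rotation remains visible.
  · have e : F z = scalarU3 m * (rotation c * ((scalarU3 m * rotation c)⁻¹ * F z * E⁻¹)) * E := by
      group
    have hE2 : ∀ i, (E : Mat3) i 2 = embed k i 2 := fun i => by rw [hE]
    rw [huF z, e, lastColLine_mul_of_col (by rw [hE2]; simp [embed]) (by rw [hE2]; simp [embed])
      (by rw [hE2]; simp [embed]), lastColLine_scalarU3_mul]

end HSLagrangian
end

open scoped ContDiff

noncomputable section

namespace HSLagrangian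

open Set Filter Topology Complex MeasureTheory

/-! ### Uniqueness of frames up to gauge -/

variable {Ω : Set ℂ} {u : Ω → CP2} {f f' : Ω → U3}

theorem IsAdapted.isHorizontalLift (hΩ : IsOpen Ω) (h : IsAdapted Ω (matField f))
    (hu : ∀ z, u z = lastColLine (f z)) :
    IsHorizontalLift Ω (projField u) fun z i => matField f z i 2 where
  smooth := contDiffOn_pi.mpr fun i => h.smooth i 2
  unit z hz := by
    have h2 := congrFun (congrFun (h.unitary z hz) 2) 2
    simpa [Matrix.mul_apply, dotProduct] using h2
  proj z hz := by
    rw [projField_eq hu z hz]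
    ext i j
    rw [mul_lastProj_mul_star_apply]
    rfl
  horizontal z hz X := by
    have e := h.horizontal z hz X
    rw [fderiv_pi fun i => h.smooth.diffMatAt hΩ hz i 2]
    simpa [mc, Matrix.mul_apply, dotProduct, dMat] using e

/-- Two horizontal lifts of the same map that agree at a point are equal. -/
theorem IsHorizontalLift.eq_of_eq {P : ℂ → Mat3} {v w : ℂ → Fin 3 → ℂ} (hΩ : IsOpen Ω)
    (hc : IsPreconnected Ω) (hv : IsHorizontalLift Ω P v) (hw : IsHorizontalLift Ω P w)
    {z₀ : ℂ} (hz₀ : z₀ ∈ Ω) (h₀ : v z₀ = w z₀) {z : ℂ} (hz : z ∈ Ω) : v z = w z := by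
  have loc : ∀ y ∈ Ω, (fun y => star (v y) ⬝ᵥ w y) =ᶠ[𝓝 y] fun _ => star (v y) ⬝ᵥ w y :=
    fun y hy => hv.eventually_dotProduct_eq hΩ hΩ hw hy hy
  have hcst : star (v z) ⬝ᵥ w z = star (v z₀) ⬝ᵥ w z₀ :=
    hΩ.is_const_of_fderiv_eq_zero (𝕜 := ℝ) hc
      (fun y hy => ((loc y hy).differentiableAt_iff.mpr
        (differentiableAt_const _)).differentiableWithinAt)
      (fun y hy => by simp [(loc y hy).fderiv_eq]) hz hz₀
  rw [hv.eq_smul hw.toIsUnitLift hz hz, hcst, ← h₀, hv.unit z₀ hz₀, one_smul]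

/-- The determinant of an adapted frame is the Lagrangian angle along its last column. -/
theorem IsAdapted.det_eq_of_col_eq (hΩ : IsOpen Ω) (h : IsAdapted Ω (matField f))
    (h' : IsAdapted Ω (matField f')) (hu : ∀ z, u z = lastColLine (f z))
    (hu' : ∀ z, u z = lastColLine (f' z))
    (hcol : ∀ z ∈ Ω, ∀ i, matField f z i 2 = matField f' z i 2) (z : Ω) :
    (f z : Mat3).det = (f' z : Mat3).det := by
  have a := (h.isLegendrianFraming hΩ hu).angle z
  have ang := (h'.isLegendrianFraming hΩ hu').angle z
  have hd : ∀ X i, dMat (matField f) z X i 2 = dMat (matField f') z X i 2 := fun X i => by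
    simp only [dMat, Matrix.of_apply]
    rw [Filter.EventuallyEq.fderiv_eq (eventually_of_mem (hΩ.mem_nhds z.2) fun y hy => hcol y hy i)]
  have hp : ∀ i, (f z : Mat3) i 2 = (f' z : Mat3) i 2 := fun i => by
    have := hcol z z.2 i
    rwa [matField_apply f z.2, matField_apply f' z.2] at this
  simp only [hd, hp] at a
  have hm : ((metric u z 1 1 : ℝ) : ℂ) ≠ 0 := by
    rw [h.metric_eq hΩ hu z.2]
    simpa using (h.nondeg z z.2).ne'
  exact mul_left_cancel₀ hm (a.trans ang.symm)

/-- Two frames of the same map whose last columns agree at one point differ by a map with values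
in `SU(2)`. -/
theorem IsAdapted.exists_gauge (hΩ : IsOpen Ω) (hc : IsPreconnected Ω)
    (h : IsAdapted Ω (matField f)) (h' : IsAdapted Ω (matField f'))
    (hu : ∀ z, u z = lastColLine (f z)) (hu' : ∀ z, u z = lastColLine (f' z)) (z₀ : Ω)
    (h₀ : ∀ i, (f z₀ : Mat3) i 2 = (f' z₀ : Mat3) i 2) :
    (∀ z : Ω, (f z : Mat3).det = (f' z : Mat3).det) ∧
    ∃ g : Ω → Matrix.specialUnitaryGroup (Fin 2) ℂ,
      (∀ i j, ContDiffOn ℝ ∞ (zeroExt fun z => (g z : Matrix (Fin 2) (Fin 2) ℂ) i j) Ω) ∧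
      ∀ z : Ω, (f' z : Mat3) = (f z : Mat3) * embed (g z) := by
  -- Both last columns are horizontal lifts of u, so their agreement at z₀ propagates. The
  -- determinants then agree as well, being the Lagrangian angle along a common lift.
  have hcol : ∀ z ∈ Ω, ∀ i, matField f z i 2 = matField f' z i 2 := fun z hz i =>
    congrFun ((h.isHorizontalLift hΩ hu).eq_of_eq hΩ hc (h'.isHorizontalLift hΩ hu') z₀.2
      (funext fun i => by simpa only [matField_apply _ z₀.2] using h₀ i) hz) i
  have hdet := h.det_eq_of_col_eq hΩ h' hu hu' hcol
  refine ⟨hdet, ?_⟩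
  -- The transition matrix f†f' has last column e₃ and determinant 1, hence lies in SU(2).
  let N : ℂ → Mat3 := fun z => star (matField f z) * matField f' z
  have hN : SmoothMatOn N Ω := h.smooth.star.mul h'.smooth
  have hNz : ∀ z : Ω, N z = star (f z : Mat3) * (f' z : Mat3) := fun z => by
    simp only [N, matField_apply _ z.2]
  have hss : ∀ z : Ω, (f z : Mat3) * star (f z : Mat3) = 1 := fun z =>
    Matrix.mem_unitaryGroup_iff.mp (f z).2
  have hs : ∀ z : Ω, star (f z : Mat3) * (f z : Mat3) = 1 := fun z =>
    Matrix.mem_unitaryGroup_iff'.mp (f z).2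
  have hs' : ∀ z : Ω, star (f' z : Mat3) * (f' z : Mat3) = 1 := fun z =>
    Matrix.mem_unitaryGroup_iff'.mp (f' z).2
  have hN2 : ∀ (z : Ω) i, N z i 2 = (1 : Mat3) i 2 := fun z i => by
    rw [← hs z, hNz, Matrix.mul_apply, Matrix.mul_apply]
    refine Finset.sum_congr rfl fun j _ => ?_
    have := hcol z z.2 j
    rw [matField_apply f z.2, matField_apply f' z.2] at this
    rw [this]
  have key := fun z : Ω => exists_embed_eq (N := N z)
    (by
      rw [hNz, star_mul, star_star, mul_assoc, ← mul_assoc _ _ (f' z : Mat3), hss, one_mul, hs'])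
    (by
      rw [hNz, Matrix.det_mul, ← hdet, ← Matrix.det_mul, hs, Matrix.det_one])
    (by simp [hN2]) (by simp [hN2]) (by simp [hN2])
  refine ⟨fun z => ⟨_, (key z).1⟩, fun i j => ?_, fun z => ?_⟩
  · have hc' : ∀ i j : Fin 2, ContDiffOn ℝ ∞
        (fun z => (!![N z 0 0, N z 0 1; N z 1 0, N z 1 1] : Matrix (Fin 2) (Fin 2) ℂ) i j) Ω := by
      intro i j
      fin_cases i <;> fin_cases j
      exacts [hN 0 0, hN 0 1, hN 1 0, hN 1 1]
    exact (hc' i j).congr fun z hz => zeroExt_apply _ hz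
  · change _ = _ * embed !![N z 0 0, N z 0 1; N z 1 0, N z 1 1]
    rw [← (key z).2, hNz, ← mul_assoc, hss, one_mul]

/-! ### Gauge transformations of the extended framing -/

/-- The field of `3 × 3` matrices of a gauge transformation. -/
def gaugeField (g : Ω → Matrix.specialUnitaryGroup (Fin 2) ℂ) : ℂ → Mat3 :=
  fun z => embed (zeroExt (fun w => (g w : Matrix (Fin 2) (Fin 2) ℂ)) z)

theorem gaugeField_apply (g : Ω → Matrix.specialUnitaryGroup (Fin 2) ℂ) {z : ℂ} (hz : z ∈ Ω) :
    gaugeField g z = embed (g ⟨z, hz⟩) := by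
  rw [gaugeField, zeroExt_apply _ hz]

theorem star_embed_mul_embed {k : Matrix (Fin 2) (Fin 2) ℂ}
    (hk : k ∈ Matrix.specialUnitaryGroup (Fin 2) ℂ) : star (embed k) * embed k = 1 := by
  have e : star (embed k) = embed (star k) := by
    ext i j
    fin_cases i <;> fin_cases j <;> simp [embed]
  rw [e, ← embed_mul, Matrix.mem_unitaryGroup_iff'.mp (Matrix.mem_specialUnitaryGroup_iff.mp hk).1,
    embed_one]

theorem unitaryOn_gaugeField (g : Ω → Matrix.specialUnitaryGroup (Fin 2) ℂ) :
    UnitaryOn (gaugeField g) Ω := fun z hz => by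
  rw [gaugeField_apply g hz]
  exact star_embed_mul_embed (g ⟨z, hz⟩).2

theorem smoothMatOn_gaugeField {g : Ω → Matrix.specialUnitaryGroup (Fin 2) ℂ}
    (hg : ∀ i j, ContDiffOn ℝ ∞ (zeroExt fun z => (g z : Matrix (Fin 2) (Fin 2) ℂ) i j) Ω) :
    SmoothMatOn (gaugeField g) Ω := by
  have e : ∀ i j, ContDiffOn ℝ ∞
      (fun z => zeroExt (fun w => (g w : Matrix (Fin 2) (Fin 2) ℂ)) z i j) Ω := fun i j =>
    (hg i j).congr fun z hz => by rw [zeroExt_apply _ hz, zeroExt_apply _ hz]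
  intro i j
  fin_cases i <;> fin_cases j
  exacts [e 0 0, e 0 1, contDiffOn_const, e 1 0, e 1 1, contDiffOn_const, contDiffOn_const,
    contDiffOn_const, contDiffOn_const]

/-- The Maurer–Cartan form of a gauge takes its values in su(2). Its trace vanishes by
differentiation of det g = 1. -/
theorem mc_gaugeField {g : Ω → Matrix.specialUnitaryGroup (Fin 2) ℂ} (hΩ : IsOpen Ω)
    (hg : ∀ i j, ContDiffOn ℝ ∞ (zeroExt fun z => (g z : Matrix (Fin 2) (Fin 2) ℂ) i j) Ω)
    {z : ℂ} (hz : z ∈ Ω) (X : ℂ) :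
    mc (gaugeField g) z X 0 2 = 0 ∧ mc (gaugeField g) z X 1 2 = 0 ∧
    mc (gaugeField g) z X 2 0 = 0 ∧ mc (gaugeField g) z X 2 1 = 0 ∧
    Matrix.trace (mc (gaugeField g) z X) = 0 := by
  have hd := (smoothMatOn_gaugeField hg).diffMatAt hΩ hz
  have d02 : ∀ i : Fin 3, dMat (gaugeField g) z X i 2 = 0 := fun i => by
    fin_cases i <;> simp [dMat, gaugeField, embed]
  have d20 : dMat (gaugeField g) z X 2 0 = 0 := by simp [dMat, gaugeField, embed]
  have d21 : dMat (gaugeField g) z X 2 1 = 0 := by simp [dMat, gaugeField, embed]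
  obtain ⟨k00, k01, k10, k11⟩ := conj_apply_of_mem_specialUnitaryGroup (g ⟨z, hz⟩).2
  have ht : gaugeField g z 1 1 * dMat (gaugeField g) z X 0 0
      + gaugeField g z 0 0 * dMat (gaugeField g) z X 1 1
      - gaugeField g z 0 1 * dMat (gaugeField g) z X 1 0
      - gaugeField g z 1 0 * dMat (gaugeField g) z X 0 1 = 0 := by
    have hc : (fun w => gaugeField g w 0 0 * gaugeField g w 1 1
        - gaugeField g w 0 1 * gaugeField g w 1 0) =ᶠ[𝓝 z] fun _ => 1 :=
      eventually_of_mem (hΩ.mem_nhds hz) fun w hw => by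
        have := (Matrix.mem_specialUnitaryGroup_iff.mp (g ⟨w, hw⟩).2).2
        rw [Matrix.det_fin_two] at this
        simpa [gaugeField_apply g hw, embed] using this
    have h1 := (((hd 0 0).hasFDerivAt.mul (hd 1 1).hasFDerivAt).sub
      ((hd 0 1).hasFDerivAt.mul (hd 1 0).hasFDerivAt)).fderiv
    have h2 := congrArg (fun L => L X) (h1.symm.trans hc.fderiv_eq)
    simp at h2
    simp only [dMat, Matrix.of_apply]
    linear_combination h2
  refine ⟨?_, ?_, ?_, ?_, ?_⟩
  · simp [mc, Matrix.mul_apply, d02]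
  · simp [mc, Matrix.mul_apply, d02]
  · simp [mc, Matrix.mul_apply, Fin.sum_univ_three, d20, gaugeField, embed]
  · simp [mc, Matrix.mul_apply, Fin.sum_univ_three, d21, gaugeField, embed]
  · rw [gaugeField_apply g hz] at ht
    simp only [mc, Matrix.trace_fin_three, Matrix.mul_apply, Fin.sum_univ_three, d02, d20, d21,
      mul_zero, add_zero, Matrix.star_apply, gaugeField_apply g hz]
    simp [embed] at ht ⊢
    rw [k00, k01, k10, k11]
    linear_combination ht

/-- Insertion of the parameter adds a scalar matrix to the block and rotates the argument in the
last row and column. Both operations commute with conjugation by diag(k, 1), and the gauge term B is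
traceless and supported in the block. A gauge found at λ = 1 therefore works for all λ. -/
theorem twistForm_gauge {A B : ℂ → Mat3} {k : Matrix (Fin 2) (Fin 2) ℂ}
    (hk : k ∈ Matrix.specialUnitaryGroup (Fin 2) ℂ)
    (h02 : ∀ X, B X 0 2 = 0) (h12 : ∀ X, B X 1 2 = 0) (h20 : ∀ X, B X 2 0 = 0)
    (h21 : ∀ X, B X 2 1 = 0) (hB : ∀ X, Matrix.trace (B X) = 0) (c X : ℂ) :
    twistForm (fun Y => star (embed k) * A Y * embed k + B Y) c X
      = star (embed k) * twistForm A c X * embed k + B X := by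
  have hs := star_embed_mul_embed hk
  have hs' := mul_eq_one_comm.mp hs
  have ht : ∀ Y, Matrix.trace (star (embed k) * A Y * embed k + B Y) = Matrix.trace (A Y) :=
    fun Y => by
      rw [Matrix.trace_add, hB, add_zero, Matrix.trace_mul_comm, ← mul_assoc, hs', one_mul]
  have e := fun i j => congrFun (congrFun hs i) j
  have e00 := e 0 0
  have e01 := e 0 1
  have e10 := e 1 0
  have e11 := e 1 1
  simp [embed, Matrix.mul_apply, Fin.sum_univ_three] at e00 e01 e10 e11
  rw [twistForm]
  simp only [ht]
  rw [twistForm]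
  generalize (Matrix.trace (A (c ^ 2 * X)) - Matrix.trace (A X)) / 2 = δ
  ext i j
  fin_cases i <;> fin_cases j <;>
    simp [embed, Matrix.mul_apply, Fin.sum_univ_three, h02, h12, h20, h21]
  · linear_combination (-δ) * e00
  · linear_combination (-δ) * e01
  · linear_combination (-δ) * e10
  · linear_combination (-δ) * e11

variable {z₀ : Ω} {F F' : Ω → twistedLoopGroup}

theorem atParam_base (h : IsExtendedFraming z₀ F) (l : Circle) : atParam F l z₀ = 1 := by
  rw [atParam, h.base]
  rfl

/-- A gauge transformation between the values at `λ = 1` is one between the extended framings. -/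
theorem IsExtendedFraming.gauge_of_gauge_one (hΩ : IsOpen Ω) (hc : IsPreconnected Ω)
    (h : IsExtendedFraming z₀ F) (h' : IsExtendedFraming z₀ F')
    {g : Ω → Matrix.specialUnitaryGroup (Fin 2) ℂ}
    (hg : ∀ i j, ContDiffOn ℝ ∞ (zeroExt fun z => (g z : Matrix (Fin 2) (Fin 2) ℂ) i j) Ω)
    (h1 : ∀ z : Ω, (atParam F' 1 z : Mat3) = (atParam F 1 z : Mat3) * embed (g z))
    (l : Circle) (z : Ω) : (atParam F' l z : Mat3) = (atParam F l z : Mat3) * embed (g z) := by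
  have hN := smoothMatOn_gaugeField hg
  have hNU := unitaryOn_gaugeField g
  have hmul : ∀ l : Circle, ∀ z ∈ Ω, ∀ X,
      mc (fun w => matField (atParam F l) w * gaugeField g w) z X
        = star (gaugeField g z) * mc (matField (atParam F l)) z X * gaugeField g z
          + mc (gaugeField g) z X := fun l z hz X =>
    mc_mul ((smoothMatOn_atParam h.smooth l).diffMatAt hΩ hz) (hN.diffMatAt hΩ hz)
      (unitaryOn_matField _ z hz) X
  have hone : ∀ z ∈ Ω, matField (atParam F' 1) z = matField (atParam F 1) z * gaugeField g z :=
    fun z hz => by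
      rw [matField_apply _ hz, matField_apply _ hz, gaugeField_apply g hz, h1]
  have hbase : embed (g z₀) = 1 := by
    have := h1 z₀
    rwa [atParam_base h, atParam_base h', OneMemClass.coe_one, one_mul, eq_comm] at this
  have := eq_of_mc_eq hΩ hc (M := matField (atParam F' l))
    (N := fun w => matField (atParam F l) w * gaugeField g w)
    (fun z hz => (smoothMatOn_atParam h'.smooth l).diffMatAt hΩ hz)
    (fun z hz => ((smoothMatOn_atParam h.smooth l).mul hN).diffMatAt hΩ hz)
    (unitaryOn_matField _)
    (fun z hz => by
      rw [star_mul, mul_assoc, ← mul_assoc _ _ (gaugeField g z), unitaryOn_matField _ z hz,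
        one_mul, hNU z hz])
    (fun z hz X => by
      have hm := fun Y => mc_gaugeField hΩ hg hz Y
      have e : mc (matField (atParam F' 1)) z = fun Y =>
          star (gaugeField g z) * mc (matField (atParam F 1)) z Y * gaugeField g z
            + mc (gaugeField g) z Y :=
        funext fun Y => (mc_congr_on hΩ hone hz Y).trans (hmul 1 z hz Y)
      rw [hmul l z hz, h'.mc_eq_twistForm hΩ l hz, h.mc_eq_twistForm hΩ l hz, e,
        gaugeField_apply g hz]
      exact twistForm_gauge (g ⟨z, hz⟩).2 (fun Y => (hm Y).1) (fun Y => (hm Y).2.1)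
        (fun Y => (hm Y).2.2.1) (fun Y => (hm Y).2.2.2.1) (fun Y => (hm Y).2.2.2.2) _ _)
    z₀.2
    (by
      simp only [matField_apply _ z₀.2, gaugeField_apply g z₀.2, Subtype.coe_eta, hbase, mul_one]
      rw [atParam_base h, atParam_base h'])
    z.2
  simpa only [matField_apply _ z.2, gaugeField_apply g z.2, Subtype.coe_eta] using this

/-- An extended framing is determined by its value at `λ = 1`. -/
theorem IsExtendedFraming.eq_of_atParam_one_eq (hΩ : IsOpen Ω) (hc : IsPreconnected Ω)
    (h : IsExtendedFraming z₀ F) (h' : IsExtendedFraming z₀ F') (h1 : atParam F 1 = atParam F' 1) :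
    F = F' := by
  funext z
  apply Subtype.ext
  ext1 l
  apply Subtype.ext
  have := eq_of_mc_eq hΩ hc (M := matField (atParam F l)) (N := matField (atParam F' l))
    (fun z hz => (smoothMatOn_atParam h.smooth l).diffMatAt hΩ hz)
    (fun z hz => (smoothMatOn_atParam h'.smooth l).diffMatAt hΩ hz)
    (unitaryOn_matField _) (unitaryOn_matField _)
    (fun z hz X => by rw [h.mc_eq_twistForm hΩ l hz, h'.mc_eq_twistForm hΩ l hz, h1]) z₀.2
    (by rw [matField_apply _ z₀.2, matField_apply _ z₀.2, Subtype.coe_eta, atParam_base h,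
      atParam_base h']) z.2
  rwa [matField_apply _ z.2, matField_apply _ z.2] at this

theorem coe_rotation (c : Circle) : (rotation c : Mat3) = Matrix.diagonal ![(c : ℂ), 1, 1] := rfl

/-- Extended framings that give the same immersion have the same parameter and are gauge
equivalent. -/
theorem eq_and_gaugeEquivalent (hΩ : IsOpen Ω) (hc : IsPreconnected Ω) {c c' : Circle}
    {F F' : ExtendedFraming z₀}
    (h : ∀ z, lastColLine (rotation c * atParam F.1 1 z)
      = lastColLine (rotation c' * atParam F'.1 1 z)) : c = c' ∧ GaugeEquivalent z₀ F F' := by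
  -- At z₀ the frames are the two rotations, whose last columns are both e₃. The lifts agree there,
  -- and comparing determinants at z₀ gives c = c'.
  obtain ⟨hdet, g, hg, hfg⟩ := ((F.2.isAdapted hΩ).mul_left hΩ (rotation c)).exists_gauge hΩ hc
    ((F'.2.isAdapted hΩ).mul_left hΩ (rotation c')) (fun _ => rfl) h z₀ (fun i => by
      rw [atParam_base F.2, atParam_base F'.2, mul_one, mul_one, coe_rotation, coe_rotation]
      fin_cases i <;> simp)
  have hcc : c = c' := by
    have := hdet z₀
    rw [atParam_base F.2, atParam_base F'.2, mul_one, mul_one, coe_rotation, coe_rotation,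
      Matrix.det_diagonal, Matrix.det_diagonal] at this
    exact Subtype.ext (by simpa [Fin.prod_univ_three] using this)
  subst hcc
  refine ⟨rfl, g, hg, F.2.gauge_of_gauge_one hΩ hc F'.2 hg fun z => ?_⟩
  have hr : star (rotation c : Mat3) * (rotation c : Mat3) = 1 :=
    Matrix.mem_unitaryGroup_iff'.mp (rotation c).2
  have := congrArg (star (rotation c : Mat3) * ·) (hfg z)
  simpa only [Submonoid.coe_mul, ← mul_assoc, hr, one_mul] using this

theorem IsAdapted.mem_stationaryImmersions (hΩ : IsOpen Ω) (h : IsAdapted Ω (matField f))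
    (hh : HarmonicAngle Ω (matField f)) (h₀ : lastColLine (f z₀) = basePoint) :
    (fun z => lastColLine (f z)) ∈ stationaryImmersions Ω z₀ :=
  ⟨h.isSmooth fun _ => rfl, h.isImmersion hΩ fun _ => rfl, h.isConformal hΩ fun _ => rfl,
    h.isLagrangian hΩ fun _ => rfl, hh.isHamiltonianStationary hΩ h fun _ => rfl, h₀⟩

theorem lastColLine_rotation (c : Circle) : lastColLine (rotation c) = basePoint := by
  rw [← lastColLine_one, ← mul_one (rotation c)]
  unfold lastColLine
  congr 1
  funext i
  fin_cases i <;> simp [coe_rotation]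

end HSLagrangian
end

/-! ### The two bijections. -/

open HSLagrangian

theorem theorem1p6 (Ω : Set ℂ) (hΩ : IsOpen Ω) (hsc : SimplyConnectedSpace Ω) (z₀ : Ω) :
    Set.BijOn (fun F : Ω → HSLagrangian.twistedLoopGroup => HSLagrangian.atParam F 1)
      {F | HSLagrangian.IsExtendedFraming z₀ F}
      {f | f z₀ = 1 ∧
        ∃ u ∈ HSLagrangian.stationaryImmersions Ω z₀, HSLagrangian.IsLegendrianFraming u f} ∧
    Set.BijOn (HSLagrangian.toImmersion z₀) Set.univ
      (HSLagrangian.stationaryImmersions Ω z₀) := by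
  have hc : IsPreconnected Ω := isPreconnected_of_simplyConnectedSpace
  refine ⟨⟨fun F hF => ?_, fun F hF F' hF' h => hF.eq_of_atParam_one_eq hΩ hc hF' h, ?_⟩, ?_, ?_, ?_⟩
  · have hA := IsExtendedFraming.isAdapted hΩ hF
    have hb := atParam_base hF 1
    exact ⟨hb, _, hA.mem_stationaryImmersions hΩ (IsExtendedFraming.harmonicAngle hΩ hF)
      (by rw [hb, lastColLine_one]), hA.isLegendrianFraming hΩ fun _ => rfl⟩
  · rintro f ⟨h₀, u, ⟨-, -, hconf, -, hstat, -⟩, hf⟩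
    have hA := hf.isAdapted hΩ hconf
    obtain ⟨F, hF, h⟩ := hA.exists_extendedFraming hΩ (hstat.harmonicAngle hΩ hA hf.lift) h₀
    exact ⟨F, hF, h⟩
  · rintro ⟨c, q⟩ -
    induction q using Quotient.inductionOn with
    | h F =>
      have hA := F.2.isAdapted hΩ
      exact (hA.mul_left hΩ (rotation c)).mem_stationaryImmersions hΩ
        ((F.2.harmonicAngle hΩ).mul_left hΩ _ hA.smooth)
        (by rw [atParam_base F.2, mul_one, lastColLine_rotation])
  · rintro ⟨c, q⟩ - ⟨c', q'⟩ - h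
    induction q using Quotient.inductionOn with
    | h F =>
      induction q' using Quotient.inductionOn with
      | h F' =>
        obtain ⟨hcc, hg⟩ := eq_and_gaugeEquivalent hΩ hc (F := F) (F' := F') (congrFun h)
        exact Prod.ext hcc (Quotient.sound hg)
  · intro u hu
    obtain ⟨c, f, hA, hh, h₀, huf⟩ := exists_normalized_frame hΩ hu
    obtain ⟨F, hF, rfl⟩ := hA.exists_extendedFraming hΩ hh h₀
    exact ⟨(c, Quotient.mk _ ⟨F, hF⟩), trivial, funext fun z => (huf z).symm⟩
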